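/- **Theorem 4.4.** Let $1<\alpha<2$, $x_L<x_R$, $T>0$, $\kappa_\alpha\ge 0$. Consider $$\partial_t u=d_+(x)\,{}_{x_L}D_x^{\alpha}u+d_-(x)\,{}_xD_{x_R}^{\alpha}u+f(x,t),\quad x_L<x<x_R,\ 0<t\le T, \qquad u(x,0)=u_0(x),\quad u(x_L,t)=u(x_R,t)=0, \tag{3.1}$$ with Riemann–Liouville derivatives, where $d_+$ is nonnegative and bounded on $(x_L,x_R)$ and $d_-=\kappa_\alpha d_+$. For $w:(x_L,x_R)\to\mathbb R$ and $\beta>0$ call $w$ *$\beta$-regular* if its extension $\tilde w$ by zero to $\mathbb R$ is continuous, with $n=\lfloor\beta\rfloor+1$ the fractional integrals of order $n-\beta$ of $\tilde w$ from $-\infty$ and from $+\infty$ are $C^n$, and $\tilde w$, ${}_{-\infty}D_x^{\beta}\tilde w$, ${}_xD_\infty^{\beta}\tilde w$ and their Fourier transforms belong to $L^1(\mathbb R)$. Suppose that the exact solution $u$ of (3.1) is three times continuously differentiable in $t\in[0,T]$ for each $x\in(x_L,x_R)$, and that for every $t\in[0,T]$ the function $u(\cdot,t)$ is $(\alpha+4)$-regular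 and $\partial_t^2u(\cdot,t)$, $\partial_t^3u(\cdot,t)$ are $\alpha$-regular, the $L^1$ norms of all these Fourier transforms being bounded uniformly in $t$. Let $g_0=1$, $g_k=(1-\frac{\alpha+1}{k})g_{k-1}$, let $q_k=(\frac32)^\alpha\sum_{m=0}^k3^{-m}g_mg_{k-m}$ for $k\ge0$ (the coefficients of $(\frac32-2\zeta+\frac12\zeta^2)^\alpha$) and $q_k=0$ for $k<0$. For an integer $p$ let $A_p=(q_{i-j+p})_{1\le i,j\le N_x-1}$, and for integers $p,q,r,s$ $$A_{p,q}=\tfrac{q}{q-p}A_p+\tfrac{p}{p-q}A_q,\qquad A_{p,q,r,s}=\tfrac{3rs+2\alpha}{3(rs-pq)}A_{p,q}+\tfrac{3pq+2\alpha}{3(pq-rs)}A_{r,s},$$ $$A_\alpha=\tfrac{a\bar b}{a\bar b-\bar ab}A_{p,q,r,s}+\tfrac{\bar ab}{\bar ab-a\bar b}A_{\bar p,\bar q,\bar r,\bar s},$$ where $a=rs-pq$, $b=6pqrs(r+s-p-q)+4\alpha[rs(r+s)-pq(p+q)]+9\alpha(rs-pq)$, and $\bar a,\bar b$ are the same expressions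 in $\bar p,\bar q,\bar r,\bar s$. Let $(p,q,r,s,\bar p,\bar q,\bar r,\bar s)$ be either $(1,2,1,-2,1,\bar q,1,\bar s)$ with integers $|\bar q|,|\bar s|\ge2$, $\bar q\bar s<0$, $(\bar q,\bar s)\ne(2,-2)$, or one of $(1,2,1,0,1,2,1,-2)$, $(1,2,1,0,1,-1,1,-2)$, $(1,2,1,-1,1,2,1,-2)$, $(1,2,1,-1,1,-1,1,-2)$, $(1,0,1,-1,1,2,1,-2)$, $(1,0,1,-2,1,2,1,-2)$, $(1,-1,1,-2,1,2,1,-2)$, and suppose $a\bar b\ne\bar ab$. Then there is a constant $C>0$ such that for all integers $N_x,N_t\ge1$, with $h=(x_R-x_L)/N_x$, $\tau=T/N_t$, $x_i=x_L+ih$, $t_n=n\tau$, $D_\pm=\mathrm{diag}(d_\pm(x_1),\dots,d_\pm(x_{N_x-1}))$ and $F^{n+1/2}=(f(x_i,t_n+\tau/2))_{1\le i\le N_x-1}$, the Crank–Nicolson/WSLD scheme $$\Big[I-\tfrac{\tau}{2h^\alpha}(D_+A_\alpha+D_-A_\alpha^{T})\Big]U^{n+1}=\Big[I+\tfrac{\tau}{2h^\alpha}(D_+A_\alpha+D_-A_\alpha^{T})\Big]U^{n}+\tau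 F^{n+1/2},\quad 0\le n<N_t,\qquad U^0_i=u_0(x_i), \tag{3.7}$$ has a unique solution $U^n=(u_1^n,\dots,u_{N_x-1}^n)$, $0\le n\le N_t$, and $$\Big(h\sum_{i=1}^{N_x-1}|u(x_i,t_n)-u_i^n|^2\Big)^{1/2}\le C(\tau^2+h^4),\qquad n=0,1,\dots,N_t.$$ -/

import Mathlib

open Set MeasureTheory
open scoped FourierTransform Matrix

namespace WSLD

noncomputable section

/-! ### Riemann-Liouville derivatives -/

/-- The left fractional integral of order `n - β` of `w` at `x`, `n = ⌊β⌋ + 1`, where the integration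
is over the part of the interval `I` lying to the left of `x`. -/
def leftIntegral (I : Set ℝ) (β : ℝ) (w : ℝ → ℝ) (x : ℝ) : ℝ :=
  (Real.Gamma ((⌊β⌋₊ + 1 : ℕ) - β))⁻¹ *
    ∫ ξ in I ∩ Iio x, (x - ξ) ^ (((⌊β⌋₊ + 1 : ℕ) : ℝ) - β - 1) * w ξ

/-- The right fractional integral of order `n - β` of `w` at `x`, `n = ⌊β⌋ + 1`, where the integration
is over the part of the interval `I` lying to the right of `x`. -/
def rightIntegral (I : Set ℝ) (β : ℝ) (w : ℝ → ℝ) (x : ℝ) : ℝ :=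
  (Real.Gamma ((⌊β⌋₊ + 1 : ℕ) - β))⁻¹ *
    ∫ ξ in I ∩ Ioi x, (ξ - x) ^ (((⌊β⌋₊ + 1 : ℕ) : ℝ) - β - 1) * w ξ

/-- Left Riemann-Liouville derivative of order `β` on the interval `I`: for `I = Ioo a b` the lower
limit is `a`, for `I = univ` it is `-∞`. -/
def leftRL (I : Set ℝ) (β : ℝ) (w : ℝ → ℝ) (x : ℝ) : ℝ :=
  iteratedDeriv (⌊β⌋₊ + 1) (leftIntegral I β w) x

/-- Right Riemann-Liouville derivative of order `β` on the interval `I`: for `I = Ioo a b` the upper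
limit is `b`, for `I = univ` it is `+∞`. -/
def rightRL (I : Set ℝ) (β : ℝ) (w : ℝ → ℝ) (x : ℝ) : ℝ :=
  (-1) ^ (⌊β⌋₊ + 1) * iteratedDeriv (⌊β⌋₊ + 1) (rightIntegral I β w) x

/-! ### The equation and the smoothness of its solution -/

/-- `u` solves `∂ₜu = d₊(x) D₊^α u + d₋(x) D₋^α u + f(x,t)` for `xL < x < xR`, `0 < t ≤ T`, with
left and right Riemann-Liouville derivatives on `(xL, xR)`, with initial value `u₀` and zero
boundary values. -/
structure IsExactSolution (α xL xR T : ℝ) (dp dm : ℝ → ℝ) (f : ℝ → ℝ → ℝ) (u₀ : ℝ → ℝ)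
    (u : ℝ → ℝ → ℝ) : Prop where
  pde : ∀ x ∈ Ioo xL xR, ∀ t ∈ Ioc 0 T,
    derivWithin (u x) (Icc 0 T) t =
      dp x * leftRL (Ioo xL xR) α (fun y => u y t) x +
      dm x * rightRL (Ioo xL xR) α (fun y => u y t) x + f x t
  initial : ∀ x ∈ Ioo xL xR, u x 0 = u₀ x
  boundary : ∀ t ∈ Icc 0 T, u xL t = 0 ∧ u xR t = 0

/-- `w` is continuous, the Riemann-Liouville derivatives of order `β` of `w` on the whole line exist,
and `w`, these derivatives and their Fourier transforms belong to `L¹(ℝ)`, where the `L¹` norms of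
the Fourier transforms are at most `M`. -/
structure FracRegular (β M : ℝ) (w : ℝ → ℝ) : Prop where
  continuous : Continuous w
  integrable : Integrable w
  integrable_fourier : Integrable (𝓕 (fun x => (w x : ℂ)))
  fourier_le : ∫ ξ, ‖𝓕 (fun x => (w x : ℂ)) ξ‖ ≤ M
  left_contDiff : ContDiff ℝ (⌊β⌋₊ + 1 : ℕ) (leftIntegral univ β w)
  left_integrable : Integrable (leftRL univ β w)
  left_integrable_fourier : Integrable (𝓕 (fun x => (leftRL univ β w x : ℂ)))
  left_fourier_le : ∫ ξ, ‖𝓕 (fun x => (leftRL univ β w x : ℂ)) ξ‖ ≤ M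
  right_contDiff : ContDiff ℝ (⌊β⌋₊ + 1 : ℕ) (rightIntegral univ β w)
  right_integrable : Integrable (rightRL univ β w)
  right_integrable_fourier : Integrable (𝓕 (fun x => (rightRL univ β w x : ℂ)))
  right_fourier_le : ∫ ξ, ‖𝓕 (fun x => (rightRL univ β w x : ℂ)) ξ‖ ≤ M

/-- Extension by zero from `(xL, xR)` to the real line. -/
def zeroExt (xL xR : ℝ) (w : ℝ → ℝ) : ℝ → ℝ := (Ioo xL xR).indicator w

/-- Smoothness of the exact solution: three times continuously differentiable in time on `[0, T]`;
the zero extension of `u(·,t)` has regular fractional derivatives of order `α + 4`, those of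
`∂ₜ²u(·,t)` and `∂ₜ³u(·,t)` have regular fractional derivatives of order `α`, uniformly in `t`. -/
structure IsSmoothSolution (α xL xR T : ℝ) (u : ℝ → ℝ → ℝ) : Prop where
  time : ∀ x ∈ Ioo xL xR, ContDiffOn ℝ 3 (u x) (Icc 0 T)
  space : ∃ M : ℝ, ∀ t ∈ Icc 0 T,
    FracRegular (α + 4) M (zeroExt xL xR (fun x => u x t)) ∧
    FracRegular α M (zeroExt xL xR (fun x => iteratedDerivWithin 2 (u x) (Icc 0 T) t)) ∧
    FracRegular α M (zeroExt xL xR (fun x => iteratedDerivWithin 3 (u x) (Icc 0 T) t))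

/-! ### Lubich coefficients and the WSLD matrices -/

/-- The power series coefficients of `(1 - ζ)^α`. -/
def grunwaldCoeff (α : ℝ) : ℕ → ℝ
  | 0 => 1
  | k + 1 => (1 - (α + 1) / ((k : ℝ) + 1)) * grunwaldCoeff α k

/-- The power series coefficients of `(3/2 - 2ζ + ζ²/2)^α`, with value `0` at negative indices. -/
def lubichCoeff (α : ℝ) (k : ℤ) : ℝ :=
  if k < 0 then 0 else
    (3 / 2 : ℝ) ^ α * ∑ m ∈ Finset.range (k.toNat + 1),
      ((3 : ℝ) ^ m)⁻¹ * grunwaldCoeff α m * grunwaldCoeff α (k.toNat - m)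

/-- The matrix of Lubich's operator shifted by `p` (times `h^α`) on the `N - 1` interior points. -/
def lubichMatrix (α : ℝ) (N : ℕ) (p : ℤ) : Matrix (Fin (N - 1)) (Fin (N - 1)) ℝ :=
  Matrix.of fun i j => lubichCoeff α ((i : ℤ) - (j : ℤ) + p)

/-- The second order combination with shifts `p`, `q`. -/
def matrix₂ (α : ℝ) (N : ℕ) (p q : ℤ) : Matrix (Fin (N - 1)) (Fin (N - 1)) ℝ :=
  ((q : ℝ) / (q - p)) • lubichMatrix α N p + ((p : ℝ) / (p - q)) • lubichMatrix α N q

/-- The third order combination with shifts `p`, `q`, `r`, `s`. -/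
def matrix₃ (α : ℝ) (N : ℕ) (p q r s : ℤ) : Matrix (Fin (N - 1)) (Fin (N - 1)) ℝ :=
  ((3 * r * s + 2 * α) / (3 * ((r : ℝ) * s - p * q))) • matrix₂ α N p q +
  ((3 * p * q + 2 * α) / (3 * ((p : ℝ) * q - r * s))) • matrix₂ α N r s

/-- The eight integer shifts `(p, q, r, s, p̄, q̄, r̄, s̄)`. -/
structure Shifts where
  p : ℤ
  q : ℤ
  r : ℤ
  s : ℤ
  pb : ℤ
  qb : ℤ
  rb : ℤ
  sb : ℤ

/-- The quantity `a_{p,q,r,s} = rs - pq`. -/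
def aCoeff (p q r s : ℤ) : ℝ := (r : ℝ) * s - p * q

/-- The quantity `b_{p,q,r,s}`. -/
def bCoeff (α : ℝ) (p q r s : ℤ) : ℝ :=
  6 * (p : ℝ) * q * r * s * (r + s - p - q) +
    4 * α * ((r : ℝ) * s * (r + s) - p * q * (p + q)) + 9 * α * ((r : ℝ) * s - p * q)

/-- The product `a b̄`. -/
def Shifts.ab (σ : Shifts) (α : ℝ) : ℝ :=
  aCoeff σ.p σ.q σ.r σ.s * bCoeff α σ.pb σ.qb σ.rb σ.sb

/-- The product `ā b`. -/
def Shifts.ba (σ : Shifts) (α : ℝ) : ℝ :=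
  aCoeff σ.pb σ.qb σ.rb σ.sb * bCoeff α σ.p σ.q σ.r σ.s

/-- The fourth order WSLD matrix `A_α` on the `N - 1` interior points. -/
def Shifts.matrix (σ : Shifts) (α : ℝ) (N : ℕ) : Matrix (Fin (N - 1)) (Fin (N - 1)) ℝ :=
  (σ.ab α / (σ.ab α - σ.ba α)) • matrix₃ α N σ.p σ.q σ.r σ.s +
  (σ.ba α / (σ.ba α - σ.ab α)) • matrix₃ α N σ.pb σ.qb σ.rb σ.sb

/-- The effective choices of the shifts: `(1,2,1,-2,1,q̄,1,s̄)` with `|q̄|, |s̄| ≥ 2`, `q̄ s̄ < 0` and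
`(q̄,s̄) ≠ (2,-2)`, and seven further octuples. -/
def Shifts.Effective (σ : Shifts) : Prop :=
  (∃ qb sb : ℤ, 2 ≤ |qb| ∧ 2 ≤ |sb| ∧ qb * sb < 0 ∧ (qb, sb) ≠ (2, -2) ∧
    σ = ⟨1, 2, 1, -2, 1, qb, 1, sb⟩) ∨
  σ = ⟨1, 2, 1, 0, 1, 2, 1, -2⟩ ∨
  σ = ⟨1, 2, 1, 0, 1, -1, 1, -2⟩ ∨
  σ = ⟨1, 2, 1, -1, 1, 2, 1, -2⟩ ∨
  σ = ⟨1, 2, 1, -1, 1, -1, 1, -2⟩ ∨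
  σ = ⟨1, 0, 1, -1, 1, 2, 1, -2⟩ ∨
  σ = ⟨1, 0, 1, -2, 1, 2, 1, -2⟩ ∨
  σ = ⟨1, -1, 1, -2, 1, 2, 1, -2⟩

/-- The weights of the fourth order combination are defined: `a b̄ ≠ ā b`. -/
def Shifts.Nondegenerate (σ : Shifts) (α : ℝ) : Prop := σ.ab α ≠ σ.ba α

/-! ### The scheme -/

/-- The interior mesh points `x_{i+1} = xL + (i + 1) h`, `h = (xR - xL) / Nx`, `0 ≤ i < Nx - 1`. -/
def gridPoint (xL xR : ℝ) (Nx : ℕ) (i : Fin (Nx - 1)) : ℝ :=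
  xL + ((i : ℝ) + 1) * ((xR - xL) / Nx)

/-- The spatial matrix `h^{-α} (D₊ A_α + D₋ A_αᵀ)`. -/
def spatialMatrix (α : ℝ) (σ : Shifts) (xL xR : ℝ) (dp dm : ℝ → ℝ) (Nx : ℕ) :
    Matrix (Fin (Nx - 1)) (Fin (Nx - 1)) ℝ :=
  (((xR - xL) / Nx) ^ α)⁻¹ •
    (Matrix.diagonal (fun i => dp (gridPoint xL xR Nx i)) * σ.matrix α Nx +
      Matrix.diagonal (fun i => dm (gridPoint xL xR Nx i)) * (σ.matrix α Nx)ᵀ)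

/-- `U⁰, …, U^{Nt}` solve the Crank-Nicolson scheme
`(I - (τ/2) S) U^{n+1} = (I + (τ/2) S) U^n + τ F^{n+1/2}`, `S = h^{-α} (D₊ A_α + D₋ A_αᵀ)`,
with `τ = T / Nt` and the initial values `U⁰_i = u₀(x_i)`. -/
structure IsSchemeSolution (α : ℝ) (σ : Shifts) (xL xR T : ℝ) (dp dm : ℝ → ℝ) (f : ℝ → ℝ → ℝ)
    (u₀ : ℝ → ℝ) (Nx Nt : ℕ) (U : Fin (Nt + 1) → Fin (Nx - 1) → ℝ) : Prop where
  initial : ∀ i, U 0 i = u₀ (gridPoint xL xR Nx i)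
  step : ∀ n : Fin Nt,
    (1 - (T / Nt / 2) • spatialMatrix α σ xL xR dp dm Nx) *ᵥ U n.succ =
      (1 + (T / Nt / 2) • spatialMatrix α σ xL xR dp dm Nx) *ᵥ U n.castSucc +
        (T / Nt) • fun i => f (gridPoint xL xR Nx i) (((n : ℝ) + 1 / 2) * (T / Nt))

/-- The discrete 2-norm `(h ∑ᵢ vᵢ²)^{1/2}` of a grid function with mesh size `h`. -/
def discreteNorm (h : ℝ) {N : ℕ} (v : Fin N → ℝ) : ℝ :=
  Real.sqrt (h * ∑ i, v i ^ 2)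

end

end WSLD

namespace WSLD

noncomputable section

/-! ### Generating functions of the Grünwald and Lubich coefficients -/

/-! Let W(θ) = 3/2 - 2ζ + ζ²/2 at ζ = e^{-iθ}. The matrix A_α is a finite section of the Toeplitz
operator with symbol Φ(θ) = T(θ) W(θ)^α, where the trigonometric polynomial T collects the weighted
shifts (`Shifts.hasSum_symbol`). Two properties of Φ drive the proof.

Sign: Re Φ ≤ 0 (`Shifts.Effective.symbol_re_nonpos`). Integrating Φ against |∑ v_j e^{-ijθ}|² then
makes A_α negative semidefinite (`toeplitz_form_nonpos`). By conjugation one may take sin θ ≥ 0, so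
that W lies in the closed first quadrant. `re_mul_cpow_nonpos` reduces the sign for a T affine in α
to conditions at the exponents 1 and 2, which become polynomial inequalities in u = 1 - cos θ. For
shifts among 0, ±1, ±2, T depends on one further parameter ρ, which may be pushed to an endpoint
affine in α. For the infinite family, z^q and z^s are replaced by their quadratic interpolants in
the exponent at the nodes 1, 2, -2. What is left is a convex combination of divided differences,
bounded uniformly in q and s by `norm_divDiff_le`.

Order: Φ(θ) - (iθ)^α = O(|θ|^{α+4}), because the expansions of T and of (W/(iθ))^α cancel through
third order (`Shifts.Effective.symbol_sub_isBigO`). A Riemann-Liouville derivative multiplies the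
Fourier transform by (2πiξ)^β. This is proved through Laplace transforms on Re s = ε and the limit ε
→ 0, since the fractional integral itself need not be integrable. Hence the difference operators are
fourth order accurate on (α+4)-regular functions and bounded on α-regular ones
(`Shifts.Effective.consistency`).

Since d_- = κ d_+, the spatial matrix is diag(d_+) B with B negative semidefinite, but d_+ varies
and may vanish, so the Euclidean energy is unsuitable. `energy_le` writes the error as e = d z and
controls ∑ d z². The time truncation error carries no factor d, so `error_le` first subtracts its
accumulated sum. This requires B applied to that truncation error to be small, which is where the
spatial regularity of ∂_t³u enters. Semidefiniteness of B also makes the implicit matrix invertible.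
-/

theorem ring_choose_succ (a : ℝ) (k : ℕ) :
    Ring.choose a (k + 1) = Ring.choose a k * ((a - k) / (k + 1)) := by
  simp only [Ring.choose_eq_smul, descPochhammer_succ_right, Polynomial.smeval_mul,
    Polynomial.smeval_sub, Polynomial.smeval_X, Polynomial.smeval_natCast, Nat.factorial_succ,
    smul_eq_mul, pow_zero, pow_one, nsmul_eq_mul, mul_one]
  push_cast
  have h : (k : ℝ) + 1 ≠ 0 := by positivity
  have h2 : (k.factorial : ℝ) ≠ 0 := by positivity
  field_simp

theorem grunwaldCoeff_eq_choose (α : ℝ) (k : ℕ) :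
    grunwaldCoeff α k = (-1) ^ k * Ring.choose α k := by
  induction k with
  | zero => simp [grunwaldCoeff]
  | succ k ih =>
    rw [grunwaldCoeff, ih, ring_choose_succ, pow_succ]
    have h : (k : ℝ) + 1 ≠ 0 := by positivity
    field_simp
    ring

theorem sum_grunwaldCoeff (α : ℝ) (n : ℕ) :
    ∑ k ∈ Finset.range (n + 1), grunwaldCoeff α k = ∏ k ∈ Finset.range n, (1 - α / (k + 1)) := by
  have key : ∀ n : ℕ, grunwaldCoeff α (n + 1) =
      -(α / (n + 1)) * ∏ k ∈ Finset.range n, (1 - α / (k + 1)) := by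
    intro n
    induction n with
    | zero => simp [grunwaldCoeff]
    | succ n ih =>
      rw [grunwaldCoeff, ih, Finset.prod_range_succ]
      push_cast
      have h : (n : ℝ) + 1 ≠ 0 := by positivity
      have h' : (n : ℝ) + 1 + 1 ≠ 0 := by positivity
      field_simp
      ring
  induction n with
  | zero => simp [grunwaldCoeff]
  | succ n ih =>
    rw [Finset.sum_range_succ, ih, key, Finset.prod_range_succ]
    ring

theorem grunwaldCoeff_nonneg {α : ℝ} (h₁ : 1 < α) (h₂ : α < 2) (k : ℕ) :
    0 ≤ grunwaldCoeff α (k + 2) := by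
  induction k with
  | zero => simp only [grunwaldCoeff]; push_cast; nlinarith
  | succ k ih =>
    rw [show k + 1 + 2 = (k + 2) + 1 by ring, grunwaldCoeff]
    refine mul_nonneg ?_ ih
    rw [sub_nonneg, div_le_one (by positivity)]
    push_cast
    have : (0 : ℝ) ≤ k := by positivity
    linarith

/-- From the second on, the partial sums are ∏ (1 - α/k) with a single negative factor, the one at k
= 1, hence nonpositive. As all terms with k ≥ 2 are nonnegative, they add up to at most α - 1. -/
theorem summable_grunwaldCoeff {α : ℝ} (h₁ : 1 < α) (h₂ : α < 2) :
    Summable fun k => ‖grunwaldCoeff α k‖ := by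
  rw [← summable_nat_add_iff 2]
  have hn : ∀ k, ‖grunwaldCoeff α (k + 2)‖ = grunwaldCoeff α (k + 2) := fun k =>
    Real.norm_of_nonneg (grunwaldCoeff_nonneg h₁ h₂ k)
  simp only [hn]
  refine summable_of_sum_range_le (c := α - 1) (grunwaldCoeff_nonneg h₁ h₂) fun n => ?_
  have h := sum_grunwaldCoeff α (n + 1)
  rw [Finset.sum_range_succ', Finset.sum_range_succ', Finset.prod_range_succ'] at h
  have hp : 0 ≤ ∏ k ∈ Finset.range n, (1 - α / (((k + 1 : ℕ) : ℝ) + 1)) := by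
    refine Finset.prod_nonneg fun k _ => ?_
    rw [sub_nonneg, div_le_one (by positivity)]
    push_cast
    have : (0 : ℝ) ≤ k := by positivity
    linarith
  have h1 : grunwaldCoeff α (0 + 1) = -α := by simp [grunwaldCoeff]
  have h0 : grunwaldCoeff α 0 = 1 := rfl
  rw [h0, h1] at h
  push_cast at h hp
  simp only [add_assoc, zero_add, div_one] at h hp ⊢
  norm_num at h hp ⊢
  nlinarith

theorem hasSum_grunwaldCoeff_of_norm_lt_one (α : ℝ) {z : ℂ} (hz : ‖z‖ < 1) :
    HasSum (fun k => (grunwaldCoeff α k : ℂ) * z ^ k) ((1 - z) ^ (α : ℂ)) := by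
  have h := (Complex.one_add_cpow_hasFPowerSeriesOnBall_zero (a := (α : ℂ))).hasSum (y := -z)
    (by simpa [← ofReal_norm] using hz)
  simp only [binomialSeries_apply, zero_add] at h
  rw [← sub_eq_add_neg] at h
  refine (congrArg (HasSum · _) (funext fun k => ?_)).mpr h
  rw [grunwaldCoeff_eq_choose, List.ofFn_const, List.prod_replicate, ← Complex.ofReal_choose,
    neg_pow]
  push_cast
  simp only [smul_eq_mul]
  ring

/-- Abel's argument carries the identity from the open disc to its boundary: both sides are
continuous along the radius r ↦ r z, the series by dominated convergence. -/
theorem hasSum_grunwaldCoeff {α : ℝ} (h₁ : 1 < α) (h₂ : α < 2) {z : ℂ} (hz : ‖z‖ ≤ 1) :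
    HasSum (fun k => (grunwaldCoeff α k : ℂ) * z ^ k) ((1 - z) ^ (α : ℂ)) := by
  have hbound : ∀ w : ℂ, ‖w‖ ≤ 1 → ∀ k,
      ‖(grunwaldCoeff α k : ℂ) * w ^ k‖ ≤ ‖grunwaldCoeff α k‖ := fun w hw k => by
    rw [norm_mul, Complex.norm_real, norm_pow]
    exact mul_le_of_le_one_right (norm_nonneg _) (pow_le_one₀ (norm_nonneg _) hw)
  have hsum : Summable fun k => (grunwaldCoeff α k : ℂ) * z ^ k :=
    (summable_grunwaldCoeff h₁ h₂).of_norm_bounded (hbound z hz)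
  have hre : 0 ≤ (1 - z).re := by
    have := (Complex.re_le_norm z).trans hz
    simpa using this
  have hev : ∀ᶠ r : ℝ in nhdsWithin 1 (Iio 1), 0 ≤ r ∧ r < 1 := by
    filter_upwards [Ioo_mem_nhdsLT (zero_lt_one (α := ℝ))] with r hr
    exact ⟨hr.1.le, hr.2⟩
  have hr1 : Filter.Tendsto (fun r : ℝ => (r : ℂ) * z) (nhdsWithin 1 (Iio 1)) (nhds z) := by
    have : Continuous fun r : ℝ => (r : ℂ) * z := by fun_prop
    simpa using (this.tendsto 1).mono_left nhdsWithin_le_nhds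
  have hnorm : ∀ r : ℝ, 0 ≤ r → r < 1 → ‖(r : ℂ) * z‖ < 1 := fun r h0 h1 => by
    rw [norm_mul, Complex.norm_real, Real.norm_of_nonneg h0]
    exact (mul_le_of_le_one_right h0 hz).trans_lt h1
  have hlim1 : Filter.Tendsto (fun r : ℝ => ∑' k, (grunwaldCoeff α k : ℂ) * ((r : ℂ) * z) ^ k)
      (nhdsWithin 1 (Iio 1)) (nhds (∑' k, (grunwaldCoeff α k : ℂ) * z ^ k)) := by
    refine tendsto_tsum_of_dominated_convergence (summable_grunwaldCoeff h₁ h₂)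
      (fun k => (hr1.pow k).const_mul _) ?_
    filter_upwards [hev] with r hr k using hbound _ (hnorm r hr.1 hr.2).le k
  have hlim2 : Filter.Tendsto (fun r : ℝ => (1 - (r : ℂ) * z) ^ (α : ℂ))
      (nhdsWithin 1 (Iio 1)) (nhds ((1 - z) ^ (α : ℂ))) := by
    -- The base 1 - z has nonnegative real part, so it avoids the cut except at z = 1, where α > 0
    -- gives continuity.
    have hc : ContinuousAt (fun x : ℂ => x ^ (α : ℂ)) (1 - z) :=
      Complex.continuousAt_cpow_const_of_re_pos (Or.inl hre) (by simpa using by linarith)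
    exact hc.tendsto.comp (hr1.const_sub 1)
  have heq : (fun r : ℝ => ∑' k, (grunwaldCoeff α k : ℂ) * ((r : ℂ) * z) ^ k)
      =ᶠ[nhdsWithin 1 (Iio 1)] fun r : ℝ => (1 - (r : ℂ) * z) ^ (α : ℂ) := by
    filter_upwards [hev] with r hr
    exact (hasSum_grunwaldCoeff_of_norm_lt_one α (hnorm r hr.1 hr.2)).tsum_eq
  rw [← tendsto_nhds_unique (hlim1.congr' heq) hlim2]
  exact hsum.hasSum

/-- The Lubich coefficients are the coefficients of `(3/2)^α (1 - z)^α (1 - z/3)^α`. -/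
theorem hasSum_lubichCoeff_nat {α : ℝ} (h₁ : 1 < α) (h₂ : α < 2) {z : ℂ} (hz : ‖z‖ ≤ 1) :
    HasSum (fun k : ℕ => (lubichCoeff α k : ℂ) * z ^ k)
      ((3 / 2 : ℂ) ^ (α : ℂ) * (1 - z / 3) ^ (α : ℂ) * (1 - z) ^ (α : ℂ)) := by
  have hz3 : ‖z / 3‖ ≤ 1 := by
    rw [norm_div]; norm_num; linarith
  have hf := hasSum_grunwaldCoeff h₁ h₂ hz3
  have hg := hasSum_grunwaldCoeff h₁ h₂ hz
  have hsn : ∀ w : ℂ, ‖w‖ ≤ 1 → Summable fun k => ‖(grunwaldCoeff α k : ℂ) * w ^ k‖ := fun w hw =>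
    (summable_grunwaldCoeff h₁ h₂).of_nonneg_of_le (fun _ => norm_nonneg _) fun k => by
      rw [norm_mul, Complex.norm_real, norm_pow]
      exact mul_le_of_le_one_right (norm_nonneg _) (pow_le_one₀ (norm_nonneg _) hw)
  have hprod := tsum_mul_tsum_eq_tsum_sum_range_of_summable_norm (hsn _ hz3) (hsn _ hz)
  have hps := (summable_norm_sum_mul_range_of_summable_norm (hsn _ hz3) (hsn _ hz)).of_norm
  rw [hf.tsum_eq, hg.tsum_eq] at hprod
  have := (hps.hasSum.mul_left ((3 / 2 : ℂ) ^ (α : ℂ)))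
  rw [← hprod, ← mul_assoc] at this
  refine (congrArg (HasSum · _) (funext fun k => ?_)).mpr this
  have h32 : ((3 / 2 : ℂ) ^ (α : ℂ)) = (((3 / 2 : ℝ) ^ α : ℝ) : ℂ) := by
    rw [Complex.ofReal_cpow (by norm_num)]; norm_num
  rw [lubichCoeff, if_neg (by simp), h32, Int.toNat_natCast]
  push_cast
  rw [mul_assoc, Finset.sum_mul]
  congr 1
  refine Finset.sum_congr rfl fun m hm => ?_
  have hm' : m ≤ k := Nat.lt_succ_iff.mp (Finset.mem_range.mp hm)
  rw [div_pow, show z ^ k = z ^ m * z ^ (k - m) by rw [← pow_add]; congr 1; omega]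
  field_simp

theorem summable_lubichCoeff {α : ℝ} (h₁ : 1 < α) (h₂ : α < 2) :
    Summable fun k : ℤ => ‖lubichCoeff α k‖ := by
  refine Summable.of_nat_of_neg_add_one ?_ ?_
  · have hs := summable_grunwaldCoeff h₁ h₂
    have hs3 : Summable fun k : ℕ => ‖((3 : ℝ) ^ k)⁻¹ * grunwaldCoeff α k‖ :=
      hs.of_nonneg_of_le (fun _ => norm_nonneg _) fun k => by
        rw [norm_mul]
        refine mul_le_of_le_one_left (norm_nonneg _) ?_
        rw [Real.norm_of_nonneg (by positivity)]
        exact inv_le_one_of_one_le₀ (one_le_pow₀ (by norm_num))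
    refine ((summable_norm_sum_mul_range_of_summable_norm hs3 hs).mul_left
      ‖(3 / 2 : ℝ) ^ α‖).congr fun k => ?_
    rw [← norm_mul, lubichCoeff, if_neg (by simp), Int.toNat_natCast]
  · refine (summable_zero (α := ℝ)).congr fun k => ?_
    rw [lubichCoeff, if_pos (by omega), norm_zero]

theorem hasSum_lubichCoeff {α : ℝ} (h₁ : 1 < α) (h₂ : α < 2) {z : ℂ} (hz : ‖z‖ = 1) :
    HasSum (fun k : ℤ => (lubichCoeff α k : ℂ) * z ^ k)
      ((3 / 2 : ℂ) ^ (α : ℂ) * (1 - z / 3) ^ (α : ℂ) * (1 - z) ^ (α : ℂ)) := by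
  have h := hasSum_lubichCoeff_nat h₁ h₂ hz.le
  refine (Function.Injective.hasSum_iff (g := ((↑) : ℕ → ℤ)) Nat.cast_injective ?_).mp ?_
  · intro k hk
    have : k < 0 := by
      by_contra hk'
      exact hk ⟨k.toNat, by simp; omega⟩
    simp [lubichCoeff, this]
  · simpa [Function.comp_def] using h

end

noncomputable section

/-! ### Toeplitz quadratic forms -/

theorem integral_exp_int_mul_I (m : ℤ) :
    ∫ θ in (0 : ℝ)..(2 * Real.pi), Complex.exp (-(θ * Complex.I)) ^ m =
      if m = 0 then (2 * Real.pi : ℂ) else 0 := by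
  split_ifs with hm
  · simp [hm]
  · have hc : (-(m : ℂ) * Complex.I) ≠ 0 := by simp [hm]
    have h := integral_exp_mul_complex (a := 0) (b := 2 * Real.pi) hc
    have he : ∀ θ : ℝ, Complex.exp (-(θ * Complex.I)) ^ m =
        Complex.exp (-(m : ℂ) * Complex.I * θ) := fun θ => by
      rw [← Complex.exp_int_mul]; congr 1; ring
    simp only [he, h]
    have : Complex.exp (-(m : ℂ) * Complex.I * ((2 * Real.pi : ℝ) : ℂ)) = 1 := by
      rw [Complex.exp_eq_one_iff]
      exact ⟨-m, by push_cast; ring⟩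
    rw [this]; simp

/-- A summable sequence whose symbol has nonpositive real part generates negative semidefinite
Toeplitz forms. -/
theorem toeplitz_form_nonpos {c : ℤ → ℝ} (hc : Summable fun k => ‖c k‖) {Φ : ℝ → ℂ}
    (hΦ : ∀ θ : ℝ, HasSum (fun k : ℤ => (c k : ℂ) * Complex.exp (-(θ * Complex.I)) ^ k) (Φ θ))
    (hre : ∀ θ, (Φ θ).re ≤ 0) {n : ℕ} (v : Fin n → ℝ) :
    ∑ i : Fin n, ∑ j : Fin n, v i * c ((i : ℤ) - (j : ℤ)) * v j ≤ 0 := by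
  set e : ℝ → ℂ := fun θ => Complex.exp (-(θ * Complex.I)) with he
  have hee : ∀ θ, ‖e θ‖ = 1 := fun θ => by
    simp only [he]
    rw [show -((θ : ℂ) * Complex.I) = ((-θ : ℝ) : ℂ) * Complex.I by push_cast; ring]
    exact Complex.norm_exp_ofReal_mul_I _
  have he0 : ∀ θ, e θ ≠ 0 := fun θ => Complex.exp_ne_zero _
  have hecont : Continuous e := by fun_prop
  have hezc : ∀ k : ℤ, Continuous fun θ => e θ ^ k := fun k =>
    hecont.zpow₀ k fun θ => Or.inl (he0 θ)
  -- Termwise integration, dominated by ∑ |c k|, identifies c m as a Fourier coefficient of Φ.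
  have hΦm : ∀ m : ℤ, ∫ θ in (0 : ℝ)..(2 * Real.pi), Φ θ * e θ ^ (-m) =
      (2 * Real.pi : ℂ) * c m := by
    intro m
    have h := intervalIntegral.hasSum_integral_of_dominated_convergence (μ := volume)
      (a := 0) (b := 2 * Real.pi)
      (F := fun (k : ℤ) θ => (c k : ℂ) * e θ ^ k * e θ ^ (-m)) (f := fun θ => Φ θ * e θ ^ (-m))
      (fun k _ => ‖c k‖)
      (fun k => ((continuous_const.mul (hezc k)).mul (hezc (-m))).aestronglyMeasurable)
      (fun k => Filter.Eventually.of_forall fun θ _ => by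
        simp [norm_zpow, hee])
      (Filter.Eventually.of_forall fun θ _ => hc)
      (by simp) (Filter.Eventually.of_forall fun θ _ => (hΦ θ).mul_right _)
    have h2 : (fun k : ℤ => ∫ θ in (0 : ℝ)..(2 * Real.pi), (c k : ℂ) * e θ ^ k * e θ ^ (-m)) =
        fun k => if k = m then (2 * Real.pi : ℂ) * c m else 0 := by
      funext k
      have : ∀ θ, (c k : ℂ) * e θ ^ k * e θ ^ (-m) = c k * e θ ^ (k - m) := fun θ => by
        rw [mul_assoc, ← zpow_add₀ (he0 θ), sub_eq_add_neg]
      rw [intervalIntegral.integral_congr fun θ _ => this θ, intervalIntegral.integral_const_mul]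
      simp only [he]
      rw [integral_exp_int_mul_I]
      simp only [sub_eq_zero]
      split_ifs with hkm
      · rw [hkm]; ring
      · simp
    rw [h2] at h
    exact h.unique (hasSum_ite_eq m _)
  have hΦc : Continuous Φ := by
    have : Φ = fun θ => ∑' k : ℤ, (c k : ℂ) * e θ ^ k := funext fun θ => (hΦ θ).tsum_eq.symm
    rw [this]
    refine continuous_tsum (fun k => continuous_const.mul (hezc k)) hc fun k θ => ?_
    simp [norm_zpow, hee]
  have hint : ∫ θ in (0 : ℝ)..(2 * Real.pi), Φ θ * ∑ i : Fin n, ∑ j : Fin n,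
      (v i * v j : ℂ) * e θ ^ (-((i : ℤ) - (j : ℤ))) =
      (2 * Real.pi : ℂ) * ∑ i : Fin n, ∑ j : Fin n, (v i * c ((i : ℤ) - (j : ℤ)) * v j : ℂ) := by
    simp only [Finset.mul_sum]
    rw [intervalIntegral.integral_finsetSum]
    · refine Finset.sum_congr rfl fun i _ => ?_
      rw [intervalIntegral.integral_finsetSum]
      · refine Finset.sum_congr rfl fun j _ => ?_
        have : ∀ θ, Φ θ * ((v i * v j : ℂ) * e θ ^ (-((i : ℤ) - (j : ℤ)))) =
            (v i * v j : ℂ) * (Φ θ * e θ ^ (-((i : ℤ) - (j : ℤ)))) := fun θ => by ring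
        simp only [this, intervalIntegral.integral_const_mul, hΦm]
        ring
      · intro j _
        exact (hΦc.mul (continuous_const.mul (hezc _))).intervalIntegrable _ _
    · intro i _
      exact (continuous_finsetSum _ fun j _ =>
        hΦc.mul (continuous_const.mul (hezc _))).intervalIntegrable _ _
  -- The double sum is a squared modulus, so the integrand inherits the sign of Re Φ.
  have hsq : ∀ θ, (∑ i : Fin n, ∑ j : Fin n, (v i * v j : ℂ) * e θ ^ (-((i : ℤ) - (j : ℤ)))) =
      ((Complex.normSq (∑ i : Fin n, v i * e θ ^ (i : ℤ)) : ℝ) : ℂ) := by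
    intro θ
    have hconj : (starRingEnd ℂ) (e θ) = (e θ)⁻¹ := by
      rw [Complex.inv_def, Complex.normSq_eq_norm_sq, hee]; simp
    rw [← Complex.mul_conj, map_sum, mul_comm, Finset.sum_mul_sum]
    refine Finset.sum_congr rfl fun i _ => Finset.sum_congr rfl fun j _ => ?_
    rw [map_mul, map_zpow₀, hconj, Complex.conj_ofReal, neg_sub, zpow_sub₀ (he0 θ), inv_zpow]
    field_simp
  have hre2 : (∫ θ in (0 : ℝ)..(2 * Real.pi), Φ θ * ∑ i : Fin n, ∑ j : Fin n,
      (v i * v j : ℂ) * e θ ^ (-((i : ℤ) - (j : ℤ)))).re ≤ 0 := by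
    have hcont : Continuous fun θ => Φ θ * ∑ i : Fin n, ∑ j : Fin n,
        (v i * v j : ℂ) * e θ ^ (-((i : ℤ) - (j : ℤ))) :=
      hΦc.mul (continuous_finsetSum _ fun i _ => continuous_finsetSum _ fun j _ =>
        continuous_const.mul (hezc _))
    have h := Complex.reCLM.intervalIntegral_comp_comm (μ := volume)
      (hcont.intervalIntegrable 0 (2 * Real.pi))
    simp only [Complex.reCLM_apply] at h
    rw [← h]
    have h3 : ∀ θ ∈ Icc (0 : ℝ) (2 * Real.pi), 0 ≤ -(Φ θ * ∑ i : Fin n, ∑ j : Fin n,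
        (v i * v j : ℂ) * e θ ^ (-((i : ℤ) - (j : ℤ)))).re := fun θ _ => by
      rw [hsq, Complex.re_mul_ofReal]
      nlinarith [hre θ, Complex.normSq_nonneg (∑ i : Fin n, v i * e θ ^ (i : ℤ))]
    have h4 := intervalIntegral.integral_nonneg (μ := volume) (by positivity) h3
    rw [intervalIntegral.integral_neg] at h4
    linarith
  rw [hint] at hre2
  have h5 : ((2 * Real.pi : ℂ) * ∑ i : Fin n, ∑ j : Fin n, (v i * c ((i : ℤ) - (j : ℤ)) * v j : ℂ)) =
      ((2 * Real.pi * ∑ i : Fin n, ∑ j : Fin n, v i * c ((i : ℤ) - (j : ℤ)) * v j : ℝ) : ℂ) := by push_cast; rfl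
  rw [h5, Complex.ofReal_re] at hre2
  have hpi := Real.pi_pos
  by_contra hcon
  push Not at hcon
  have : 0 < 2 * Real.pi * ∑ i : Fin n, ∑ j : Fin n, v i * c ((i : ℤ) - (j : ℤ)) * v j := by positivity
  linarith

/-! ### The WSLD weights and their symbol -/

/-- The eight shifts of a WSLD operator. -/
def Shifts.shift (σ : Shifts) : Fin 8 → ℤ :=
  ![σ.p, σ.q, σ.r, σ.s, σ.pb, σ.qb, σ.rb, σ.sb]

/-- The weights of the four shifts in the third order combination. -/
def weight₃ (α : ℝ) (p q r s : ℤ) : Fin 4 → ℝ :=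
  ![(3 * r * s + 2 * α) / (3 * ((r : ℝ) * s - p * q)) * (q / (q - p)),
    (3 * r * s + 2 * α) / (3 * ((r : ℝ) * s - p * q)) * (p / (p - q)),
    (3 * p * q + 2 * α) / (3 * ((p : ℝ) * q - r * s)) * (s / (s - r)),
    (3 * p * q + 2 * α) / (3 * ((p : ℝ) * q - r * s)) * (r / (r - s))]

/-- The weights of the eight shifts in the fourth order combination. -/
def Shifts.weight (σ : Shifts) (α : ℝ) : Fin 8 → ℝ :=
  Fin.append
    (fun m => σ.ab α / (σ.ab α - σ.ba α) * weight₃ α σ.p σ.q σ.r σ.s m)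
    (fun m => σ.ba α / (σ.ba α - σ.ab α) * weight₃ α σ.pb σ.qb σ.rb σ.sb m)

/-- The coefficients of the symbol of the WSLD operator. -/
def Shifts.coeff (σ : Shifts) (α : ℝ) (k : ℤ) : ℝ :=
  ∑ m, σ.weight α m * lubichCoeff α (k + σ.shift m)

/-- The general target module lets one expansion serve both the real matrix entries and the complex
powers of e^{iθ}. -/
theorem Shifts.sum_weight (σ : Shifts) (α : ℝ) {V : Type*} [AddCommGroup V] [Module ℝ V]
    (F : ℤ → V) :
    ∑ m, σ.weight α m • F (σ.shift m) =
      (σ.ab α / (σ.ab α - σ.ba α)) •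
        (weight₃ α σ.p σ.q σ.r σ.s 0 • F σ.p + weight₃ α σ.p σ.q σ.r σ.s 1 • F σ.q +
          weight₃ α σ.p σ.q σ.r σ.s 2 • F σ.r + weight₃ α σ.p σ.q σ.r σ.s 3 • F σ.s) +
      (σ.ba α / (σ.ba α - σ.ab α)) •
        (weight₃ α σ.pb σ.qb σ.rb σ.sb 0 • F σ.pb + weight₃ α σ.pb σ.qb σ.rb σ.sb 1 • F σ.qb +
          weight₃ α σ.pb σ.qb σ.rb σ.sb 2 • F σ.rb + weight₃ α σ.pb σ.qb σ.rb σ.sb 3 • F σ.sb) := by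
  rw [show (Finset.univ : Finset (Fin 8)) = (Finset.univ : Finset (Fin (4 + 4))) from rfl,
    Fin.sum_univ_add, Fin.sum_univ_four, Fin.sum_univ_four]
  simp only [Shifts.weight, Fin.append_left, Fin.append_right, mul_smul, smul_add]
  rfl

theorem Shifts.matrix_apply (σ : Shifts) (α : ℝ) (N : ℕ) (i j : Fin (N - 1)) :
    σ.matrix α N i j = σ.coeff α ((i : ℤ) - (j : ℤ)) := by
  have h := σ.sum_weight α (fun p => lubichCoeff α ((i : ℤ) - j + p))
  simp only [smul_eq_mul] at h
  rw [Shifts.coeff, h]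
  simp [Shifts.matrix, matrix₃, matrix₂, lubichMatrix, weight₃]
  ring

theorem Shifts.summable_coeff (σ : Shifts) {α : ℝ} (h₁ : 1 < α) (h₂ : α < 2) :
    Summable fun k => ‖σ.coeff α k‖ := by
  have h : Summable fun k => ∑ m, ‖σ.weight α m * lubichCoeff α (k + σ.shift m)‖ := by
    refine summable_sum fun m _ => ?_
    simp only [norm_mul]
    exact ((summable_lubichCoeff h₁ h₂).comp_injective (add_left_injective _)).mul_left _
  exact h.of_nonneg_of_le (fun _ => norm_nonneg _) fun k => norm_sum_le _ _

/-- The trigonometric polynomial formed from the weights and shifts. -/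
def Shifts.trigPoly (σ : Shifts) (α : ℝ) (θ : ℝ) : ℂ :=
  ∑ m, (σ.weight α m : ℂ) * Complex.exp (θ * Complex.I) ^ σ.shift m

/-- The function `(3/2 - 2ζ + ζ²/2)^α`, as a product of principal powers. -/
def lubichSymbol (α : ℝ) (ζ : ℂ) : ℂ :=
  (3 / 2 : ℂ) ^ (α : ℂ) * (1 - ζ / 3) ^ (α : ℂ) * (1 - ζ) ^ (α : ℂ)

/-- The symbol of the WSLD operator. -/
def Shifts.symbol (σ : Shifts) (α : ℝ) (θ : ℝ) : ℂ :=
  σ.trigPoly α θ * lubichSymbol α (Complex.exp (-(θ * Complex.I)))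

/-- Translating the coefficient sequence by p multiplies its symbol by ζ^{-p} = e^{ipθ}, so the
eight shifts contribute the factor `trigPoly`. -/
theorem Shifts.hasSum_symbol (σ : Shifts) {α : ℝ} (h₁ : 1 < α) (h₂ : α < 2) (θ : ℝ) :
    HasSum (fun k : ℤ => (σ.coeff α k : ℂ) * Complex.exp (-(θ * Complex.I)) ^ k)
      (σ.symbol α θ) := by
  set ζ := Complex.exp (-(θ * Complex.I)) with hζ
  have hζ1 : ‖ζ‖ = 1 := by
    rw [hζ, show -((θ : ℂ) * Complex.I) = ((-θ : ℝ) : ℂ) * Complex.I by push_cast; ring]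
    exact Complex.norm_exp_ofReal_mul_I _
  have hζ0 : ζ ≠ 0 := Complex.exp_ne_zero _
  have hinv : Complex.exp (θ * Complex.I) = ζ⁻¹ := by rw [hζ, ← Complex.exp_neg, neg_neg]
  have hshift : ∀ p : ℤ, HasSum (fun k : ℤ => (lubichCoeff α (k + p) : ℂ) * ζ ^ (k + p))
      (lubichSymbol α ζ) := fun p =>
    ((Equiv.addRight p).hasSum_iff (f := fun k : ℤ => (lubichCoeff α k : ℂ) * ζ ^ k)).mpr
      (hasSum_lubichCoeff h₁ h₂ hζ1)
  have h : HasSum (fun k : ℤ => ∑ m, (σ.weight α m : ℂ) * ζ⁻¹ ^ σ.shift m *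
      ((lubichCoeff α (k + σ.shift m) : ℂ) * ζ ^ (k + σ.shift m)))
      (∑ m, (σ.weight α m : ℂ) * ζ⁻¹ ^ σ.shift m * lubichSymbol α ζ) := by
    exact hasSum_sum fun m _ => (hshift _).mul_left _
  rw [Shifts.symbol, Shifts.trigPoly, hinv, Finset.sum_mul]
  refine (congrArg (HasSum · _) (funext fun k => ?_)).mpr h
  rw [Shifts.coeff]
  push_cast
  rw [Finset.sum_mul]
  refine Finset.sum_congr rfl fun m _ => ?_
  rw [zpow_add₀ hζ0, inv_zpow]
  have := zpow_ne_zero (σ.shift m) hζ0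
  field_simp

end

noncomputable section

/-! ### Interpolation in the order of the operator -/

/-- Multiply by sin φ and use sin φ · e^{i(1+t)φ} = sin((1-t)φ) e^{iφ} + sin(tφ) e^{2iφ}. The
product with the interpolated coefficient has four terms: `h11` and `h22` settle the diagonal ones,
while the two mixed ones are treated together by `h21` and `h12`. -/
theorem interpolate_cos_sin_nonpos {a₁ b₁ a₂ b₂ φ t : ℝ} (hφ : 0 < φ) (hφ' : φ ≤ Real.pi / 2)
    (ht : 0 ≤ t) (ht' : t ≤ 1)
    (h11 : a₁ * Real.cos φ - b₁ * Real.sin φ ≤ 0) (h21 : a₂ * Real.cos φ - b₂ * Real.sin φ ≤ 0)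
    (h22 : a₂ * Real.cos (2 * φ) - b₂ * Real.sin (2 * φ) ≤ 0)
    (h12 : (a₂ * Real.cos φ - b₂ * Real.sin φ) +
      2 * (a₁ * Real.cos (2 * φ) - b₁ * Real.sin (2 * φ)) ≤ 0) :
    ((1 - t) * a₁ + t * a₂) * Real.cos ((1 + t) * φ) -
      ((1 - t) * b₁ + t * b₂) * Real.sin ((1 + t) * φ) ≤ 0 := by
  have hpi := Real.pi_pos
  have hsin : 0 < Real.sin φ := Real.sin_pos_of_pos_of_lt_pi hφ (by linarith)
  set S₁ := Real.sin ((1 - t) * φ) with hS₁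
  set S₂ := Real.sin (t * φ) with hS₂
  have hS₁0 : (1 - t) * Real.sin φ ≤ S₁ := by
    have h := strictConcaveOn_sin_Icc.concaveOn.2 (show φ ∈ Icc 0 Real.pi from
      ⟨hφ.le, by linarith⟩) (show (0 : ℝ) ∈ Icc 0 Real.pi from ⟨le_rfl, hpi.le⟩)
      (show 0 ≤ 1 - t by linarith) ht (by ring)
    simpa [hS₁] using h
  have hS₂0 : 0 ≤ S₂ := Real.sin_nonneg_of_nonneg_of_le_pi (by positivity) (by nlinarith)
  have hS₂1 : S₂ ≤ t * φ := Real.sin_le (by positivity)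
  -- Jordan's inequality with π ≤ 4; the factor 1/2 matches the 2 in `h12`.
  have hφs : φ / 2 ≤ Real.sin φ := by
    have h := Real.mul_le_sin hφ.le hφ'
    have h4 : 1 / 2 ≤ 2 / Real.pi := by
      rw [div_le_div_iff₀ (by norm_num) hpi]; linarith [Real.pi_le_four]
    nlinarith
  have key : (((1 - t) * a₁ + t * a₂) * Real.cos ((1 + t) * φ) -
      ((1 - t) * b₁ + t * b₂) * Real.sin ((1 + t) * φ)) * Real.sin φ =
      (1 - t) * S₁ * (a₁ * Real.cos φ - b₁ * Real.sin φ) +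
      t * S₂ * (a₂ * Real.cos (2 * φ) - b₂ * Real.sin (2 * φ)) +
      (t * S₁ * (a₂ * Real.cos φ - b₂ * Real.sin φ) +
      (1 - t) * S₂ * (a₁ * Real.cos (2 * φ) - b₁ * Real.sin (2 * φ))) := by
    have e1 : (1 + t) * φ = φ + t * φ := by ring
    have e2 : (1 - t) * φ = φ - t * φ := by ring
    rw [hS₁, hS₂, e1, e2, Real.cos_add, Real.sin_add, Real.sin_sub, Real.cos_two_mul,
      Real.sin_two_mul]
    have hsq := Real.sin_sq_add_cos_sq φ
    set C := Real.cos φ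
    set S := Real.sin φ
    linear_combination (-((1 - t) * a₁ + t * a₂) * Real.sin (t * φ)) * hsq
  have hcross : t * S₁ * (a₂ * Real.cos φ - b₂ * Real.sin φ) +
      (1 - t) * S₂ * (a₁ * Real.cos (2 * φ) - b₁ * Real.sin (2 * φ)) ≤ 0 := by
    have hS₁' : 0 ≤ S₁ := le_trans (by have := hsin.le; have : 0 ≤ 1 - t := by linarith
                                       positivity) hS₁0
    have h1t : 0 ≤ 1 - t := by linarith
    set R := a₂ * Real.cos φ - b₂ * Real.sin φ
    set Q := a₁ * Real.cos (2 * φ) - b₁ * Real.sin (2 * φ)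
    -- By `h12`, Q ≤ -R/2, so the mixed sum is at most R (t S₁ - (1 - t) S₂ / 2), where R ≤ 0 and
    -- the bracket is nonnegative.
    have hQ : (1 - t) * S₂ * Q ≤ (1 - t) * S₂ * (-R / 2) :=
      mul_le_mul_of_nonneg_left (by linarith) (by positivity)
    have hco : (1 - t) * S₂ / 2 ≤ t * S₁ := by
      have h1 : (1 - t) * S₂ ≤ (1 - t) * (t * φ) := mul_le_mul_of_nonneg_left hS₂1 h1t
      have h2 : t * ((1 - t) * Real.sin φ) ≤ t * S₁ := mul_le_mul_of_nonneg_left hS₁0 ht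
      have h3 : t * (1 - t) * (φ / 2) ≤ t * (1 - t) * Real.sin φ :=
        mul_le_mul_of_nonneg_left hφs (by positivity)
      linarith
    nlinarith
  have h1 : (1 - t) * S₁ * (a₁ * Real.cos φ - b₁ * Real.sin φ) ≤ 0 := by
    refine mul_nonpos_of_nonneg_of_nonpos (mul_nonneg (by linarith) ?_) h11
    exact le_trans (mul_nonneg (by linarith) hsin.le) hS₁0
  have h2 : t * S₂ * (a₂ * Real.cos (2 * φ) - b₂ * Real.sin (2 * φ)) ≤ 0 :=
    mul_nonpos_of_nonneg_of_nonpos (by positivity) h22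
  by_contra hcon
  push Not at hcon
  have := mul_pos hcon hsin
  linarith

/-- If `T` interpolates `T₁` and `T₂` linearly, the sign of `Re (T W^(1+t))` for `0 ≤ t ≤ 1` follows
from sign conditions at the integer exponents `1` and `2`. -/
theorem re_mul_cpow_nonpos {W T₁ T₂ : ℂ} {t m : ℝ} (hW : W ≠ 0) (hre : 0 ≤ W.re) (him : 0 ≤ W.im)
    (ht : 0 ≤ t) (ht' : t ≤ 1) (hm : m ≤ ‖W‖)
    (h11 : (T₁ * W).re ≤ 0) (h21 : (T₂ * W).re ≤ 0) (h22 : (T₂ * W ^ 2).re ≤ 0)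
    (h12 : m * (T₂ * W).re + 2 * (T₁ * W ^ 2).re ≤ 0) :
    (((1 - t) * T₁ + t * T₂) * W ^ ((1 + t : ℝ) : ℂ)).re ≤ 0 := by
  set ρ := ‖W‖ with hρ
  have hρ0 : 0 < ρ := norm_pos_iff.mpr hW
  set φ := W.arg with hφ
  have hφ0 : 0 ≤ φ := Complex.arg_nonneg_iff.mpr him
  have hφ1 : φ ≤ Real.pi / 2 := (Complex.arg_le_pi_div_two_iff).mpr (Or.inl hre)
  have hX : W.re = ρ * Real.cos φ := (Complex.norm_mul_cos_arg W).symm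
  have hY : W.im = ρ * Real.sin φ := (Complex.norm_mul_sin_arg W).symm
  have hWre : ∀ T : ℂ, (T * W).re = ρ * (T.re * Real.cos φ - T.im * Real.sin φ) := fun T => by
    rw [Complex.mul_re, hX, hY]; ring
  have hW2re : ∀ T : ℂ, (T * W ^ 2).re =
      ρ ^ 2 * (T.re * Real.cos (2 * φ) - T.im * Real.sin (2 * φ)) := fun T => by
    have h := Real.sin_sq_add_cos_sq φ
    simp only [pow_two, Complex.mul_re, Complex.mul_im, hX, hY, Real.cos_two_mul, Real.sin_two_mul]
    linear_combination (-ρ ^ 2 * T.re) * h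
  have hpow : W ^ ((1 + t : ℝ) : ℂ) =
      ((ρ ^ (1 + t) : ℝ) : ℂ) * Complex.exp (((1 + t) * φ : ℝ) * Complex.I) := by
    rw [Complex.cpow_def_of_ne_zero hW, Complex.log, add_mul, Complex.exp_add]
    congr 1
    · rw [Real.rpow_def_of_pos hρ0, Complex.ofReal_exp]; push_cast; rfl
    · congr 1; push_cast; ring
  have hgoal : (((1 - t) * T₁ + t * T₂) * W ^ ((1 + t : ℝ) : ℂ)).re = ρ ^ (1 + t) *
      (((1 - t) * T₁.re + t * T₂.re) * Real.cos ((1 + t) * φ) -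
      ((1 - t) * T₁.im + t * T₂.im) * Real.sin ((1 + t) * φ)) := by
    rw [hpow, Complex.exp_mul_I, ← Complex.ofReal_cos, ← Complex.ofReal_sin]
    generalize Real.cos ((1 + t) * φ) = C
    generalize Real.sin ((1 + t) * φ) = S
    generalize ρ ^ (1 + t) = R
    simp
    ring
  rw [hgoal]
  refine mul_nonpos_of_nonneg_of_nonpos (by positivity) ?_
  rw [hWre] at h11 h21
  rw [hW2re] at h22
  have h11' := nonpos_of_mul_nonpos_right h11 hρ0
  have h21' := nonpos_of_mul_nonpos_right h21 hρ0
  have h22' := nonpos_of_mul_nonpos_right h22 (by positivity)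
  -- For φ = 0 one cannot divide by sin φ, but then W is real and positive, and only the real parts
  -- of T₁ and T₂ count.
  rcases hφ0.eq_or_lt with h0 | h0
  · rw [← h0] at h11' h21' ⊢
    simp only [Real.cos_zero, Real.sin_zero, mul_zero, sub_zero, mul_one] at h11' h21' ⊢
    nlinarith
  · refine interpolate_cos_sin_nonpos h0 hφ1 ht ht' h11' h21' h22' ?_
    rw [hWre, hW2re] at h12
    refine nonpos_of_mul_nonpos_right (a := ρ ^ 2) ?_ (by positivity)
    -- Since Re (T₂ W) ≤ 0, raising m to ‖W‖ keeps the mixed condition true and makes it homogeneous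
    -- of degree 2 in ‖W‖.
    have : (ρ - m) * (ρ * (T₂.re * Real.cos φ - T₂.im * Real.sin φ)) ≤ 0 :=
      mul_nonpos_of_nonneg_of_nonpos (by linarith) h21
    linarith

/-! ### The Lubich symbol on the unit circle -/

/-- For ζ ≠ 1 both factors have arguments in (-π/2, π/2), so logarithms add without meeting the cut;
at ζ = 1 both sides vanish. -/
theorem lubichSymbol_eq {α : ℝ} (hα : 0 < α) {ζ : ℂ} (hζ : ‖ζ‖ ≤ 1) :
    lubichSymbol α ζ = (3 / 2 * (1 - ζ / 3) * (1 - ζ)) ^ (α : ℂ) := by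
  have hα' : (α : ℂ) ≠ 0 := by exact_mod_cast hα.ne'
  by_cases h1 : ζ = 1
  · simp [lubichSymbol, h1, Complex.zero_cpow hα']
  have hre : ζ.re < 1 := by
    refine lt_of_le_of_ne ((Complex.re_le_norm ζ).trans hζ) fun h => h1 ?_
    have h2 : ζ.re ^ 2 + ζ.im ^ 2 ≤ 1 := by
      have := Complex.sq_norm ζ
      rw [Complex.normSq_apply] at this
      nlinarith [norm_nonneg ζ]
    have h3 : ζ.im = 0 := by rw [h] at h2; nlinarith
    exact Complex.ext (by simpa using h) (by simpa using h3)
  have hre1 : 0 < (1 - ζ).re := by simpa using hre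
  have hre2 : 0 < (1 - ζ / 3).re := by
    simp
    linarith
  have hne1 : (1 - ζ) ≠ 0 := fun h => by rw [h] at hre1; simp at hre1
  have hne2 : (1 - ζ / 3) ≠ 0 := fun h => by rw [h] at hre2; simp at hre2
  have ha1 := abs_lt.mp (Complex.abs_arg_lt_pi_div_two_iff.mpr (Or.inl hre1))
  have ha2 := abs_lt.mp (Complex.abs_arg_lt_pi_div_two_iff.mpr (Or.inl hre2))
  have hlog1 : Complex.log ((1 - ζ / 3) * (1 - ζ)) =
      Complex.log (1 - ζ / 3) + Complex.log (1 - ζ) :=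
    (Complex.log_mul_eq_add_log_iff hne2 hne1).mpr ⟨by linarith, by linarith⟩
  have h32 : (3 / 2 : ℂ) = ((3 / 2 : ℝ) : ℂ) := by push_cast; rfl
  have hlog2 : Complex.log (3 / 2 * ((1 - ζ / 3) * (1 - ζ))) =
      Complex.log (3 / 2) + (Complex.log (1 - ζ / 3) + Complex.log (1 - ζ)) := by
    rw [← hlog1, h32, Complex.log_ofReal_mul (by norm_num) (mul_ne_zero hne2 hne1),
      Complex.ofReal_log (by norm_num)]
  rw [lubichSymbol, mul_assoc (3 / 2 : ℂ),
    Complex.cpow_def_of_ne_zero (by norm_num : (3 / 2 : ℂ) ≠ 0),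
    Complex.cpow_def_of_ne_zero hne1, Complex.cpow_def_of_ne_zero hne2,
    Complex.cpow_def_of_ne_zero (mul_ne_zero (by norm_num) (mul_ne_zero hne2 hne1)), hlog2,
    ← Complex.exp_add, ← Complex.exp_add]
  congr 1
  ring

/-- The base `3/2 - 2ζ + ζ²/2` of the Lubich symbol at `ζ = e^{-iθ}`. -/
def lubichBase (θ : ℝ) : ℂ :=
  3 / 2 * (1 - Complex.exp (-(θ * Complex.I)) / 3) * (1 - Complex.exp (-(θ * Complex.I)))

theorem norm_exp_neg_mul_I (θ : ℝ) : ‖Complex.exp (-(θ * Complex.I))‖ = 1 := by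
  rw [show -((θ : ℂ) * Complex.I) = ((-θ : ℝ) : ℂ) * Complex.I by push_cast; ring]
  exact Complex.norm_exp_ofReal_mul_I _

theorem Shifts.symbol_eq (σ : Shifts) {α : ℝ} (hα : 0 < α) (θ : ℝ) :
    σ.symbol α θ = σ.trigPoly α θ * lubichBase θ ^ (α : ℂ) := by
  rw [Shifts.symbol, lubichSymbol_eq hα (norm_exp_neg_mul_I θ).le, lubichBase]

theorem exp_neg_mul_I (θ : ℝ) :
    Complex.exp (-(θ * Complex.I)) = Real.cos θ - Real.sin θ * Complex.I := by
  rw [show -((θ : ℂ) * Complex.I) = ((-θ : ℝ) : ℂ) * Complex.I by push_cast; ring,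
    Complex.exp_mul_I, ← Complex.ofReal_cos, ← Complex.ofReal_sin, Real.cos_neg, Real.sin_neg]
  push_cast; ring

/-- The real part is a square and the imaginary part has the sign of sin θ, so the base is in the
closed first quadrant when sin θ ≥ 0. -/
theorem lubichBase_eq (θ : ℝ) :
    lubichBase θ = ((1 - Real.cos θ) ^ 2 : ℝ) +
      (Real.sin θ * (2 - Real.cos θ) : ℝ) * Complex.I := by
  have h : ((Real.sin θ : ℝ) : ℂ) ^ 2 = 1 - (Real.cos θ : ℂ) ^ 2 := by
    have := Real.sin_sq_add_cos_sq θ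
    rw [eq_sub_iff_add_eq]; exact_mod_cast this
  rw [lubichBase, exp_neg_mul_I]
  generalize Real.cos θ = c at h ⊢
  generalize Real.sin θ = s at h ⊢
  push_cast
  linear_combination (1 / 2 * Complex.I ^ 2) * h + (1 / 2 * (1 - (c : ℂ) ^ 2)) * Complex.I_sq

/-- The coefficients are real, so θ ↦ -θ conjugates the symbol; it is enough to treat sin θ ≥ 0. -/
theorem Shifts.symbol_neg_re (σ : Shifts) {α : ℝ} (h₁ : 1 < α) (h₂ : α < 2) (θ : ℝ) :
    (σ.symbol α (-θ)).re = (σ.symbol α θ).re := by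
  have h := Complex.hasSum_conj'.mpr (σ.hasSum_symbol h₁ h₂ θ)
  have h' := σ.hasSum_symbol h₁ h₂ (-θ)
  have : σ.symbol α (-θ) = (starRingEnd ℂ) (σ.symbol α θ) := by
    refine h'.unique ((congrArg (HasSum · _) (funext fun k => ?_)).mpr h)
    rw [map_mul, map_zpow₀, Complex.conj_ofReal, ← Complex.exp_conj]
    congr 3
    simp
  rw [this, Complex.conj_re]

end

noncomputable section

/-! ### The trigonometric polynomials of the effective shifts -/

/-- The ratio `b/a` for the shifts `(1, q, 1, s)`. -/
def shiftRatio (α q s : ℝ) : ℝ := 6 * q * s + 4 * α * (q + s + 1) + 9 * α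

/-- The trigonometric polynomial of the third order combination with shifts `(1, q, 1, s)` at
`z = e^{iθ}`. -/
def trigPoly₃ (α : ℝ) (q s : ℤ) (z : ℂ) : ℂ :=
  (((3 * s + 2 * α) / (3 * ((s : ℝ) - q)) : ℝ) : ℂ) *
    (((q / (q - 1) : ℝ) : ℂ) * z - ((1 / (q - 1) : ℝ) : ℂ) * z ^ q) +
  (((3 * q + 2 * α) / (3 * ((q : ℝ) - s)) : ℝ) : ℂ) *
    (((s / (s - 1) : ℝ) : ℂ) * z - ((1 / (s - 1) : ℝ) : ℂ) * z ^ s)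

/-- For p = r = 1 one has a = s - q and b = (s - q) β with β the `shiftRatio`. The factors s - q
cancel and the outer weights are β̄/(β̄ - β) and -β/(β̄ - β). -/
theorem trigPoly_eq {α : ℝ} {q s qb sb : ℤ} (hqs : q ≠ s) (hqsb : qb ≠ sb)
    (hσ : (⟨1, q, 1, s, 1, qb, 1, sb⟩ : Shifts).Nondegenerate α) (θ : ℝ) :
    shiftRatio α qb sb - shiftRatio α q s ≠ 0 ∧
    (⟨1, q, 1, s, 1, qb, 1, sb⟩ : Shifts).trigPoly α θ =
      ((shiftRatio α qb sb / (shiftRatio α qb sb - shiftRatio α q s) : ℝ) : ℂ) *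
        trigPoly₃ α q s (Complex.exp (θ * Complex.I)) -
      ((shiftRatio α q s / (shiftRatio α qb sb - shiftRatio α q s) : ℝ) : ℂ) *
        trigPoly₃ α qb sb (Complex.exp (θ * Complex.I)) := by
  have h1 : (s : ℝ) - q ≠ 0 := by rw [sub_ne_zero]; exact_mod_cast hqs.symm
  have h2 : (sb : ℝ) - qb ≠ 0 := by rw [sub_ne_zero]; exact_mod_cast hqsb.symm
  have hb : ∀ q s : ℤ, bCoeff α 1 q 1 s = ((s : ℝ) - q) * shiftRatio α q s := fun q s => by
    simp only [bCoeff, shiftRatio]; push_cast; ring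
  have ha : ∀ q s : ℤ, aCoeff 1 q 1 s = (s : ℝ) - q := fun q s => by
    simp only [aCoeff]; push_cast; ring
  simp only [Shifts.Nondegenerate, Shifts.ab, Shifts.ba, ha, hb] at hσ
  have hB : shiftRatio α qb sb - shiftRatio α q s ≠ 0 := fun h => hσ (by
    rw [sub_eq_zero.mp h]; ring)
  refine ⟨hB, ?_⟩
  have hsum := (⟨1, q, 1, s, 1, qb, 1, sb⟩ : Shifts).sum_weight α
    (fun p => Complex.exp (θ * Complex.I) ^ p)
  simp only [Complex.real_smul] at hsum
  rw [Shifts.trigPoly, hsum]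
  generalize Complex.exp (θ * Complex.I) = z
  simp only [Shifts.ab, Shifts.ba, ha, hb]
  have e1 : ((s : ℝ) - q) * (((sb : ℝ) - qb) * shiftRatio α qb sb) /
      (((s : ℝ) - q) * (((sb : ℝ) - qb) * shiftRatio α qb sb) -
        ((sb : ℝ) - qb) * (((s : ℝ) - q) * shiftRatio α q s)) =
      shiftRatio α qb sb / (shiftRatio α qb sb - shiftRatio α q s) := by
    rw [show ((s : ℝ) - q) * (((sb : ℝ) - qb) * shiftRatio α qb sb) -
        ((sb : ℝ) - qb) * (((s : ℝ) - q) * shiftRatio α q s) = ((s : ℝ) - q) * ((sb : ℝ) - qb) *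
        (shiftRatio α qb sb - shiftRatio α q s) by ring]
    field_simp
  have e2 : ((sb : ℝ) - qb) * (((s : ℝ) - q) * shiftRatio α q s) /
      (((sb : ℝ) - qb) * (((s : ℝ) - q) * shiftRatio α q s) -
      ((s : ℝ) - q) * (((sb : ℝ) - qb) * shiftRatio α qb sb)) =
      -(shiftRatio α q s / (shiftRatio α qb sb - shiftRatio α q s)) := by
    rw [show ((sb : ℝ) - qb) * (((s : ℝ) - q) * shiftRatio α q s) -
      ((s : ℝ) - q) * (((sb : ℝ) - qb) * shiftRatio α qb sb) = -(((s : ℝ) - q) * ((sb : ℝ) - qb) *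
        (shiftRatio α qb sb - shiftRatio α q s)) by ring, div_neg]
    field_simp
  rw [e1, e2]
  have hw : ∀ q s : ℤ, (weight₃ α 1 q 1 s 0 : ℂ) * z ^ (1 : ℤ) + (weight₃ α 1 q 1 s 1 : ℂ) * z ^ q +
      (weight₃ α 1 q 1 s 2 : ℂ) * z ^ (1 : ℤ) + (weight₃ α 1 q 1 s 3 : ℂ) * z ^ s =
      trigPoly₃ α q s z := by
    intro q s
    have hsub : ∀ x : ℝ, 1 / (1 - x) = -(1 / (x - 1)) := fun x => by
      rw [← neg_sub x 1, div_neg]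
    simp only [weight₃, trigPoly₃, Matrix.cons_val_zero, Matrix.cons_val_one, Matrix.cons_val,
      Int.cast_one, mul_one, one_mul, zpow_one, hsub]
    push_cast
    ring
  rw [hw, hw]
  push_cast
  ring

/-! ### Shifts among `0, ±1, ±2` -/

/-- The general form of a symmetric-range trigonometric polynomial of the correct order. -/
def centralPoly (α ρ θ : ℝ) : ℂ :=
  ((1 - 2 * α / 3 * (1 - Real.cos θ) + ρ * (1 - Real.cos θ) ^ 2 : ℝ) : ℂ) +
    ((α / 2 * (1 - Real.cos θ) * Real.sin θ : ℝ) : ℂ) * Complex.I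

theorem zpow_exp_mul_I (θ : ℝ) :
    Complex.exp (θ * Complex.I) = Real.cos θ + Real.sin θ * Complex.I ∧
    Complex.exp (θ * Complex.I) ^ (2 : ℤ) = ((1 - 4 * (1 - Real.cos θ) + 2 * (1 - Real.cos θ) ^ 2 : ℝ) : ℂ) +
      ((2 * Real.sin θ * Real.cos θ : ℝ) : ℂ) * Complex.I ∧
    Complex.exp (θ * Complex.I) ^ (-1 : ℤ) = Real.cos θ - Real.sin θ * Complex.I ∧
    Complex.exp (θ * Complex.I) ^ (-2 : ℤ) =
      ((1 - 4 * (1 - Real.cos θ) + 2 * (1 - Real.cos θ) ^ 2 : ℝ) : ℂ) -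
      ((2 * Real.sin θ * Real.cos θ : ℝ) : ℂ) * Complex.I := by
  have h2 : ((1 - 4 * (1 - Real.cos θ) + 2 * (1 - Real.cos θ) ^ 2 : ℝ)) = Real.cos (2 * θ) := by
    rw [Real.cos_two_mul]; ring
  have h3 : 2 * Real.sin θ * Real.cos θ = Real.sin (2 * θ) := (Real.sin_two_mul θ).symm
  rw [h2, h3]
  have key : ∀ p : ℤ, Complex.exp (θ * Complex.I) ^ p =
      Real.cos (p * θ) + Real.sin (p * θ) * Complex.I := fun p => by
    rw [← Complex.exp_int_mul, ← mul_assoc, show (p : ℂ) * θ = ((p * θ : ℝ) : ℂ) by push_cast; rfl,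
      Complex.exp_mul_I, ← Complex.ofReal_cos, ← Complex.ofReal_sin]
  refine ⟨by simpa using key 1, by simpa using key 2, ?_, ?_⟩
  · rw [key]; simp [sub_eq_add_neg]
  · rw [key]
    simp [sub_eq_add_neg]

/-- Third order accuracy leaves only two free terms for shifts in this range: the coefficient ρ of
u² and an imaginary term proportional to β. The latter is the error that the fourth order
combination removes. -/
theorem trigPoly₃_central (α θ : ℝ) {q s : ℤ} {ρ : ℝ}
    (h : (q = 2 ∧ s = 0 ∧ ρ = 2 * α / 3) ∨ (q = 2 ∧ s = -2 ∧ ρ = (4 * α - 6) / 9) ∨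
      (q = -1 ∧ s = -2 ∧ ρ = (4 * α - 6) / 9) ∨ (q = 2 ∧ s = -1 ∧ ρ = (4 * α - 6) / 9) ∨
      (q = 0 ∧ s = -1 ∧ ρ = 0) ∨ (q = 0 ∧ s = -2 ∧ ρ = 2 * α / 9)) :
    trigPoly₃ α q s (Complex.exp (θ * Complex.I)) = centralPoly α ρ θ -
      ((shiftRatio α q s / 18 * (1 - Real.cos θ) * Real.sin θ : ℝ) : ℂ) * Complex.I := by
  obtain ⟨z1, z2, z3, z4⟩ := zpow_exp_mul_I θ
  rcases h with ⟨rfl, rfl, rfl⟩ | ⟨rfl, rfl, rfl⟩ | ⟨rfl, rfl, rfl⟩ | ⟨rfl, rfl, rfl⟩ |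
    ⟨rfl, rfl, rfl⟩ | ⟨rfl, rfl, rfl⟩ <;>
  · simp only [trigPoly₃, z2, z3, z4, zpow_zero, centralPoly, shiftRatio]
    rw [z1]
    generalize Real.cos θ = c
    generalize Real.sin θ = s
    push_cast
    ring

/-- The weights β̄/(β̄ - β) and -β/(β̄ - β) have sum 1 and annihilate the pair (β, β̄), so only an
affine combination of ρ₁ and ρ₂ survives. -/
theorem trigPoly_central {α θ : ℝ} {q s qb sb : ℤ} {ρ₁ ρ₂ ρ : ℝ} (hqs : q ≠ s) (hqsb : qb ≠ sb)
    (hσ : (⟨1, q, 1, s, 1, qb, 1, sb⟩ : Shifts).Nondegenerate α)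
    (h₁ : trigPoly₃ α q s (Complex.exp (θ * Complex.I)) = centralPoly α ρ₁ θ -
      ((shiftRatio α q s / 18 * (1 - Real.cos θ) * Real.sin θ : ℝ) : ℂ) * Complex.I)
    (h₂ : trigPoly₃ α qb sb (Complex.exp (θ * Complex.I)) = centralPoly α ρ₂ θ -
      ((shiftRatio α qb sb / 18 * (1 - Real.cos θ) * Real.sin θ : ℝ) : ℂ) * Complex.I)
    (hρ : ρ * (shiftRatio α qb sb - shiftRatio α q s) =
      shiftRatio α qb sb * ρ₁ - shiftRatio α q s * ρ₂) :
    (⟨1, q, 1, s, 1, qb, 1, sb⟩ : Shifts).trigPoly α θ = centralPoly α ρ θ := by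
  obtain ⟨hB, hT⟩ := trigPoly_eq hqs hqsb hσ θ
  rw [hT, h₁, h₂]
  have hρ' : ρ = (shiftRatio α qb sb * ρ₁ - shiftRatio α q s * ρ₂) /
    (shiftRatio α qb sb - shiftRatio α q s) := by rw [eq_div_iff hB, hρ]
  rw [hρ']
  simp only [centralPoly]
  have hB' : (shiftRatio α qb sb : ℂ) - shiftRatio α q s ≠ 0 := by exact_mod_cast hB
  generalize Real.cos θ = c
  generalize Real.sin θ = s
  generalize shiftRatio α qb sb = x at *
  generalize shiftRatio α q s = y at *
  push_cast
  field_simp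
  ring

/-- These products certify polynomial inequalities on [0, L]: a polynomial with nonnegative
coefficients in the Bernstein basis is nonnegative, and `linarith` finds the coefficients. -/
theorem bernstein_nonneg {u L : ℝ} (h0 : 0 ≤ u) (h1 : u ≤ L) (i j : ℕ) :
    0 ≤ u ^ i * (L - u) ^ j :=
  mul_nonneg (pow_nonneg h0 _) (pow_nonneg (sub_nonneg.mpr h1) _)

/-- The bound 2u is the number `m` fed to `re_mul_cpow_nonpos`. It amounts to 4u ≤ 2 + 3u for u ≤ 2
and avoids the square root in ‖W‖. -/
theorem norm_lubichBase_ge {W : ℂ} {u s : ℝ} (hu : 0 ≤ u) (hu2 : u ≤ 2) (hs : s ^ 2 = u * (2 - u))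
    (hre : W.re = u ^ 2) (him : W.im = s * (1 + u)) :
    ‖W‖ ^ 2 = u * (2 + 3 * u) ∧ 2 * u ≤ ‖W‖ := by
  have h : ‖W‖ ^ 2 = u * (2 + 3 * u) := by
    rw [Complex.sq_norm, Complex.normSq_apply, hre, him]
    linear_combination (1 + u) ^ 2 * hs
  exact ⟨h, by nlinarith [norm_nonneg W]⟩

/-- The sign of the symbol for linear families of central trigonometric polynomials, reduced to
polynomial inequalities in `u = 1 - cos θ`. -/
theorem central_nonpos_of_poly {ρ₁ ρ₂ t u s : ℝ} {W : ℂ} (ht : 0 ≤ t) (ht' : t ≤ 1)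
    (hu : 0 < u) (hu2 : u ≤ 2) (hs0 : 0 ≤ s) (hs : s ^ 2 = u * (2 - u))
    (hre : W.re = u ^ 2) (him : W.im = s * (1 + u))
    (i11 : (1 - 2 / 3 * u + ρ₁ * u ^ 2) - (2 - u) * (1 + u) / 2 ≤ 0)
    (i21 : (1 - 4 / 3 * u + ρ₂ * u ^ 2) - (2 - u) * (1 + u) ≤ 0)
    (i22 : (1 - 4 / 3 * u + ρ₂ * u ^ 2) * (2 * u ^ 3 - 3 * u - 2) -
      2 * u ^ 3 * (2 - u) * (1 + u) ≤ 0)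
    (i12 : u ^ 2 * ((1 - 4 / 3 * u + ρ₂ * u ^ 2) - (2 - u) * (1 + u)) +
      (1 - 2 / 3 * u + ρ₁ * u ^ 2) * (2 * u ^ 3 - 3 * u - 2) - u ^ 3 * (2 - u) * (1 + u) ≤ 0) :
    ((((1 - 2 * (1 + t) / 3 * u + ((1 - t) * ρ₁ + t * ρ₂) * u ^ 2 : ℝ) : ℂ) +
      (((1 + t) / 2 * u * s : ℝ) : ℂ) * Complex.I) * W ^ ((1 + t : ℝ) : ℂ)).re ≤ 0 := by
  have hW0 : W ≠ 0 := fun h => by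
    rw [h, Complex.zero_re] at hre; have := pow_pos hu 2; linarith
  have hm := (norm_lubichBase_ge hu.le hu2 hs hre him).2
  have h := re_mul_cpow_nonpos (W := W) (m := 2 * u)
    (T₁ := ((1 - 2 / 3 * u + ρ₁ * u ^ 2 : ℝ) : ℂ) + ((1 / 2 * u * s : ℝ) : ℂ) * Complex.I)
    (T₂ := ((1 - 4 / 3 * u + ρ₂ * u ^ 2 : ℝ) : ℂ) + ((u * s : ℝ) : ℂ) * Complex.I)
    hW0 (by rw [hre]; positivity) (by rw [him]; positivity) ht ht' hm
  have hT : ∀ a b : ℝ, (((a : ℂ) + (b : ℂ) * Complex.I) * W).re = a * u ^ 2 - b * (s * (1 + u)) :=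
    fun a b => by simp [Complex.mul_re, hre, him]
  have hT2 : ∀ a b : ℝ, (((a : ℂ) + (b : ℂ) * Complex.I) * W ^ 2).re =
      a * ((u ^ 2) ^ 2 - (s * (1 + u)) ^ 2) - b * (2 * u ^ 2 * (s * (1 + u))) :=
    fun a b => by
    simp only [pow_two, Complex.mul_re, Complex.mul_im, Complex.add_re, Complex.add_im,
      Complex.ofReal_re, Complex.ofReal_im, Complex.I_re, Complex.I_im, hre, him]
    ring
  simp only [hT, hT2] at h
  have e1 : ∀ b : ℝ, b * u * s * (s * (1 + u)) = b * u ^ 2 * (2 - u) * (1 + u) := fun b => by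
    linear_combination b * u * (1 + u) * hs
  have e2 : (s * (1 + u)) ^ 2 = u * (2 - u) * (1 + u) ^ 2 := by
    linear_combination (1 + u) ^ 2 * hs
  have e3 : ∀ b : ℝ, b * u * s * (2 * u ^ 2 * (s * (1 + u))) =
      2 * b * u ^ 4 * (2 - u) * (1 + u) := fun b => by
    linear_combination 2 * b * u ^ 3 * (1 + u) * hs
  have e1' := e1 1
  have e3' := e3 1
  rw [one_mul] at e1' e3'
  rw [e1, e1', e2, e3, e3'] at h
  -- The four conditions are the polynomials of `i11`, `i21`, `i22`, `i12` multiplied by u², u², u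
  -- and 2u respectively.
  have hu2' : 0 < u ^ 2 := by positivity
  have := h (by nlinarith) (by nlinarith) (by nlinarith) (by nlinarith)
  convert this using 3
  push_cast
  ring

/-- The real part is affine in ρ with slope u² Re W^α, so the sign of Re W^α decides which endpoint
of the interval for ρ is the worst. Both endpoints are affine in α: the lower is -5/3 at α = 1 and
-1/3 at α = 2, the upper is 1/12 and 1/3. This gives T the form required by
`central_nonpos_of_poly`. -/
theorem central_nonpos {α ρ θ : ℝ} (hα₁ : 1 < α) (hα₂ : α < 2) (hlo : (4 * α - 9) / 3 ≤ ρ)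
    (hhi : ρ ≤ α / 4 - 1 / 6) (hθ : 0 ≤ Real.sin θ) :
    (centralPoly α ρ θ * lubichBase θ ^ (α : ℂ)).re ≤ 0 := by
  set u := 1 - Real.cos θ with hu
  set s := Real.sin θ with hs
  have hu0 : 0 ≤ u := by have := Real.cos_le_one θ; linarith
  have hu2 : u ≤ 2 := by have := Real.neg_one_le_cos θ; linarith
  have hs2 : s ^ 2 = u * (2 - u) := by
    have := Real.sin_sq_add_cos_sq θ
    rw [hu]; linear_combination this
  have hre : (lubichBase θ).re = u ^ 2 := by
    rw [lubichBase_eq]; simp only [Complex.mul_re, Complex.add_re, Complex.ofReal_re,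
      Complex.ofReal_im, Complex.I_re, Complex.I_im]; ring
  have him : (lubichBase θ).im = s * (1 + u) := by
    rw [lubichBase_eq]; simp only [Complex.mul_im, Complex.add_im, Complex.ofReal_re,
      Complex.ofReal_im, Complex.I_re, Complex.I_im]; ring
  generalize lubichBase θ = W at *
  rcases hu0.eq_or_lt with h0 | h0
  · have : W = 0 := by
      have hs0 : s = 0 := by rw [← h0] at hs2; simpa using hs2
      apply Complex.ext <;> simp [hre, him, ← h0, hs0]
    have hα0 : (α : ℂ) ≠ 0 := by exact_mod_cast (by linarith : α ≠ 0)
    rw [this, Complex.zero_cpow hα0]; simp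
  have hb := bernstein_nonneg hu0 hu2
  obtain ⟨t, rfl⟩ : ∃ t, α = 1 + t := ⟨α - 1, by ring⟩
  have hL := central_nonpos_of_poly (ρ₁ := -5 / 3) (ρ₂ := -1 / 3) (t := t) (by linarith)
    (by linarith) h0 hu2 hθ hs2 hre him (by nlinarith) (by nlinarith [hb 0 2, hb 1 1, hb 2 0])
    (by linarith [hb 0 9, hb 1 8, hb 2 7, hb 3 6, hb 4 5, hb 5 4, hb 6 3, hb 7 2, hb 8 1, hb 9 0])
    (by nlinarith [sq_nonneg (u - 9 / 10), mul_nonneg hu0 (sq_nonneg (u - 9 / 10)),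
      mul_nonneg (pow_nonneg hu0 3) (sq_nonneg (u - 9 / 10)),
      mul_nonneg (pow_nonneg hu0 2) (sq_nonneg (u - 9 / 10)), sq_nonneg (u ^ 2 - 1)])
  have hH := central_nonpos_of_poly (ρ₁ := 1 / 12) (ρ₂ := 1 / 3) (t := t) (by linarith)
    (by linarith) h0 hu2 hθ hs2 hre him (by nlinarith) (by nlinarith [hb 0 2, hb 1 1, hb 2 0])
    (by linarith [hb 0 5, hb 1 4, hb 2 3, hb 3 2, hb 4 1, hb 5 0])
    (by linarith [hb 0 5, hb 1 4, hb 2 3, hb 3 2, hb 4 1, hb 5 0])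
  have hdiff : ∀ ρ' : ℝ, ((((1 - 2 * (1 + t) / 3 * u + ρ * u ^ 2 : ℝ) : ℂ) +
      (((1 + t) / 2 * u * s : ℝ) : ℂ) * Complex.I) * W ^ ((1 + t : ℝ) : ℂ)).re =
      ((((1 - 2 * (1 + t) / 3 * u + ρ' * u ^ 2 : ℝ) : ℂ) +
      (((1 + t) / 2 * u * s : ℝ) : ℂ) * Complex.I) * W ^ ((1 + t : ℝ) : ℂ)).re +
      (ρ - ρ') * u ^ 2 * (W ^ ((1 + t : ℝ) : ℂ)).re := fun ρ' => by
    generalize W ^ ((1 + t : ℝ) : ℂ) = V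
    simp only [Complex.mul_re, Complex.mul_im, Complex.add_re, Complex.add_im,
      Complex.ofReal_re, Complex.ofReal_im, Complex.I_re, Complex.I_im]
    ring
  simp only [centralPoly]
  rcases le_total 0 (W ^ ((1 + t : ℝ) : ℂ)).re with hV | hV
  · rw [← hu, hdiff ((1 - t) * (1 / 12) + t * (1 / 3))]
    have : (ρ - ((1 - t) * (1 / 12) + t * (1 / 3))) * u ^ 2 * (W ^ ((1 + t : ℝ) : ℂ)).re ≤ 0 :=
      mul_nonpos_of_nonpos_of_nonneg
        (mul_nonpos_of_nonpos_of_nonneg (by linarith) (by positivity)) hV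
    linarith
  · rw [← hu, hdiff ((1 - t) * (-5 / 3) + t * (-1 / 3))]
    have : (ρ - ((1 - t) * (-5 / 3) + t * (-1 / 3))) * u ^ 2 * (W ^ ((1 + t : ℝ) : ℂ)).re ≤ 0 :=
      mul_nonpos_of_nonneg_of_nonpos (mul_nonneg (by linarith) (by positivity)) hV
    linarith

/-- The sign of the symbol for the seven effective octuples with shifts among `0, ±1, ±2`. -/
theorem symbol_nonpos_of_central {σ : Shifts} {α θ : ℝ} (hα₁ : 1 < α) (hα₂ : α < 2)
    (hσ : σ = ⟨1, 2, 1, 0, 1, 2, 1, -2⟩ ∨ σ = ⟨1, 2, 1, 0, 1, -1, 1, -2⟩ ∨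
      σ = ⟨1, 2, 1, -1, 1, 2, 1, -2⟩ ∨ σ = ⟨1, 2, 1, -1, 1, -1, 1, -2⟩ ∨
      σ = ⟨1, 0, 1, -1, 1, 2, 1, -2⟩ ∨ σ = ⟨1, 0, 1, -2, 1, 2, 1, -2⟩ ∨
      σ = ⟨1, -1, 1, -2, 1, 2, 1, -2⟩) (hσα : σ.Nondegenerate α) (hθ : 0 ≤ Real.sin θ) :
    (σ.trigPoly α θ * lubichBase θ ^ (α : ℂ)).re ≤ 0 := by
  have h20 := trigPoly₃_central α θ (Or.inl ⟨rfl, rfl, rfl⟩)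
  have h22 := trigPoly₃_central α θ (Or.inr <| Or.inl ⟨rfl, rfl, rfl⟩)
  have h12 := trigPoly₃_central α θ (Or.inr <| Or.inr <| Or.inl ⟨rfl, rfl, rfl⟩)
  have h21 := trigPoly₃_central α θ (Or.inr <| Or.inr <| Or.inr <| Or.inl ⟨rfl, rfl, rfl⟩)
  have h01 := trigPoly₃_central α θ
    (Or.inr <| Or.inr <| Or.inr <| Or.inr <| Or.inl ⟨rfl, rfl, rfl⟩)
  have h02 := trigPoly₃_central α θ
    (Or.inr <| Or.inr <| Or.inr <| Or.inr <| Or.inr ⟨rfl, rfl, rfl⟩)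
  -- Each ρ below is the affine combination prescribed by `trigPoly_central`; only its position
  -- between the two endpoints remains to be checked.
  rcases hσ with rfl | rfl | rfl | rfl | rfl | rfl | rfl
  · rw [trigPoly_central (ρ := α / 12) (by decide) (by decide) hσα h20 h22
      (by simp only [shiftRatio]; push_cast; ring)]
    exact central_nonpos hα₁ hα₂ (by linarith) (by linarith) hθ
  · have h5 : 0 < 6 * (5 * α - 3) := by linarith
    rw [trigPoly_central (ρ := -(α * (33 - 13 * α) / (6 * (5 * α - 3)))) (by decide) (by decide)
      hσα h20 h12 (by
        have he := div_mul_cancel₀ (α * (33 - 13 * α)) h5.ne'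
        simp only [shiftRatio]; push_cast
        linear_combination (2 / 3) * he)]
    refine central_nonpos hα₁ hα₂ ?_ ?_ hθ
    · rw [le_neg, div_le_iff₀ h5]; nlinarith
    · have : 0 ≤ α * (33 - 13 * α) / (6 * (5 * α - 3)) :=
        div_nonneg (mul_nonneg (by linarith) (by linarith)) h5.le
      linarith
  · rw [trigPoly_central (ρ := (4 * α - 6) / 9) (by decide) (by decide) hσα h21 h22
      (by simp only [shiftRatio]; push_cast; ring)]
    exact central_nonpos hα₁ hα₂ (by linarith) (by linarith) hθ
  · rw [trigPoly_central (ρ := (4 * α - 6) / 9) (by decide) (by decide) hσα h21 h12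
      (by simp only [shiftRatio]; push_cast; ring)]
    exact central_nonpos hα₁ hα₂ (by linarith) (by linarith) hθ
  · have h6 : 0 < 2 * (6 - α) := by linarith
    have h6' : 6 - α ≠ 0 := by linarith
    rw [trigPoly_central (ρ := α * (2 * α - 3) / (2 * (6 - α))) (by decide) (by decide) hσα h01 h22
      (by simp only [shiftRatio]; push_cast; field_simp; ring)]
    refine central_nonpos hα₁ hα₂ ?_ ?_ hθ
    · rw [le_div_iff₀ h6]; nlinarith
    · rw [div_le_iff₀ h6]; nlinarith
  · rw [trigPoly_central (ρ := α / 12) (by decide) (by decide) hσα h02 h22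
      (by simp only [shiftRatio]; push_cast; ring)]
    exact central_nonpos hα₁ hα₂ (by linarith) (by linarith) hθ
  · rw [trigPoly_central (ρ := (4 * α - 6) / 9) (by decide) (by decide) hσα h12 h22
      (by simp only [shiftRatio]; push_cast; ring)]
    exact central_nonpos hα₁ hα₂ (by linarith) (by linarith) hθ

end

noncomputable section

/-! ### Divided differences of powers on the unit circle -/

/-- Triple summation from dominated initial data. This is the discrete counterpart of bounding an
interpolation error by a third derivative. -/
theorem norm_le_of_third_difference {F : ℕ → ℂ} {M : ℕ → ℝ} (h0 : ‖F 0‖ ≤ M 0)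
    (h1 : ‖F 1 - F 0‖ ≤ M 1 - M 0) (h2 : ‖F 2 - 2 * F 1 + F 0‖ ≤ M 2 - 2 * M 1 + M 0)
    (h3 : ∀ n, ‖F (n + 3) - 3 * F (n + 2) + 3 * F (n + 1) - F n‖ ≤
      M (n + 3) - 3 * M (n + 2) + 3 * M (n + 1) - M n) (n : ℕ) : ‖F n‖ ≤ M n := by
  suffices h : ‖F n‖ ≤ M n ∧ ‖F (n + 1) - F n‖ ≤ M (n + 1) - M n ∧
      ‖F (n + 2) - 2 * F (n + 1) + F n‖ ≤ M (n + 2) - 2 * M (n + 1) + M n from h.1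
  induction n with
  | zero => exact ⟨h0, h1, h2⟩
  | succ n ih =>
    obtain ⟨i0, i1, i2⟩ := ih
    refine ⟨?_, ?_, ?_⟩
    · calc ‖F (n + 1)‖ = ‖(F (n + 1) - F n) + F n‖ := by ring_nf
        _ ≤ _ := norm_add_le _ _
        _ ≤ _ := by linarith
    · calc ‖F (n + 1 + 1) - F (n + 1)‖
          = ‖(F (n + 2) - 2 * F (n + 1) + F n) + (F (n + 1) - F n)‖ := by ring_nf
        _ ≤ _ := norm_add_le _ _
        _ ≤ _ := by linarith
    · calc ‖F (n + 1 + 2) - 2 * F (n + 1 + 1) + F (n + 1)‖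
          = ‖(F (n + 3) - 3 * F (n + 2) + 3 * F (n + 1) - F n) +
              (F (n + 2) - 2 * F (n + 1) + F n)‖ := by ring_nf
        _ ≤ _ := norm_add_le _ _
        _ ≤ _ := by linarith [h3 n]

/-- The error at `x` of the quadratic interpolation of `k ↦ z^k` at the nodes `1`, `2`, `-2`. -/
def interpError (z : ℂ) (x : ℤ) : ℂ :=
  z ^ x + (((x ^ 2 - 4) / 3 : ℝ) : ℂ) * z - (((x - 1) * (x + 2) / 4 : ℝ) : ℂ) * z ^ 2 -
    (((x - 1) * (x - 2) / 12 : ℝ) : ℂ) * (z ^ 2)⁻¹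

/-- The divided difference of `k ↦ z^k` at the nodes `1`, `2`, `-2`, `x`. -/
def divDiff (z : ℂ) (x : ℤ) : ℂ :=
  interpError z x / (((x - 1) * (x ^ 2 - 4) : ℝ) : ℂ)

/-- The third difference of k ↦ z^k has modulus ‖z - 1‖³, while the quadratic interpolant
contributes none. The majorant is ‖z - 1‖³/6 times the nodal cubic (x - 1)(x² - 4) at x = n + 1,
whose third difference is exactly ‖z - 1‖³. -/
theorem norm_interpError_le_up {z : ℂ} (hz : ‖z‖ = 1) (n : ℕ) :
    ‖interpError z (n + 1)‖ ≤ ((n : ℝ) ^ 3 + 2 * n ^ 2 - 3 * n) / 6 * ‖z - 1‖ ^ 3 := by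
  have hz0 : z ≠ 0 := fun h => by simp [h] at hz
  have e1 : interpError z (((0 : ℕ) : ℤ) + 1) = 0 := by simp [interpError]; norm_num
  have e2 : interpError z (((1 : ℕ) : ℤ) + 1) = 0 := by
    simp [interpError]; norm_num
  -- The error vanishes at the nodes 1 and 2, so its value at 3 is the initial second difference.
  -- The coefficients 6, 3, 1 add up to 10, and 10/6 is the majorant at n = 2.
  have e3 : interpError z (((2 : ℕ) : ℤ) + 1) =
      (z - 1) ^ 3 * ((6 * z ^ 2 + 3 * z + 1) / 6 * (z ^ 2)⁻¹) := by
    simp [interpError]; norm_num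
    field_simp
    ring
  refine norm_le_of_third_difference (F := fun n : ℕ => interpError z (n + 1))
    (M := fun n : ℕ => ((n : ℝ) ^ 3 + 2 * n ^ 2 - 3 * n) / 6 * ‖z - 1‖ ^ 3) ?_ ?_ ?_ ?_ n
  · simp only [e1]; simp
  · simp only [e1, e2]; norm_num
  · simp only [e1, e2, e3]
    rw [mul_zero, sub_zero, add_zero, norm_mul, norm_mul, norm_pow, norm_inv, norm_pow, hz]
    have h : ‖(6 * z ^ 2 + 3 * z + 1) / 6‖ ≤ 10 / 6 := by
      rw [norm_div]
      have h1 : ‖6 * z ^ 2 + 3 * z + 1‖ ≤ 6 + 3 + 1 := by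
        refine (norm_add_le _ _).trans (add_le_add ((norm_add_le _ _).trans (add_le_add ?_ ?_)) ?_)
        all_goals simp [hz]
      norm_num at h1 ⊢
      linarith
    have h3 : 0 ≤ ‖z - 1‖ ^ 3 := by positivity
    norm_num at h ⊢
    nlinarith
  · intro m
    have hthird : interpError z (((m + 3 : ℕ) : ℤ) + 1) - 3 * interpError z (((m + 2 : ℕ) : ℤ) + 1) +
        3 * interpError z (((m + 1 : ℕ) : ℤ) + 1) - interpError z ((m : ℤ) + 1) =
        z ^ ((m : ℤ) + 1) * (z - 1) ^ 3 := by
      have a1 : z ^ (((m + 3 : ℕ) : ℤ) + 1) = z ^ ((m : ℤ) + 1) * z ^ 3 := by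
        rw [← zpow_natCast, ← zpow_add₀ hz0]; congr 1
      have a2 : z ^ (((m + 2 : ℕ) : ℤ) + 1) = z ^ ((m : ℤ) + 1) * z ^ 2 := by
        rw [← zpow_natCast, ← zpow_add₀ hz0]; congr 1
      have a3 : z ^ (((m + 1 : ℕ) : ℤ) + 1) = z ^ ((m : ℤ) + 1) * z := by
        rw [← zpow_add_one₀ hz0]; congr 1
      simp only [interpError, a1, a2, a3]
      push_cast
      ring
    simp only [hthird]
    rw [norm_mul, norm_zpow, norm_pow, hz, one_zpow, one_mul]
    push_cast
    apply le_of_eq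
    ring

/-- The same comparison to the left of the node -2, with the absolute value of the nodal cubic at x
= -2 - n. Only one node lies on this side, so the first and second initial differences both need an
explicit bound. -/
theorem norm_interpError_le_down {z : ℂ} (hz : ‖z‖ = 1) (n : ℕ) :
    ‖interpError z (-2 - n)‖ ≤ ((n : ℝ) ^ 3 + 7 * n ^ 2 + 12 * n) / 6 * ‖z - 1‖ ^ 3 := by
  have hz0 : z ≠ 0 := fun h => by simp [h] at hz
  have e1 : interpError z (-2 - ((0 : ℕ) : ℤ)) = 0 := by
    simp [interpError]; norm_num
  have e2 : interpError z (-2 - ((1 : ℕ) : ℤ)) =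
      (z - 1) ^ 3 * (-((3 * z ^ 2 + 4 * z + 3) / 3) * (z ^ 3)⁻¹) := by
    simp [interpError]; norm_num
    field_simp
    ring
  have e3 : interpError z (-2 - ((2 : ℕ) : ℤ)) - 2 * interpError z (-2 - ((1 : ℕ) : ℤ)) =
      (z - 1) ^ 3 * (-((3 * z ^ 3 + 5 * z ^ 2 + 6 * z + 6) / 6) * (z ^ 4)⁻¹) := by
    simp [interpError]; norm_num
    field_simp
    ring
  have h3 : 0 ≤ ‖z - 1‖ ^ 3 := by positivity
  refine norm_le_of_third_difference (F := fun n : ℕ => interpError z (-2 - n))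
    (M := fun n : ℕ => ((n : ℝ) ^ 3 + 7 * n ^ 2 + 12 * n) / 6 * ‖z - 1‖ ^ 3) ?_ ?_ ?_ ?_ n
  · simp only [e1]; simp
  · simp only [e1, e2]
    rw [sub_zero, norm_mul, norm_mul, norm_pow, norm_inv, norm_pow, hz, norm_neg]
    have h : ‖(3 * z ^ 2 + 4 * z + 3) / 3‖ ≤ 10 / 3 := by
      rw [norm_div]
      have h1 : ‖3 * z ^ 2 + 4 * z + 3‖ ≤ 3 + 4 + 3 := by
        refine (norm_add_le _ _).trans (add_le_add ((norm_add_le _ _).trans (add_le_add ?_ ?_)) ?_)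
        all_goals simp [hz]
      norm_num at h1 ⊢
      linarith
    norm_num at h ⊢
    nlinarith
  · simp only [e1, e3]
    rw [add_zero, norm_mul, norm_mul, norm_pow, norm_inv, norm_pow, hz, norm_neg]
    have h : ‖(3 * z ^ 3 + 5 * z ^ 2 + 6 * z + 6) / 6‖ ≤ 20 / 6 := by
      rw [norm_div]
      have h1 : ‖3 * z ^ 3 + 5 * z ^ 2 + 6 * z + 6‖ ≤ 3 + 5 + 6 + 6 := by
        refine (norm_add_le _ _).trans (add_le_add ((norm_add_le _ _).trans
          (add_le_add ((norm_add_le _ _).trans (add_le_add ?_ ?_)) ?_)) ?_)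
        all_goals simp [hz]
      norm_num at h1 ⊢
      linarith
    norm_num at h ⊢
    nlinarith
  · intro m
    have hthird : interpError z (-2 - ((m + 3 : ℕ) : ℤ)) - 3 * interpError z (-2 - ((m + 2 : ℕ) : ℤ)) +
        3 * interpError z (-2 - ((m + 1 : ℕ) : ℤ)) - interpError z (-2 - (m : ℤ)) =
        -(z ^ (-2 - ((m + 3 : ℕ) : ℤ)) * (z - 1) ^ 3) := by
      have a1 : z ^ (-2 - (m : ℤ)) = z ^ (-2 - ((m + 3 : ℕ) : ℤ)) * z ^ 3 := by
        rw [← zpow_natCast, ← zpow_add₀ hz0]; congr 1; push_cast; ring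
      have a2 : z ^ (-2 - ((m + 1 : ℕ) : ℤ)) = z ^ (-2 - ((m + 3 : ℕ) : ℤ)) * z ^ 2 := by
        rw [← zpow_natCast, ← zpow_add₀ hz0]; congr 1
      have a3 : z ^ (-2 - ((m + 2 : ℕ) : ℤ)) = z ^ (-2 - ((m + 3 : ℕ) : ℤ)) * z := by
        rw [← zpow_add_one₀ hz0]; congr 1
      simp only [interpError, a1, a2, a3]
      push_cast
      ring
    simp only [hthird]
    rw [norm_neg, norm_mul, norm_zpow, norm_pow, hz, one_zpow, one_mul]
    push_cast
    apply le_of_eq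
    ring

/-- The first bound is the interpolation estimate divided by the nodal cubic and is good for z near
1. The second is the triangle inequality, worst at x = 3, where it reads (16/3)/10. At x = ±2 the
divided difference is 0 by the convention for division by zero. -/
theorem norm_divDiff_le {z : ℂ} (hz : ‖z‖ = 1) {x : ℤ} (hx : 2 ≤ |x|) :
    ‖divDiff z x‖ ≤ ‖z - 1‖ ^ 3 / 6 ∧ ‖divDiff z x‖ ≤ 8 / 15 := by
  have hz0 : z ≠ 0 := fun h => by simp [h] at hz
  by_cases hx2 : |x| = 2
  · have : (x : ℝ) ^ 2 - 4 = 0 := by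
      rcases (abs_eq (by norm_num)).mp hx2 with h | h <;> rw [h] <;> norm_num
    rw [divDiff, this, mul_zero]
    simp only [Complex.ofReal_zero, div_zero, norm_zero]
    exact ⟨by positivity, by norm_num⟩
  have hx3 : 3 ≤ |x| := by omega
  have hE : ‖interpError z x‖ ≤ 1 + |((x : ℝ) ^ 2 - 4) / 3| + |((x : ℝ) - 1) * (x + 2) / 4| +
      |((x : ℝ) - 1) * (x - 2) / 12| := by
    rw [interpError]
    refine (norm_sub_le _ _).trans (add_le_add ((norm_sub_le _ _).trans
      (add_le_add ((norm_add_le _ _).trans (add_le_add ?_ ?_)) ?_)) ?_)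
    · rw [norm_zpow, hz, one_zpow]
    · rw [norm_mul, hz, mul_one, Complex.norm_real, Real.norm_eq_abs]
    · rw [norm_mul, norm_pow, hz, one_pow, mul_one, Complex.norm_real, Real.norm_eq_abs]
    · rw [norm_mul, norm_inv, norm_pow, hz, one_pow, inv_one, mul_one, Complex.norm_real,
        Real.norm_eq_abs]
  rw [divDiff, norm_div, Complex.norm_real, Real.norm_eq_abs]
  rcases le_or_gt 0 x with h | h
  · rw [abs_of_nonneg h] at hx3
    obtain ⟨n, rfl⟩ : ∃ n : ℕ, x = n + 1 := ⟨(x - 1).toNat, by omega⟩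
    have hn : (2 : ℝ) ≤ n := by exact_mod_cast (by omega : (2 : ℤ) ≤ n)
    have hup := norm_interpError_le_up hz n
    push_cast at hE ⊢
    have p1 : 0 ≤ (((n : ℝ) + 1) ^ 2 - 4) / 3 := by nlinarith
    have p2 : 0 ≤ ((n : ℝ) + 1 - 1) * (n + 1 + 2) / 4 := by nlinarith
    have p3 : 0 ≤ ((n : ℝ) + 1 - 1) * (n + 1 - 2) / 12 := by nlinarith
    have p4 : 0 < ((n : ℝ) + 1 - 1) * ((n + 1) ^ 2 - 4) := by
      apply mul_pos <;> nlinarith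
    rw [abs_of_nonneg p1, abs_of_nonneg p2, abs_of_nonneg p3] at hE
    rw [abs_of_pos p4, div_le_iff₀ p4, div_le_iff₀ p4]
    constructor
    · refine hup.trans (le_of_eq ?_); ring
    · nlinarith [mul_nonneg (sub_nonneg.mpr hn) (sub_nonneg.mpr hn)]
  · rw [abs_of_neg h] at hx3
    obtain ⟨n, rfl⟩ : ∃ n : ℕ, x = -2 - n := ⟨(-2 - x).toNat, by omega⟩
    have hn : (1 : ℝ) ≤ n := by exact_mod_cast (by omega : (1 : ℤ) ≤ n)
    have hdown := norm_interpError_le_down hz n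
    push_cast at hE ⊢
    have p1 : 0 ≤ ((-2 - (n : ℝ)) ^ 2 - 4) / 3 := by nlinarith
    have p2 : 0 ≤ (-2 - (n : ℝ) - 1) * (-2 - n + 2) / 4 := by nlinarith
    have p3 : 0 ≤ (-2 - (n : ℝ) - 1) * (-2 - n - 2) / 12 := by nlinarith
    have p4 : (-2 - (n : ℝ) - 1) * ((-2 - n) ^ 2 - 4) < 0 :=
      mul_neg_of_neg_of_pos (by linarith) (by nlinarith)
    rw [abs_of_nonneg p1, abs_of_nonneg p2, abs_of_nonneg p3] at hE
    rw [abs_of_neg p4, div_le_iff₀ (neg_pos.mpr p4), div_le_iff₀ (neg_pos.mpr p4)]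
    constructor
    · refine hdown.trans (le_of_eq ?_); ring
    · nlinarith [mul_nonneg (sub_nonneg.mpr hn) (sub_nonneg.mpr hn)]

/-! ### Shifts `(1, 2, 1, -2, 1, q, 1, s)` -/

theorem interpError_eq {z : ℂ} {x : ℤ} (hx : 2 ≤ |x|) :
    interpError z x = (((x - 1) * (x ^ 2 - 4) : ℝ) : ℂ) * divDiff z x := by
  by_cases hx2 : |x| = 2
  · have h4 : (x : ℝ) ^ 2 - 4 = 0 := by
      rcases (abs_eq (by norm_num)).mp hx2 with h | h <;> rw [h] <;> norm_num
    rw [h4, mul_zero, Complex.ofReal_zero, zero_mul]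
    rcases (abs_eq (by norm_num)).mp hx2 with h | h <;> rw [h] <;> simp [interpError] <;> norm_num
  · have hx3 : 3 ≤ |x| := by omega
    have h1 : x - 1 ≠ 0 := fun h => by
      rw [sub_eq_zero.mp h] at hx3; norm_num at hx3
    have h2 : x ^ 2 - 4 ≠ 0 := fun h => by
      have : |x| ^ 2 = 4 := by rw [sq_abs]; linarith
      nlinarith
    have h3 : (((x - 1) * (x ^ 2 - 4) : ℝ) : ℂ) ≠ 0 := by
      have : ((x : ℝ) - 1) * (x ^ 2 - 4) ≠ 0 := by exact_mod_cast mul_ne_zero h1 h2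
      exact_mod_cast this
    rw [divDiff, mul_div_cancel₀ _ h3]

/-- The third order conditions fix how the weights act on the exponent functions 1, k, k². Replacing
z^q and z^s by their interpolants at 1, 2, -2 therefore produces the third order combination with
those nodes, and the interpolation errors are the remainder. -/
theorem trigPoly₃_sub {α : ℝ} {z : ℂ} {q s : ℤ} (hq : 2 ≤ |q|) (hs : 2 ≤ |s|)
    (hqs : q ≠ s) :
    trigPoly₃ α q s z = trigPoly₃ α 2 (-2) z -
      ((((3 * s + 2 * α) * (q ^ 2 - 4) / (3 * (s - q)) : ℝ) : ℂ) * divDiff z q +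
        (((3 * q + 2 * α) * (s ^ 2 - 4) / (3 * (q - s)) : ℝ) : ℂ) * divDiff z s) := by
  have hq' := interpError_eq (z := z) hq
  have hs' := interpError_eq (z := z) hs
  have hpow : ∀ x : ℤ, z ^ x = interpError z x - (((x ^ 2 - 4) / 3 : ℝ) : ℂ) * z +
      (((x - 1) * (x + 2) / 4 : ℝ) : ℂ) * z ^ 2 +
      (((x - 1) * (x - 2) / 12 : ℝ) : ℂ) * (z ^ 2)⁻¹ := fun x => by rw [interpError]; ring
  have hz2 : z ^ (2 : ℤ) = z ^ 2 := rfl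
  have hz2' : z ^ (-2 : ℤ) = (z ^ 2)⁻¹ := rfl
  have q1 : (q : ℂ) - 1 ≠ 0 := by
    rw [sub_ne_zero]; intro h
    have : q = 1 := by exact_mod_cast h
    rw [this] at hq; norm_num at hq
  have s1 : (s : ℂ) - 1 ≠ 0 := by
    rw [sub_ne_zero]; intro h
    have : s = 1 := by exact_mod_cast h
    rw [this] at hs; norm_num at hs
  have d1 : (s : ℂ) - q ≠ 0 := by rw [sub_ne_zero]; exact_mod_cast hqs.symm
  have d2 : (q : ℂ) - s = -((s : ℂ) - q) := by ring
  simp only [trigPoly₃, hz2, hz2']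
  rw [hpow q, hpow s, hq', hs']
  generalize divDiff z q = Dq
  generalize divDiff z s = Ds
  push_cast
  rw [d2]
  generalize hd : (s : ℂ) - q = d at *
  have : (s : ℂ) = d + q := by rw [← hd]; ring
  rw [this] at s1 ⊢
  generalize (z ^ 2)⁻¹ = y
  field_simp
  ring

/-- In the outer combination the remainder of `trigPoly₃_sub` is weighted by the ratio 13α - 24 of
the pair (2, -2). Because q and s have opposite signs, the normalized coefficients of the two
divided differences are nonnegative, and they add up to 1. -/
theorem trigPoly_family {α : ℝ} (θ : ℝ) (hα₁ : 1 < α) (hα₂ : α < 2) {q s : ℤ} (hq : 2 ≤ |q|)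
    (hs : 2 ≤ |s|) (hqs : q * s < 0)
    (hσ : (⟨1, 2, 1, -2, 1, q, 1, s⟩ : Shifts).Nondegenerate α) :
    ∃ μ ν : ℝ, 0 ≤ μ ∧ 0 ≤ ν ∧ μ + ν = 1 ∧
      (⟨1, 2, 1, -2, 1, q, 1, s⟩ : Shifts).trigPoly α θ =
        trigPoly₃ α 2 (-2) (Complex.exp (θ * Complex.I)) + (((24 - 13 * α) / 6 : ℝ) : ℂ) *
          (μ * divDiff (Complex.exp (θ * Complex.I)) q +
            ν * divDiff (Complex.exp (θ * Complex.I)) s) := by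
  have hne : q ≠ s := fun h => by rw [h] at hqs; nlinarith [mul_self_nonneg s]
  obtain ⟨hB, hT⟩ := trigPoly_eq (by decide) hne hσ θ
  set B := shiftRatio α q s - shiftRatio α ((2 : ℤ) : ℝ) ((-2 : ℤ) : ℝ) with hBdef
  have hBe : B = 6 * q * s + 24 + 4 * α * (q + s) := by
    rw [hBdef]; simp only [shiftRatio]; push_cast; ring
  have hβ : shiftRatio α ((2 : ℤ) : ℝ) ((-2 : ℤ) : ℝ) = 13 * α - 24 := by
    simp only [shiftRatio]; push_cast; ring
  have hβ' : shiftRatio α q s = B + (13 * α - 24) := by rw [← hβ, hBdef]; ring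
  have hd' : (s : ℝ) - q ≠ 0 := by rw [sub_ne_zero]; exact_mod_cast hne.symm
  have hd : (q : ℝ) - s = -((s : ℝ) - q) := by ring
  -- Equality holds at Q = S = 2, so strict negativity of B has to come from nondegeneracy.
  have hneg : ∀ Q S : ℝ, 2 ≤ Q → 2 ≤ S → 6 * Q * (-S) + 24 + 4 * α * (Q + -S) ≤ 0 := by
    intro Q S hQ hS
    have := mul_nonneg (sub_nonneg.mpr hQ) (sub_nonneg.mpr hS)
    rcases le_total Q S with h | h
    · nlinarith
    · nlinarith [mul_nonneg (sub_nonneg.mpr h) (sub_nonneg.mpr hα₂.le)]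
  have hcases : (2 ≤ (q : ℝ) ∧ (s : ℝ) ≤ -2) ∨ ((q : ℝ) ≤ -2 ∧ 2 ≤ (s : ℝ)) := by
    rcases le_abs.mp hq with h | h <;> rcases le_abs.mp hs with h' | h'
    · nlinarith
    · left; constructor <;> [exact_mod_cast h; exact_mod_cast (by linarith : s ≤ -2)]
    · right; constructor <;> [exact_mod_cast (by linarith : q ≤ -2); exact_mod_cast h']
    · nlinarith
  have hBneg : B < 0 := by
    refine lt_of_le_of_ne ?_ hB
    rw [hBe]
    rcases hcases with ⟨h, h'⟩ | ⟨h, h'⟩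
    · have := hneg q (-s) h (by linarith); rw [neg_neg] at this; exact this
    · have := hneg s (-q) h' (by linarith); rw [neg_neg] at this; linarith
  have hq4 : 0 ≤ (q : ℝ) ^ 2 - 4 := by rcases hcases with ⟨h, _⟩ | ⟨h, _⟩ <;> nlinarith
  have hs4 : 0 ≤ (s : ℝ) ^ 2 - 4 := by rcases hcases with ⟨_, h⟩ | ⟨_, h⟩ <;> nlinarith
  -- Since 2α < 6 ≤ 3|s|, the factor 3s + 2α has the sign of s; likewise for q.
  refine ⟨-2 * (3 * s + 2 * α) * (q ^ 2 - 4) / ((s - q) * B),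
    -2 * (3 * q + 2 * α) * (s ^ 2 - 4) / ((q - s) * B), ?_, ?_, ?_, ?_⟩
  · rcases hcases with ⟨h, h'⟩ | ⟨h, h'⟩
    · refine div_nonneg (mul_nonneg (by linarith) hq4) ?_
      exact (mul_pos_of_neg_of_neg (by linarith) hBneg).le
    · refine div_nonneg_of_nonpos (mul_nonpos_of_nonpos_of_nonneg (by linarith) hq4) ?_
      exact (mul_neg_of_pos_of_neg (by linarith) hBneg).le
  · rcases hcases with ⟨h, h'⟩ | ⟨h, h'⟩
    · refine div_nonneg_of_nonpos (mul_nonpos_of_nonpos_of_nonneg (by linarith) hs4) ?_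
      exact (mul_neg_of_pos_of_neg (by linarith) hBneg).le
    · refine div_nonneg (mul_nonneg (by linarith) hs4) ?_
      exact (mul_pos_of_neg_of_neg (by linarith) hBneg).le
  · rw [show ((q : ℝ) - s) * B = -((s - q) * B) by ring, div_neg, ← sub_eq_add_neg, ← sub_div,
      div_eq_one_iff_eq (mul_ne_zero hd' hB), hBe]
    ring
  · rw [hT, trigPoly₃_sub hq hs hne, hβ, hβ']
    have hBc : (B : ℂ) ≠ 0 := by exact_mod_cast hB
    have hdc : (s : ℂ) - q ≠ 0 := by exact_mod_cast hd'
    generalize trigPoly₃ α 2 (-2) (Complex.exp (θ * Complex.I)) = T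
    generalize divDiff (Complex.exp (θ * Complex.I)) q = Dq
    generalize divDiff (Complex.exp (θ * Complex.I)) s = Ds
    rw [hd]
    push_cast
    clear_value B
    generalize (s : ℂ) - q = d at *
    field_simp
    ring

theorem re_nonpos_of_bound {T D W : ℂ} {γ K ρ r : ℝ} (hD : ‖D‖ ≤ K) (hW : ‖W‖ = ρ)
    (h : (T * W).re + |γ| * K * ρ ≤ r) : ((T + (γ : ℂ) * D) * W).re ≤ r := by
  have h1 : ((T + (γ : ℂ) * D) * W).re = (T * W).re + γ * (D * W).re := by
    rw [add_mul, Complex.add_re, mul_assoc, Complex.re_ofReal_mul]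
  have h2 : |γ * (D * W).re| ≤ |γ| * K * ρ := by
    rw [abs_mul, mul_assoc]
    refine mul_le_mul_of_nonneg_left ((Complex.abs_re_le_norm _).trans ?_) (abs_nonneg _)
    rw [norm_mul, hW]
    exact mul_le_mul_of_nonneg_right hD (hW ▸ norm_nonneg _)
  rw [h1]
  linarith [le_abs_self (γ * (D * W).re)]

/-- These are the conditions at α = 1 and α = 2, with the divided-difference term D known only
through its norm. The coefficients are those of the shifts (2, -2), and (24 - 13α)/6 takes the
values 11/6 and -1/3. The square roots δ and ρ are linearized by tangents, which leaves polynomial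
inequalities on subintervals of [0, 2]. -/
theorem family_interpolation_bounds {W D : ℂ} {u s' δ : ℝ} (hδ2 : δ ^ 2 = 2 * u)
    (hD1 : ‖D‖ ≤ δ ^ 3 / 6) (hD2 : ‖D‖ ≤ 8 / 15) (h0 : 0 < u) (hu2 : u ≤ 2)
    (hs2 : s' ^ 2 = u * (2 - u)) (hre : W.re = u ^ 2) (him : W.im = s' * (1 + u)) :
    ((((1 - 2 / 3 * u - 2 / 9 * u ^ 2 : ℝ) : ℂ) + ((10 / 9 * u * s' : ℝ) : ℂ) *
      Complex.I + ((11 / 6 : ℝ) : ℂ) * D) * W).re ≤ 0 ∧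
    ((((1 - 4 / 3 * u + 2 / 9 * u ^ 2 : ℝ) : ℂ) + ((8 / 9 * u * s' : ℝ) : ℂ) *
      Complex.I + ((-1 / 3 : ℝ) : ℂ) * D) * W).re ≤ 0 ∧
    ((((1 - 2 / 3 * u - 2 / 9 * u ^ 2 : ℝ) : ℂ) + ((10 / 9 * u * s' : ℝ) : ℂ) *
      Complex.I + ((11 / 6 : ℝ) : ℂ) * D) * W ^ 2).re ≤ 0 ∧
    ((((1 - 4 / 3 * u + 2 / 9 * u ^ 2 : ℝ) : ℂ) + ((8 / 9 * u * s' : ℝ) : ℂ) *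
      Complex.I + ((-1 / 3 : ℝ) : ℂ) * D) * W ^ 2).re ≤ 0 := by
  have hu0 := h0.le
  obtain ⟨hρ2, hm⟩ := norm_lubichBase_ge hu0 hu2 hs2 hre him
  set ρ := ‖W‖ with hρ
  have hρ0 : 0 ≤ ρ := norm_nonneg _
  have hδρ : (δ * ρ) ^ 2 = u ^ 2 * (4 + 6 * u) := by rw [mul_pow, hδ2, hρ2]; ring
  -- Here δρ/u = √(4 + 6u) is bounded by the arithmetic-geometric mean inequality, sharp at c² = 4 +
  -- 6u.
  have hKρ : ∀ c : ℝ, 0 < c → δ ^ 3 / 6 * ρ ≤ u ^ 2 * (4 + 6 * u + c ^ 2) / (6 * c) := by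
    intro c hc
    have h1 : δ * ρ ≤ u * (4 + 6 * u + c ^ 2) / (2 * c) := by
      rw [le_div_iff₀ (by positivity)]
      have : 0 ≤ (δ * ρ / u - c) ^ 2 * u := by positivity
      have h2 : (δ * ρ / u - c) ^ 2 * u = u * (4 + 6 * u) - 2 * c * (δ * ρ) + c ^ 2 * u := by
        have h3 : (δ * ρ / u) ^ 2 = 4 + 6 * u := by rw [div_pow, hδρ]; field_simp
        have h4 : δ * ρ / u * u = δ * ρ := div_mul_cancel₀ _ h0.ne'
        linear_combination u * h3 - 2 * c * h4
      linarith
    calc δ ^ 3 / 6 * ρ = u / 3 * (δ * ρ) := by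
          linear_combination (δ * ρ / 6) * hδ2
      _ ≤ u / 3 * (u * (4 + 6 * u + c ^ 2) / (2 * c)) :=
          mul_le_mul_of_nonneg_left h1 (by positivity)
      _ = _ := by field_simp; ring
  -- The same for δ = √(2u), sharp at c² = 2u.
  have hK : ∀ c : ℝ, 0 < c → δ ^ 3 / 6 ≤ u * (2 * u + c ^ 2) / (6 * c) := by
    intro c hc
    have h1 : δ ≤ (2 * u + c ^ 2) / (2 * c) := by
      rw [le_div_iff₀ (by positivity)]
      nlinarith [sq_nonneg (δ - c)]
    calc δ ^ 3 / 6 = u / 3 * δ := by linear_combination (δ / 6) * hδ2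
      _ ≤ u / 3 * ((2 * u + c ^ 2) / (2 * c)) := mul_le_mul_of_nonneg_left h1 (by positivity)
      _ = _ := by field_simp; ring
  have hTre : ∀ a b : ℝ, (((a : ℂ) + (b * u * s' : ℝ) * Complex.I) * W).re =
      u ^ 2 * (a - b * ((2 - u) * (1 + u))) := fun a b => by
    simp only [Complex.mul_re, Complex.mul_im, Complex.add_re, Complex.add_im,
      Complex.ofReal_re, Complex.ofReal_im, Complex.I_re, Complex.I_im, hre, him]
    linear_combination (-b * u * (1 + u)) * hs2
  have hTre2 : ∀ a b : ℝ, (((a : ℂ) + (b * u * s' : ℝ) * Complex.I) * W ^ 2).re =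
      u * (a * (2 * u ^ 3 - 3 * u - 2) - 2 * b * u ^ 3 * ((2 - u) * (1 + u))) := fun a b => by
    simp only [pow_two, Complex.mul_re, Complex.mul_im, Complex.add_re, Complex.add_im,
      Complex.ofReal_re, Complex.ofReal_im, Complex.I_re, Complex.I_im, hre, him]
    linear_combination (-a * (1 + u) ^ 2 - 2 * b * u ^ 3 * (1 + u)) * hs2
  have hW2 : ‖W ^ 2‖ = u * (2 + 3 * u) := by rw [norm_pow, ← hρ, hρ2]
  have hb := bernstein_nonneg hu0 hu2
  have hu2' : 0 ≤ u ^ 2 := by positivity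
  have abs1 : |(11 / 6 : ℝ)| = 11 / 6 := abs_of_pos (by norm_num)
  have abs2 : |(-1 / 3 : ℝ)| = 1 / 3 := by rw [abs_of_neg (by norm_num)]; norm_num
  refine ⟨?_, ?_, ?_, ?_⟩
  · have e := hTre (1 - 2 / 3 * u - 2 / 9 * u ^ 2) (10 / 9)
    -- The bounds δ³/6 and 8/15 cross near u = 11/10. Below that point c = 2 is sharp at u = 0 and c
    -- = 16/5 near u = 1.04, with the change at 15/16.
    rcases le_total u (11 / 10) with hu' | hu'
    · refine re_nonpos_of_bound hD1 rfl ?_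
      rw [e, abs1, mul_assoc]
      rcases le_total u (15 / 16) with hu'' | hu''
      · have hc := hKρ 2 (by norm_num)
        have hb' := bernstein_nonneg hu0 hu''
        have hp : 0 ≤ 11 / 9 + 16 / 9 * u - 8 / 9 * u ^ 2 - 11 / 6 * (8 + 6 * u) / 12 := by
          linarith [hb' 0 2, hb' 1 1, hb' 2 0]
        linarith [mul_nonneg hu2' hp]
      · have hc : δ ^ 3 / 6 * ρ ≤ u ^ 2 * (4 + 6 * u + 256 / 25) * (5 / 96) :=
          (hKρ (16 / 5) (by norm_num)).trans_eq (by ring)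
        have hb' := bernstein_nonneg (sub_nonneg.mpr hu'')
          (by linarith : u - 15 / 16 ≤ 11 / 10 - 15 / 16)
        have hp : 0 ≤ 11 / 9 + 16 / 9 * u - 8 / 9 * u ^ 2 -
            11 / 6 * (4 + 6 * u + 256 / 25) * (5 / 96) := by
          linarith [hb' 0 2, hb' 1 1, hb' 2 0]
        linarith [mul_nonneg hu2' hp]
    · refine re_nonpos_of_bound hD2 rfl ?_
      rw [e, abs1, ← hρ]
      -- The tangent bound for the square root at ρ = 3, with ρ² = 2u + 3u².
      have hc : ρ ≤ (9 + 2 * u + 3 * u ^ 2) / 6 := by nlinarith [sq_nonneg (ρ - 3)]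
      have hb' := bernstein_nonneg (sub_nonneg.mpr hu')
          (by linarith : u - 11 / 10 ≤ 2 - 11 / 10)
      linarith [hb' 0 4, hb' 1 3, hb' 2 2, hb' 3 1, hb' 4 0]
  · have e := hTre (1 - 4 / 3 * u + 2 / 9 * u ^ 2) (8 / 9)
    refine re_nonpos_of_bound hD1 rfl ?_
    rw [e, abs2, mul_assoc]
    have hc := hKρ 2 (by norm_num)
    have hp : 0 ≤ 7 / 9 + 20 / 9 * u - 10 / 9 * u ^ 2 - 1 / 3 * (8 + 6 * u) / 12 := by
      linarith [hb 0 2, hb 1 1, hb 2 0]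
    linarith [mul_nonneg hu2' hp]
  · have e := hTre2 (1 - 2 / 3 * u - 2 / 9 * u ^ 2) (10 / 9)
    have hpos : 0 ≤ u * (2 + 3 * u) := by positivity
    rcases le_total u (11 / 10) with hu' | hu'
    · have hK' : δ ^ 3 / 6 ≤ u * (2 * u + 49 / 25) * (5 / 42) :=
        (hK (7 / 5) (by norm_num)).trans_eq (by ring)
      refine re_nonpos_of_bound (hD1.trans hK') hW2 ?_
      rw [e, abs1]
      have hb' := bernstein_nonneg hu0 hu'
      have hp : 0 ≤ (1 - 2 / 3 * u - 2 / 9 * u ^ 2) * (2 + 3 * u - 2 * u ^ 3) +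
          20 / 9 * u ^ 3 * ((2 - u) * (1 + u)) -
          11 / 6 * (u * (2 * u + 49 / 25) * (5 / 42)) * (2 + 3 * u) := by
        linarith [hb' 0 5, hb' 1 4, hb' 2 3, hb' 3 2, hb' 4 1, hb' 5 0]
      linarith [mul_nonneg hu0 hp]
    · refine re_nonpos_of_bound hD2 hW2 ?_
      rw [e, abs1]
      have hb' := bernstein_nonneg (sub_nonneg.mpr hu')
          (by linarith : u - 11 / 10 ≤ 2 - 11 / 10)
      have hp : 0 ≤ (1 - 2 / 3 * u - 2 / 9 * u ^ 2) * (2 + 3 * u - 2 * u ^ 3) +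
          20 / 9 * u ^ 3 * ((2 - u) * (1 + u)) -
          11 / 6 * (8 / 15) * (2 + 3 * u) := by
        linarith [hb' 0 5, hb' 1 4, hb' 2 3, hb' 3 2, hb' 4 1, hb' 5 0]
      linarith [mul_nonneg hu0 hp]
  · have e := hTre2 (1 - 4 / 3 * u + 2 / 9 * u ^ 2) (8 / 9)
    have hK' : δ ^ 3 / 6 ≤ 2 / 3 * u := by
      have := hK 2 (by norm_num)
      nlinarith [mul_nonneg hu0 (sub_nonneg.mpr hu2)]
    refine re_nonpos_of_bound (hD1.trans hK') hW2 ?_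
    rw [e, abs2]
    have hp : 0 ≤ (1 - 4 / 3 * u + 2 / 9 * u ^ 2) * (2 + 3 * u - 2 * u ^ 3) +
        16 / 9 * u ^ 3 * ((2 - u) * (1 + u)) - 1 / 3 * (2 / 3 * u) * (2 + 3 * u) := by
      linarith [hb 0 7, hb 1 6, hb 2 5, hb 3 4, hb 4 3, hb 5 2, hb 6 1, hb 7 0]
    linarith [mul_nonneg hu0 hp]

/-- D depends on α through μ and ν, but it is frozen as a complex number of bounded modulus; the
remaining dependence of T on α is affine, as `re_mul_cpow_nonpos` requires. -/
theorem symbol_nonpos_of_family {q s : ℤ} {α θ : ℝ} (hα₁ : 1 < α) (hα₂ : α < 2) (hq : 2 ≤ |q|)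
    (hs : 2 ≤ |s|) (hqs : q * s < 0)
    (hσ : (⟨1, 2, 1, -2, 1, q, 1, s⟩ : Shifts).Nondegenerate α) (hθ : 0 ≤ Real.sin θ) :
    ((⟨1, 2, 1, -2, 1, q, 1, s⟩ : Shifts).trigPoly α θ * lubichBase θ ^ (α : ℂ)).re ≤ 0 := by
  obtain ⟨μ, ν, hμ, hν, hμν, hT⟩ := trigPoly_family θ hα₁ hα₂ hq hs hqs hσ
  set z := Complex.exp (θ * Complex.I) with hz
  have hz1 : ‖z‖ = 1 := Complex.norm_exp_ofReal_mul_I θ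
  set D := (μ : ℂ) * divDiff z q + ν * divDiff z s with hD
  have hDb : ∀ K, ‖divDiff z q‖ ≤ K → ‖divDiff z s‖ ≤ K → ‖D‖ ≤ K := fun K h1 h2 => by
    calc ‖D‖ ≤ ‖(μ : ℂ) * divDiff z q‖ + ‖(ν : ℂ) * divDiff z s‖ := norm_add_le _ _
      _ = μ * ‖divDiff z q‖ + ν * ‖divDiff z s‖ := by
        rw [norm_mul, norm_mul, Complex.norm_real, Complex.norm_real, Real.norm_of_nonneg hμ,
          Real.norm_of_nonneg hν]
      _ ≤ μ * K + ν * K := by gcongr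
      _ = K := by rw [← add_mul, hμν, one_mul]
  have hD1 := hDb _ (norm_divDiff_le hz1 hq).1 (norm_divDiff_le hz1 hs).1
  have hD2 := hDb _ (norm_divDiff_le hz1 hq).2 (norm_divDiff_le hz1 hs).2
  rw [hT, trigPoly₃_central α θ (Or.inr <| Or.inl ⟨rfl, rfl, rfl⟩)]
  clear_value D
  set δ := ‖z - 1‖ with hδ
  have hδ0 : 0 ≤ δ := norm_nonneg _
  set u := 1 - Real.cos θ with hu
  have hδ2 : δ ^ 2 = 2 * u := by
    rw [hδ, Complex.sq_norm, hz, Complex.exp_mul_I, ← Complex.ofReal_cos, ← Complex.ofReal_sin,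
      Complex.normSq_apply]
    simp only [Complex.sub_re, Complex.add_re, Complex.ofReal_re, Complex.mul_re, Complex.I_re,
      Complex.ofReal_im, Complex.I_im, Complex.one_re, Complex.sub_im, Complex.add_im,
      Complex.mul_im, Complex.one_im]
    have := Real.sin_sq_add_cos_sq θ
    rw [hu]; linear_combination this
  set s' := Real.sin θ with hs'
  have hu0 : 0 ≤ u := by have := Real.cos_le_one θ; linarith
  have hu2 : u ≤ 2 := by have := Real.neg_one_le_cos θ; linarith
  have hs2 : s' ^ 2 = u * (2 - u) := by
    have := Real.sin_sq_add_cos_sq θ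
    rw [hu]; linear_combination this
  have hre : (lubichBase θ).re = u ^ 2 := by
    rw [lubichBase_eq]; simp only [Complex.mul_re, Complex.add_re, Complex.ofReal_re,
      Complex.ofReal_im, Complex.I_re, Complex.I_im]; ring
  have him : (lubichBase θ).im = s' * (1 + u) := by
    rw [lubichBase_eq]; simp only [Complex.mul_im, Complex.add_im, Complex.ofReal_re,
      Complex.ofReal_im, Complex.I_re, Complex.I_im]; ring
  have hβ : shiftRatio α ((2 : ℤ) : ℝ) ((-2 : ℤ) : ℝ) = 13 * α - 24 := by
    simp only [shiftRatio]; push_cast; ring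
  rw [hβ]
  simp only [centralPoly]
  rw [← hu, ← hs']
  generalize lubichBase θ = W at *
  clear hT hDb
  clear_value δ u s' z
  rcases hu0.eq_or_lt with h0 | h0
  · have : W = 0 := by
      have hs0 : s' = 0 := by rw [← h0] at hs2; simpa using hs2
      apply Complex.ext <;> simp [hre, him, ← h0, hs0]
    have hα0 : (α : ℂ) ≠ 0 := by exact_mod_cast (by linarith : α ≠ 0)
    rw [this, Complex.zero_cpow hα0]; simp
  obtain ⟨t, rfl⟩ : ∃ t, α = 1 + t := ⟨α - 1, by ring⟩
  have hW0 : W ≠ 0 := fun h => by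
    rw [h, Complex.zero_re] at hre; have := pow_pos h0 2; linarith
  obtain ⟨hρ2, hm⟩ := norm_lubichBase_ge hu0 hu2 hs2 hre him
  set ρ := ‖W‖ with hρ
  have hρ0 : 0 ≤ ρ := norm_nonneg _
  have h := re_mul_cpow_nonpos (W := W) (m := 2 * u) (t := t)
    (T₁ := (((1 - 2 / 3 * u - 2 / 9 * u ^ 2 : ℝ) : ℂ) + ((10 / 9 * u * s' : ℝ) : ℂ) * Complex.I) +
      ((11 / 6 : ℝ) : ℂ) * D)
    (T₂ := (((1 - 4 / 3 * u + 2 / 9 * u ^ 2 : ℝ) : ℂ) + ((8 / 9 * u * s' : ℝ) : ℂ) * Complex.I) +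
      ((-1 / 3 : ℝ) : ℂ) * D)
    hW0 (by rw [hre]; positivity) (by rw [him]; positivity) (by linarith) (by linarith) hm
  obtain ⟨c11, c21, c12, c22⟩ := family_interpolation_bounds hδ2 hD1 hD2 h0 hu2 hs2 hre him
  have := h c11 c21 c22 (by
    have : 2 * u * ((((1 - 4 / 3 * u + 2 / 9 * u ^ 2 : ℝ) : ℂ) + ((8 / 9 * u * s' : ℝ) : ℂ) *
      Complex.I + ((-1 / 3 : ℝ) : ℂ) * D) * W).re ≤ 0 :=
      mul_nonpos_of_nonneg_of_nonpos (by positivity) c21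
    linarith)
  convert this using 3
  push_cast
  ring

end

noncomputable section

/-! ### Negativity of the symbol -/

theorem Shifts.Effective.symbol_re_nonpos {σ : Shifts} {α : ℝ} (hα₁ : 1 < α) (hα₂ : α < 2)
    (hσ : σ.Effective) (hσα : σ.Nondegenerate α) (θ : ℝ) : (σ.symbol α θ).re ≤ 0 := by
  have key : ∀ θ, 0 ≤ Real.sin θ → (σ.symbol α θ).re ≤ 0 := by
    intro θ hθ
    rw [σ.symbol_eq (by linarith)]
    rcases hσ with ⟨q, s, hq, hs, hqs, -, rfl⟩ | h
    · exact symbol_nonpos_of_family hα₁ hα₂ hq hs hqs hσα hθ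
    · exact symbol_nonpos_of_central hα₁ hα₂ h hσα hθ
  rcases le_total 0 (Real.sin θ) with h | h
  · exact key θ h
  · rw [← σ.symbol_neg_re hα₁ hα₂]
    exact key _ (by rw [Real.sin_neg]; linarith)

theorem Shifts.Effective.matrix_form_nonpos {σ : Shifts} {α : ℝ} (hα₁ : 1 < α) (hα₂ : α < 2)
    (hσ : σ.Effective) (hσα : σ.Nondegenerate α) {N : ℕ} (v : Fin (N - 1) → ℝ) :
    v ⬝ᵥ (σ.matrix α N *ᵥ v) ≤ 0 := by
  have h := toeplitz_form_nonpos (σ.summable_coeff hα₁ hα₂) (σ.hasSum_symbol hα₁ hα₂)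
    (hσ.symbol_re_nonpos hα₁ hα₂ hσα) v
  refine le_trans (le_of_eq ?_) h
  simp only [dotProduct, Matrix.mulVec, Shifts.matrix_apply, Finset.mul_sum]
  exact Finset.sum_congr rfl fun i _ => Finset.sum_congr rfl fun j _ => by ring

/-- Consistency uses only this common shape; the finer restrictions on the shifts matter for the
sign of the symbol. -/
theorem Shifts.Effective.exists_eq {σ : Shifts} (hσ : σ.Effective) :
    ∃ q s qb sb : ℤ, q ≠ 1 ∧ s ≠ 1 ∧ qb ≠ 1 ∧ sb ≠ 1 ∧ q ≠ s ∧ qb ≠ sb ∧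
      σ = ⟨1, q, 1, s, 1, qb, 1, sb⟩ := by
  rcases hσ with ⟨q, s, hq, hs, hqs, -, rfl⟩ | rfl | rfl | rfl | rfl | rfl | rfl | rfl
  · refine ⟨2, -2, q, s, by decide, by decide, ?_, ?_, by decide, ?_, rfl⟩
    · rintro rfl; norm_num at hq
    · rintro rfl; norm_num at hs
    · rintro rfl; nlinarith [mul_self_nonneg q]
  all_goals exact ⟨_, _, _, _, by decide, by decide, by decide, by decide, by decide, by decide, rfl⟩

/-! ### Order of consistency of the symbol -/

open Filter Topology Asymptotics

theorem exp_mul_sub_isBigO (n : ℕ) (k : ℂ) :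
    (fun y : ℂ => Complex.exp (k * y) - ∑ i ∈ Finset.range n, (k * y) ^ i / i.factorial)
      =O[𝓝 0] fun y => y ^ n := by
  have h : Tendsto (fun y : ℂ => k * y) (𝓝 0) (𝓝 0) := by
    have : Continuous fun y : ℂ => k * y := by fun_prop
    simpa using this.tendsto 0
  refine ((Complex.exp_sub_sum_range_isBigO_pow n).comp_tendsto h).trans ?_
  simp only [Function.comp_def, mul_pow]
  exact isBigO_const_mul_self _ _ _

/-- Taylor expansion at y = 0 reduces to three moments of the weights A and B. Only the cubic
coefficient depends on the shifts, and only through `shiftRatio`. -/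
theorem trigPoly₃_exp_isBigO {α : ℝ} {q s : ℤ} (hq : q ≠ 1) (hs : s ≠ 1) (hqs : q ≠ s) :
    (fun y : ℂ => trigPoly₃ α q s (Complex.exp y) -
      (1 + α / 3 * y ^ 2 + ((shiftRatio α q s : ℝ) / 36 - α / 4) * y ^ 3)) =O[𝓝 0]
      fun y => y ^ 4 := by
  have e1 := exp_mul_sub_isBigO 4 1
  have eq := exp_mul_sub_isBigO 4 q
  have es := exp_mul_sub_isBigO 4 s
  have q1 : (q : ℂ) - 1 ≠ 0 := by rw [sub_ne_zero]; exact_mod_cast hq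
  have s1 : (s : ℂ) - 1 ≠ 0 := by rw [sub_ne_zero]; exact_mod_cast hs
  have d1 : (s : ℂ) - q ≠ 0 := by rw [sub_ne_zero]; exact_mod_cast hqs.symm
  have d2 : (q : ℂ) - s = -((s : ℂ) - q) := by ring
  set A : ℂ := (3 * s + 2 * α) / (3 * (s - q)) with hA
  set B : ℂ := (3 * q + 2 * α) / (3 * (q - s)) with hB
  have h := ((e1.const_mul_left (q / (q - 1))).sub (eq.const_mul_left (1 / (q - 1)))).const_mul_left A
    |>.add (((e1.const_mul_left (s / (s - 1))).sub (es.const_mul_left (1 / (s - 1)))).const_mul_left B)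
  refine h.congr_left fun y => ?_
  have hAB : A + B = 1 := by rw [hA, hB, d2]; field_simp; ring
  have hAB1 : A * q + B * s = -(2 * α / 3) := by rw [hA, hB, d2]; field_simp; ring
  have hAB2 : A * (q * (q + 1)) + B * (s * (s + 1)) = -((shiftRatio α q s : ℝ) / 6 - 3 * α / 2) := by
    rw [hA, hB, d2]; simp only [shiftRatio]; push_cast; field_simp; ring
  have hF : trigPoly₃ α q s (Complex.exp y) =
      A * (q / (q - 1) * Complex.exp (1 * y) - 1 / (q - 1) * Complex.exp (q * y)) +
      B * (s / (s - 1) * Complex.exp (1 * y) - 1 / (s - 1) * Complex.exp (s * y)) := by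
    rw [Complex.exp_int_mul, Complex.exp_int_mul, one_mul, trigPoly₃, hA, hB]
    push_cast
    ring
  have hx : ∀ x : ℂ, x - 1 ≠ 0 →
      x / (x - 1) * ∑ i ∈ Finset.range 4, (1 * y) ^ i / (i.factorial : ℂ) -
        1 / (x - 1) * ∑ i ∈ Finset.range 4, (x * y) ^ i / (i.factorial : ℂ) =
      1 - x * y ^ 2 / 2 - x * (x + 1) * y ^ 3 / 6 := by
    intro x hx
    simp only [Finset.sum_range_succ, Finset.sum_range_zero, Nat.factorial]
    push_cast
    field_simp
    ring
  rw [hF]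
  have hxq := hx q q1
  have hxs := hx s s1
  linear_combination A * hxq - A * hxq - (A * hxq + B * hxs) - hAB + y ^ 2 / 2 * hAB1 + y ^ 3 / 6 * hAB2

/-- The outer weights have sum 1 and cancel the two ratios in the cubic coefficient. -/
theorem Shifts.Effective.trigPoly_isBigO {σ : Shifts} {α : ℝ} (hσ : σ.Effective)
    (hσα : σ.Nondegenerate α) :
    (fun θ : ℝ => σ.trigPoly α θ - (1 + α / 3 * (θ * Complex.I) ^ 2 - α / 4 * (θ * Complex.I) ^ 3))
      =O[𝓝 0] fun θ => θ ^ 4 := by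
  obtain ⟨q, s, qb, sb, h1, h2, h3, h4, h5, h6, rfl⟩ := hσ.exists_eq
  have hlim : Tendsto (fun θ : ℝ => (θ : ℂ) * Complex.I) (𝓝 0) (𝓝 0) := by
    have : Continuous fun θ : ℝ => (θ : ℂ) * Complex.I := by fun_prop
    simpa using this.tendsto 0
  have e1 := (trigPoly₃_exp_isBigO (α := α) h1 h2 h5).comp_tendsto hlim
  have e2 := (trigPoly₃_exp_isBigO (α := α) h3 h4 h6).comp_tendsto hlim
  obtain ⟨hB, -⟩ := trigPoly_eq h5 h6 hσα 0
  have hB' : ((shiftRatio α qb sb : ℝ) : ℂ) - (shiftRatio α q s : ℝ) ≠ 0 := by exact_mod_cast hB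
  have h := (e1.const_mul_left ((shiftRatio α qb sb : ℝ) / ((shiftRatio α qb sb : ℝ) -
    (shiftRatio α q s : ℝ)) : ℂ)).sub (e2.const_mul_left ((shiftRatio α q s : ℝ) /
      ((shiftRatio α qb sb : ℝ) - (shiftRatio α q s : ℝ)) : ℂ))
  have hg : ((fun y : ℂ => y ^ 4) ∘ fun θ : ℝ => (θ : ℂ) * Complex.I) =O[𝓝 0]
      fun θ : ℝ => θ ^ 4 := IsBigO.of_bound 1 (Eventually.of_forall fun θ => by simp)
  have h' := h.trans hg
  refine h'.congr_left fun θ => ?_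
  rw [(trigPoly_eq h5 h6 hσα θ).2]
  simp only [Function.comp_def]
  push_cast
  generalize shiftRatio α q s = b at hB' ⊢
  generalize shiftRatio α qb sb = bb at hB' ⊢
  field_simp
  ring

theorem one_add_cpow_isBigO (α : ℂ) :
    (fun v : ℂ => (1 + v) ^ α - (1 + α * v)) =O[𝓝 0] fun v => v ^ 2 := by
  have hlog : (fun v : ℂ => Complex.log (1 + v) - v) =O[𝓝 0] fun v => v ^ 2 := by
    refine IsBigO.of_bound 1 ?_
    filter_upwards [Metric.ball_mem_nhds (0 : ℂ) (by norm_num : (0 : ℝ) < 1 / 2)] with v hv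
    rw [mem_ball_zero_iff] at hv
    refine (Complex.norm_log_one_add_sub_self_le (by linarith)).trans ?_
    rw [norm_pow, one_mul]
    have : (1 - ‖v‖)⁻¹ ≤ 2 := by
      rw [inv_le_comm₀ (by linarith) (by norm_num)]; linarith
    nlinarith [sq_nonneg ‖v‖]
  have hsq : (fun v : ℂ => v ^ 2) =O[𝓝 0] fun v => v :=
    IsBigO.of_bound 1 <| by
      filter_upwards [Metric.ball_mem_nhds (0 : ℂ) one_pos] with v hv
      rw [mem_ball_zero_iff] at hv
      rw [norm_pow, one_mul]
      nlinarith [norm_nonneg v]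
  have hlog1 : (fun v : ℂ => α * Complex.log (1 + v)) =O[𝓝 0] fun v => v := by
    have := (hlog.trans hsq).add (isBigO_refl (fun v : ℂ => v) (𝓝 0))
    exact (this.congr_left fun v => by ring).const_mul_left α
  have hlim : Tendsto (fun v : ℂ => α * Complex.log (1 + v)) (𝓝 0) (𝓝 0) :=
    hlog1.trans_tendsto tendsto_id
  have h2 := ((Complex.exp_sub_sum_range_isBigO_pow 2).comp_tendsto hlim).trans (hlog1.pow 2)
  refine (h2.add (hlog.const_mul_left α)).congr' ?_ EventuallyEq.rfl
  filter_upwards [Metric.ball_mem_nhds (0 : ℂ) one_pos] with v hv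
  rw [mem_ball_zero_iff] at hv
  have hne : 1 + v ≠ 0 := fun h => by
    rw [add_eq_zero_iff_eq_neg'.mp h] at hv; simp at hv
  rw [Complex.cpow_def_of_ne_zero hne]
  simp [Finset.sum_range_succ]
  ring_nf

theorem lubichBase_isBigO :
    (fun θ : ℝ => lubichBase θ - ((θ * Complex.I) - (θ * Complex.I) ^ 3 / 3 +
      (θ * Complex.I) ^ 4 / 4)) =O[𝓝 0] fun θ => θ ^ 5 := by
  have hlim : Tendsto (fun θ : ℝ => (θ : ℂ) * Complex.I) (𝓝 0) (𝓝 0) := by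
    have : Continuous fun θ : ℝ => (θ : ℂ) * Complex.I := by fun_prop
    simpa using this.tendsto 0
  have h := (((exp_mul_sub_isBigO 5 (-2)).const_mul_left (1 / 2)).sub
    ((exp_mul_sub_isBigO 5 (-1)).const_mul_left 2)).comp_tendsto hlim
  have hg : ((fun y : ℂ => y ^ 5) ∘ fun θ : ℝ => (θ : ℂ) * Complex.I) =O[𝓝 0]
      fun θ : ℝ => θ ^ 5 := IsBigO.of_bound 1 (Eventually.of_forall fun θ => by simp)
  refine (h.trans hg).congr_left fun θ => ?_
  simp only [Function.comp_def, lubichBase]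
  generalize (θ : ℂ) * Complex.I = y
  have : Complex.exp (-2 * y) = Complex.exp (-y) ^ 2 := by
    rw [← Complex.exp_nat_mul]; congr 1; push_cast; ring
  rw [this, show -1 * y = -y by ring]
  simp only [Finset.sum_range_succ, Finset.sum_range_zero, Nat.factorial]
  push_cast
  ring

theorem mul_cpow_of_re_pos {y w α : ℂ} (hy0 : y ≠ 0) (hy : 0 ≤ y.re) (hw : 0 < w.re) :
    (y * w) ^ α = y ^ α * w ^ α := by
  have hw0 : w ≠ 0 := fun h => by rw [h] at hw; simp at hw
  have ha1 := abs_le.mp (Complex.abs_arg_le_pi_div_two_iff.mpr hy)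
  have ha2 := abs_lt.mp (Complex.abs_arg_lt_pi_div_two_iff.mpr (Or.inl hw))
  rw [Complex.cpow_def_of_ne_zero hy0, Complex.cpow_def_of_ne_zero hw0,
    Complex.cpow_def_of_ne_zero (mul_ne_zero hy0 hw0),
    (Complex.log_mul_eq_add_log_iff hy0 hw0).mpr ⟨by linarith, by linarith⟩, add_mul,
    Complex.exp_add]

theorem norm_mul_I_cpow {α : ℝ} (θ : ℝ) : ‖((θ : ℂ) * Complex.I) ^ (α : ℂ)‖ = |θ| ^ α := by
  rw [Complex.norm_cpow_real, norm_mul, Complex.norm_I, mul_one, Complex.norm_real,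
    Real.norm_eq_abs]

/-- With y = iθ, the quotient ψ = W/y equals 1 - y²/3 + y³/4 + O(y⁴), and its α-th power cancels T =
1 + αy²/3 - αy³/4 + O(y⁴) through third order. The principal power of W = yψ splits because Re y = 0
and Re ψ > 0 near 0. -/
theorem Shifts.Effective.symbol_sub_isBigO {σ : Shifts} {α : ℝ} (hα₁ : 1 < α)
    (hσ : σ.Effective) (hσα : σ.Nondegenerate α) :
    (fun θ : ℝ => σ.symbol α θ - (θ * Complex.I) ^ (α : ℂ)) =O[𝓝[≠] 0]
      fun θ => |θ| ^ (α + 4) := by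
  set Y : ℝ → ℂ := fun θ => θ * Complex.I with hY
  set ψ : ℝ → ℂ := fun θ => lubichBase θ / Y θ with hψ
  have hY1 : Y =O[𝓝[≠] 0] fun θ => θ := IsBigO.of_bound 1 (Eventually.of_forall fun θ => by simp [hY])
  have hne : ∀ᶠ θ : ℝ in 𝓝[≠] 0, Y θ ≠ 0 := by
    filter_upwards [self_mem_nhdsWithin] with θ hθ
    simpa [hY] using hθ
  have hpow : ∀ m n : ℕ, m ≤ n → (fun θ : ℝ => θ ^ n) =O[𝓝[≠] 0] fun θ => θ ^ m := by
    intro m n hmn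
    refine IsBigO.of_bound 1 ?_
    filter_upwards [nhdsWithin_le_nhds (Metric.ball_mem_nhds (0 : ℝ) one_pos)] with θ hθ
    rw [mem_ball_zero_iff] at hθ
    rw [norm_pow, norm_pow, one_mul]
    exact pow_le_pow_of_le_one (norm_nonneg _) hθ.le hmn
  have h1 : (fun θ => ψ θ - 1 - (-(Y θ) ^ 2 / 3 + Y θ ^ 3 / 4)) =O[𝓝[≠] 0] fun θ : ℝ => θ ^ 4 := by
    have hinv : (fun θ => (Y θ)⁻¹) =O[𝓝[≠] 0] fun θ : ℝ => θ⁻¹ :=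
      IsBigO.of_bound 1 (Eventually.of_forall fun θ => by simp [hY])
    refine ((lubichBase_isBigO.mono nhdsWithin_le_nhds).mul hinv).congr' ?_ ?_
    · filter_upwards [hne] with θ hθ
      simp only [hψ]
      change (lubichBase θ - (Y θ - Y θ ^ 3 / 3 + Y θ ^ 4 / 4)) * (Y θ)⁻¹ = _
      field_simp
      ring
    · filter_upwards [self_mem_nhdsWithin] with θ hθ
      have : θ ≠ 0 := hθ
      field_simp
  have hY2 : ∀ c d : ℂ, (fun θ => c * Y θ ^ 2 + d * Y θ ^ 3) =O[𝓝[≠] 0] fun θ : ℝ => θ ^ 2 := fun c d =>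
    ((hY1.pow 2).const_mul_left c).add (((hY1.pow 3).trans (hpow 2 3 (by norm_num))).const_mul_left d)
  have hv : (fun θ => ψ θ - 1) =O[𝓝[≠] 0] fun θ : ℝ => θ ^ 2 :=
    ((h1.trans (hpow 2 4 (by norm_num))).add (hY2 (-1 / 3) (1 / 4))).congr_left fun θ => by ring
  have hsq0 : Tendsto (fun θ : ℝ => θ ^ 2) (𝓝[≠] 0) (𝓝 0) := by
    have : Continuous fun θ : ℝ => θ ^ 2 := by fun_prop
    simpa using (this.tendsto 0).mono_left nhdsWithin_le_nhds
  have hv0 : Tendsto (fun θ => ψ θ - 1) (𝓝[≠] 0) (𝓝 0) := hv.trans_tendsto hsq0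
  have h2 : (fun θ => ψ θ ^ (α : ℂ) - (1 + α * (-(Y θ) ^ 2 / 3 + Y θ ^ 3 / 4))) =O[𝓝[≠] 0]
      fun θ : ℝ => θ ^ 4 := by
    have e := ((one_add_cpow_isBigO α).comp_tendsto hv0).trans (hv.pow 2)
    have e' := (e.congr_right fun θ => by ring : _ =O[𝓝[≠] 0] fun θ : ℝ => θ ^ 4).add
      (h1.const_mul_left (α : ℂ))
    refine e'.congr_left fun θ => ?_
    simp only [Function.comp_def]
    rw [add_sub_cancel]
    ring
  have hT := (hσ.trigPoly_isBigO hσα).mono (nhdsWithin_le_nhds (s := {0}ᶜ))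
  have hbd : ∀ c d : ℂ, (fun θ => 1 + (c * Y θ ^ 2 + d * Y θ ^ 3)) =O[𝓝[≠] 0] fun _ => (1 : ℝ) := fun c d =>
    (isBigO_const_const _ one_ne_zero _).add ((hY2 c d).trans (by simpa using hpow 0 2 (by norm_num)))
  have h3 : (fun θ => σ.trigPoly α θ * ψ θ ^ (α : ℂ) - 1) =O[𝓝[≠] 0] fun θ : ℝ => θ ^ 4 := by
    have hψb : (fun θ => ψ θ ^ (α : ℂ)) =O[𝓝[≠] 0] fun _ => (1 : ℝ) :=
      ((h2.trans (by simpa using hpow 0 4 (by norm_num))).add (hbd (-α / 3) (α / 4))).congr_left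
        fun θ => by ring
    have a1 := (hT.mul hψb).congr_right fun θ => mul_one _
    have a2 := ((hbd (α / 3) (-α / 4)).mul h2).congr_right fun θ => one_mul _
    -- The product of the truncations is (1 + αE)(1 - αE) with E = y²/3 - y³/4; this is the leftover
    -- -α²E².
    have a3 : (fun θ => (α : ℂ) ^ 2 * (-(1 / 9) * Y θ ^ 4 + 1 / 6 * Y θ ^ 5 - 1 / 16 * Y θ ^ 6))
        =O[𝓝[≠] 0] fun θ : ℝ => θ ^ 4 :=
      ((((hY1.pow 4).const_mul_left _).add (((hY1.pow 5).trans
        (hpow 4 5 (by norm_num))).const_mul_left _)).sub (((hY1.pow 6).trans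
        (hpow 4 6 (by norm_num))).const_mul_left _)).const_mul_left _
    refine ((a1.add a2).add a3).congr_left fun θ => ?_
    change (_ - (1 + α / 3 * Y θ ^ 2 - α / 4 * Y θ ^ 3)) * _ + _ + _ = _
    ring
  have hrepos : ∀ᶠ θ : ℝ in 𝓝[≠] 0, 0 < (ψ θ).re := by
    have : Tendsto (fun θ => (ψ θ).re) (𝓝[≠] 0) (𝓝 1) := by
      have := (Complex.continuous_re.tendsto _).comp (hv0.add_const 1)
      simpa [Function.comp_def] using this
    exact this.eventually (lt_mem_nhds one_pos)
  have h4 : (fun θ => Y θ ^ (α : ℂ)) =O[𝓝[≠] 0] fun θ => |θ| ^ α :=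
    IsBigO.of_bound 1 (Eventually.of_forall fun θ => by
      simp only [hY]
      rw [norm_mul_I_cpow, one_mul, Real.norm_of_nonneg (by positivity)])
  refine (h4.mul h3).congr' ?_ ?_
  · filter_upwards [hne, hrepos] with θ hθ hre
    have : lubichBase θ = Y θ * ψ θ := by simp only [hψ]; field_simp
    rw [σ.symbol_eq (by linarith), this, mul_cpow_of_re_pos hθ (by simp [hY]) hre]
    ring
  · filter_upwards [self_mem_nhdsWithin] with θ hθ
    have : 0 < |θ| := abs_pos.mpr hθ
    rw [Real.rpow_add this, show (4 : ℝ) = ((4 : ℕ) : ℝ) by norm_num, Real.rpow_natCast,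
      (by decide : Even 4).pow_abs]

theorem Shifts.norm_symbol_le (σ : Shifts) {α : ℝ} (hα₁ : 1 < α) (hα₂ : α < 2) (θ : ℝ) :
    ‖σ.symbol α θ‖ ≤ ∑' k, ‖σ.coeff α k‖ := by
  refine (σ.hasSum_symbol hα₁ hα₂ θ).norm_le_of_bounded (σ.summable_coeff hα₁ hα₂).hasSum
    fun k => ?_
  rw [norm_mul, norm_zpow, norm_exp_neg_mul_I, one_zpow, mul_one, Complex.norm_real]

/-- Near 0 the expansion applies. For |θ| ≥ δ the symbol is at most ∑ |c_k|, and the powers of |θ|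
are bounded below. The estimates are needed on the whole line because θ = 2πhξ is unbounded. -/
theorem Shifts.Effective.exists_symbol_bound {σ : Shifts} {α : ℝ} (hα₁ : 1 < α) (hα₂ : α < 2)
    (hσ : σ.Effective) (hσα : σ.Nondegenerate α) :
    ∃ C : ℝ, 0 ≤ C ∧ ∀ θ : ℝ, ‖σ.symbol α θ‖ ≤ C * |θ| ^ α ∧
      ‖σ.symbol α θ - (θ * Complex.I) ^ (α : ℂ)‖ ≤ C * |θ| ^ (α + 4) := by
  obtain ⟨K, hK0, hK⟩ := (hσ.symbol_sub_isBigO hα₁ hσα).exists_nonneg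
  rw [isBigOWith_iff, eventually_nhdsWithin_iff, Metric.eventually_nhds_iff] at hK
  obtain ⟨ε, hε, hK⟩ := hK
  set δ := min (ε / 2) 1 with hδ
  have hδ0 : 0 < δ := by positivity
  set M := ∑' k, ‖σ.coeff α k‖
  have hM0 : 0 ≤ M := tsum_nonneg fun _ => norm_nonneg _
  have hαc : (α : ℂ) ≠ 0 := by exact_mod_cast (by linarith : α ≠ 0)
  refine ⟨K + 1 + M / δ ^ α + (M / δ ^ α + 1) / δ ^ 4, by positivity, fun θ => ?_⟩
  have t1 : 0 ≤ M / δ ^ α := by positivity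
  have t2 : 0 ≤ (M / δ ^ α + 1) / δ ^ 4 := by positivity
  rcases eq_or_ne θ 0 with rfl | h0
  · have hb : lubichBase 0 = 0 := by simp [lubichBase]
    rw [σ.symbol_eq (by linarith), hb, Complex.zero_cpow hαc]
    simp [Complex.zero_cpow hαc]
    constructor <;> positivity
  have ha : 0 < |θ| := abs_pos.mpr h0
  have ha1 : 0 < |θ| ^ α := by positivity
  have hsplit : |θ| ^ (α + 4) = |θ| ^ α * |θ| ^ 4 := by
    rw [Real.rpow_add ha, show (4 : ℝ) = ((4 : ℕ) : ℝ) by norm_num, Real.rpow_natCast]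
  rw [hsplit]
  rcases lt_or_ge |θ| δ with hlt | hge
  · have hθ := hK (y := θ) (by
      rw [Real.dist_eq, sub_zero]; have := min_le_left (ε / 2) 1; linarith) h0
    rw [Real.norm_of_nonneg (by positivity), hsplit] at hθ
    have h1 : |θ| ^ 4 ≤ 1 := pow_le_one₀ ha.le (hlt.le.trans (min_le_right _ _))
    constructor
    · calc ‖σ.symbol α θ‖ ≤ ‖σ.symbol α θ - (θ * Complex.I) ^ (α : ℂ)‖ + ‖((θ : ℂ) * Complex.I) ^ (α : ℂ)‖ := by
            simpa using norm_add_le (σ.symbol α θ - (θ * Complex.I) ^ (α : ℂ)) ((θ * Complex.I) ^ (α : ℂ))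
        _ ≤ K * (|θ| ^ α * |θ| ^ 4) + |θ| ^ α := by rw [norm_mul_I_cpow]; gcongr
        _ ≤ K * (|θ| ^ α * 1) + |θ| ^ α := by gcongr
        _ = (K + 1) * |θ| ^ α := by ring
        _ ≤ _ := mul_le_mul_of_nonneg_right (by linarith) ha1.le
    · refine hθ.trans ?_
      gcongr; linarith
  · have hδα : δ ^ α ≤ |θ| ^ α := Real.rpow_le_rpow hδ0.le hge (by linarith)
    have hδ4 : δ ^ 4 ≤ |θ| ^ 4 := by gcongr
    have hδα0 : 0 < δ ^ α := by positivity
    have h1 : ‖σ.symbol α θ‖ ≤ M / δ ^ α * |θ| ^ α := by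
      refine (σ.norm_symbol_le hα₁ hα₂ θ).trans ?_
      rw [div_mul_eq_mul_div, le_div_iff₀ hδα0]
      gcongr
    constructor
    · refine h1.trans ?_
      gcongr; linarith
    · calc _ ≤ ‖σ.symbol α θ‖ + ‖((θ : ℂ) * Complex.I) ^ (α : ℂ)‖ := norm_sub_le _ _
        _ ≤ M / δ ^ α * |θ| ^ α + |θ| ^ α := by rw [norm_mul_I_cpow]; gcongr
        _ = (M / δ ^ α + 1) / δ ^ 4 * (|θ| ^ α * δ ^ 4) := by field_simp
        _ ≤ (M / δ ^ α + 1) / δ ^ 4 * (|θ| ^ α * |θ| ^ 4) := by gcongr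
        _ ≤ _ := by gcongr; linarith

end

noncomputable section

open Filter Topology

/-! ### The Laplace transform of a power -/

theorem integrableOn_rpow_mul_exp {σ r : ℝ} (hσ : -1 < σ) (hr : 0 < r) :
    IntegrableOn (fun t : ℝ => t ^ σ * Real.exp (-r * t)) (Ioi 0) := by
  have h := integrableOn_rpow_mul_exp_neg_mul_rpow hσ one_pos hr
  simpa only [Real.rpow_one] using h

theorem norm_exp_neg_mul_ofReal (s : ℂ) (t : ℝ) : ‖Complex.exp (-s * t)‖ = Real.exp (-s.re * t) := by
  rw [Complex.norm_exp]; simp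

theorem integrableOn_rpow_mul_cexp {σ : ℝ} {s : ℂ} (hσ : -1 < σ) (hs : 0 < s.re) :
    IntegrableOn (fun t : ℝ => ((t ^ σ : ℝ) : ℂ) * Complex.exp (-s * t)) (Ioi 0) := by
  refine (integrableOn_rpow_mul_exp hσ hs).mono' ?_ ?_
  · exact (Complex.measurable_ofReal.comp (by fun_prop)).aestronglyMeasurable.mul
      (Continuous.aestronglyMeasurable (by fun_prop))
  · refine (ae_restrict_mem measurableSet_Ioi).mono fun t ht => ?_
    rw [norm_mul, norm_exp_neg_mul_ofReal, Complex.norm_real,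
      Real.norm_of_nonneg (Real.rpow_nonneg (le_of_lt ht) _)]

theorem hasDerivAt_laplace_rpow {σ : ℝ} {s : ℂ} (hσ : 0 < σ) (hs : 0 < s.re) :
    HasDerivAt (fun z : ℂ => ∫ t in Ioi (0 : ℝ), ((t ^ (σ - 1) : ℝ) : ℂ) * Complex.exp (-z * t))
      (∫ t in Ioi (0 : ℝ), ((t ^ (σ - 1) : ℝ) : ℂ) * (Complex.exp (-s * t) * -t)) s := by
  have hm : ∀ z : ℂ, AEStronglyMeasurable
      (fun t : ℝ => ((t ^ (σ - 1) : ℝ) : ℂ) * Complex.exp (-z * t)) (volume.restrict (Ioi 0)) := fun z =>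
    (Complex.measurable_ofReal.comp (by fun_prop)).aestronglyMeasurable.mul
      (Continuous.aestronglyMeasurable (by fun_prop))
  refine (hasDerivAt_integral_of_dominated_loc_of_deriv_le (μ := volume.restrict (Ioi (0 : ℝ)))
    (bound := fun t : ℝ => t ^ σ * Real.exp (-(s.re / 2) * t))
    (F' := fun z (t : ℝ) => ((t ^ (σ - 1) : ℝ) : ℂ) * (Complex.exp (-z * t) * -t))
    (Metric.ball_mem_nhds s (half_pos hs)) (Eventually.of_forall hm)
    (integrableOn_rpow_mul_cexp (by linarith) hs) ?_ ?_
    (integrableOn_rpow_mul_exp (by linarith) (half_pos hs)) ?_).2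
  · exact (Complex.measurable_ofReal.comp (by fun_prop)).aestronglyMeasurable.mul
      (Continuous.aestronglyMeasurable (by fun_prop))
  · refine (ae_restrict_mem measurableSet_Ioi).mono fun t ht z hz => ?_
    have ht' : 0 < t := ht
    have hre : s.re / 2 ≤ z.re := by
      have h1 := (Complex.abs_re_le_norm (z - s)).trans (mem_ball_iff_norm.mp hz).le
      rw [Complex.sub_re, abs_le] at h1
      linarith
    rw [norm_mul, norm_mul, norm_exp_neg_mul_ofReal, norm_neg, Complex.norm_real, Complex.norm_real,
      Real.norm_of_nonneg (Real.rpow_nonneg ht'.le _), Real.norm_of_nonneg ht'.le,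
      show σ = σ - 1 + 1 by ring, Real.rpow_add_one ht'.ne', add_sub_cancel_right]
    have : Real.exp (-z.re * t) ≤ Real.exp (-(s.re / 2) * t) := by
      apply Real.exp_le_exp.mpr; nlinarith
    have h2 : 0 ≤ t ^ (σ - 1) := Real.rpow_nonneg ht'.le _
    calc t ^ (σ - 1) * (Real.exp (-z.re * t) * t) = t ^ (σ - 1) * t * Real.exp (-z.re * t) := by ring
      _ ≤ _ := by gcongr
  · refine Eventually.of_forall fun t z _ => ?_
    have h : HasDerivAt (fun z : ℂ => -z * (t : ℂ)) (-t) z := by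
      simpa using (hasDerivAt_id z).neg.mul_const (t : ℂ)
    exact h.cexp.const_mul _

/-- Both sides are holomorphic on the right half-plane and agree on the positive axis, where the
formula is the Gamma integral; the identity theorem does the rest. -/
theorem integral_rpow_mul_cexp {σ : ℝ} {s : ℂ} (hσ : 0 < σ) (hs : 0 < s.re) :
    ∫ t in Ioi (0 : ℝ), ((t ^ (σ - 1) : ℝ) : ℂ) * Complex.exp (-s * t) =
      s ^ (-σ : ℂ) * Real.Gamma σ := by
  have hopen : IsOpen {z : ℂ | 0 < z.re} := isOpen_lt continuous_const Complex.continuous_re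
  have hf : AnalyticOnNhd ℂ (fun z : ℂ => ∫ t in Ioi (0 : ℝ),
      ((t ^ (σ - 1) : ℝ) : ℂ) * Complex.exp (-z * t)) {z : ℂ | 0 < z.re} :=
    DifferentiableOn.analyticOnNhd (fun z hz =>
      (hasDerivAt_laplace_rpow hσ hz).differentiableAt.differentiableWithinAt) hopen
  have hg : AnalyticOnNhd ℂ (fun z : ℂ => z ^ (-σ : ℂ) * Real.Gamma σ) {z : ℂ | 0 < z.re} :=
    DifferentiableOn.analyticOnNhd (fun z hz => DifferentiableAt.differentiableWithinAt
      ((differentiableAt_id.cpow_const (Or.inl hz)).mul_const _)) hopen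
  have hreal : ∀ r : ℝ, 0 < r → ∫ t in Ioi (0 : ℝ), ((t ^ (σ - 1) : ℝ) : ℂ) *
      Complex.exp (-(r : ℂ) * t) = (r : ℂ) ^ (-σ : ℂ) * Real.Gamma σ := by
    intro r hr
    have h := Real.integral_rpow_mul_exp_neg_mul_Ioi hσ hr
    have h2 : (r : ℂ) ^ (-σ : ℂ) = (((1 / r) ^ σ : ℝ) : ℂ) := by
      rw [one_div, Real.inv_rpow hr.le, ← Real.rpow_neg hr.le, Complex.ofReal_cpow hr.le]
      push_cast; rfl
    rw [h2, ← Complex.ofReal_mul, ← h, ← integral_complex_ofReal]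
    refine setIntegral_congr_fun measurableSet_Ioi fun t _ => ?_
    push_cast
    rw [neg_mul]
  have hconv : Convex ℝ {z : ℂ | 0 < z.re} := convex_halfSpace_re_gt 0
  refine hf.eqOn_of_preconnected_of_frequently_eq hg hconv.isPreconnected
    (z₀ := 1) (by simp) ?_ hs
  have ht : Tendsto (fun x : ℝ => (x : ℂ)) (𝓝[≠] 1) (𝓝[≠] 1) := by
    refine tendsto_nhdsWithin_of_tendsto_nhds_of_eventually_within _ ?_ ?_
    · exact (Complex.continuous_ofReal.tendsto' 1 1 (by simp)).mono_left nhdsWithin_le_nhds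
    · filter_upwards [self_mem_nhdsWithin] with x hx
      simpa using hx
  refine ht.frequently (Eventually.frequently ?_)
  filter_upwards [nhdsWithin_le_nhds (lt_mem_nhds (zero_lt_one (α := ℝ)))] with r hr
  exact hreal r hr

/-! ### Laplace transforms of causal functions -/

/-- The bilateral Laplace transform. -/
def laplace (f : ℝ → ℂ) (s : ℂ) : ℂ := ∫ x : ℝ, Complex.exp (-s * x) * f x

/-- Functions of at most arbitrarily slow exponential growth. -/
def SlowGrowth (f : ℝ → ℂ) : Prop := ∀ ε > 0, ∃ C : ℝ, ∀ x, ‖f x‖ ≤ C * Real.exp (ε * x)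

theorem SlowGrowth.of_bounded {f : ℝ → ℂ} {a B : ℝ} (h0 : ∀ x < a, f x = 0) (hB : ∀ x, ‖f x‖ ≤ B) :
    SlowGrowth f := by
  intro ε hε
  have hB0 : 0 ≤ B := (norm_nonneg _).trans (hB 0)
  refine ⟨B * Real.exp (-(ε * a)), fun x => ?_⟩
  rcases lt_or_ge x a with h | h
  · rw [h0 x h, norm_zero]; positivity
  · refine (hB x).trans ?_
    rw [mul_assoc, ← Real.exp_add]
    refine le_mul_of_one_le_right hB0 (Real.one_le_exp ?_)
    nlinarith

theorem SlowGrowth.of_hasDerivAt {f f' : ℝ → ℂ} {a : ℝ} (hf : ∀ x, HasDerivAt f (f' x) x)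
    (h0 : ∀ x < a, f x = 0) (h : SlowGrowth f') : SlowGrowth f := by
  intro ε hε
  obtain ⟨C, hC⟩ := h ε hε
  have hC0 : 0 ≤ C := by
    have := (norm_nonneg _).trans (hC 0)
    simpa using this
  refine ⟨C / ε, fun x => ?_⟩
  rcases lt_or_ge x a with hx | hx
  · rw [h0 x hx, norm_zero]; positivity
  refine image_norm_le_of_norm_deriv_right_le_deriv_boundary (a := a - 1) (b := x) (f' := f')
    (B := fun x => C / ε * Real.exp (ε * x)) (B' := fun x => C * Real.exp (ε * x))
    (fun y _ => (hf y).continuousAt.continuousWithinAt) (fun y _ => (hf y).hasDerivWithinAt) ?_ ?_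
    (fun y _ => hC y) ⟨by linarith, le_rfl⟩
  · rw [h0 _ (by linarith), norm_zero]; positivity
  · intro y
    have h1 : HasDerivAt (fun y : ℝ => ε * y) ε y := by simpa using (hasDerivAt_id y).const_mul ε
    have h2 := h1.exp.const_mul (C / ε)
    rwa [show C / ε * (Real.exp (ε * y) * ε) = C * Real.exp (ε * y) by field_simp] at h2

theorem norm_le_integral_of_hasDerivAt {f f' : ℝ → ℂ} {a : ℝ} (hf : ∀ x, HasDerivAt f (f' x) x)
    (h0 : ∀ x < a, f x = 0) (h : Integrable f') (x : ℝ) : ‖f x‖ ≤ ∫ y, ‖f' y‖ := by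
  rcases lt_or_ge x a with hx | hx
  · rw [h0 x hx, norm_zero]; exact integral_nonneg fun _ => norm_nonneg _
  have h1 := intervalIntegral.integral_eq_sub_of_hasDerivAt (a := a - 1) (b := x)
    (fun y _ => hf y) h.intervalIntegrable
  rw [h0 (a - 1) (by linarith), sub_zero] at h1
  rw [← h1, intervalIntegral.integral_of_le (by linarith)]
  exact (norm_integral_le_integral_norm _).trans
    (setIntegral_le_integral h.norm (Eventually.of_forall fun _ => norm_nonneg _))

theorem SlowGrowth.integrable_exp_mul {f : ℝ → ℂ} {a : ℝ} {s : ℂ} (hs : 0 < s.re)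
    (hf : AEStronglyMeasurable f) (h0 : ∀ x < a, f x = 0) (h : SlowGrowth f) :
    Integrable fun x : ℝ => Complex.exp (-s * x) * f x := by
  obtain ⟨C, hC⟩ := h (s.re / 2) (half_pos hs)
  have hb : IntegrableOn (fun x : ℝ => C * Real.exp (-(s.re / 2) * x)) (Ioi (a - 1)) :=
    (exp_neg_integrableOn_Ioi (a - 1) (half_pos hs)).const_mul C
  have hb' := (integrable_indicator_iff measurableSet_Ioi).mpr hb
  refine hb'.mono' ((Continuous.aestronglyMeasurable (by fun_prop)).mul hf)
    (Eventually.of_forall fun x => ?_)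
  rw [norm_mul, norm_exp_neg_mul_ofReal]
  by_cases hx : x ∈ Ioi (a - 1)
  · rw [indicator_of_mem hx]
    calc Real.exp (-s.re * x) * ‖f x‖ ≤ Real.exp (-s.re * x) * (C * Real.exp (s.re / 2 * x)) := by
          gcongr; exact hC x
      _ = C * (Real.exp (-s.re * x) * Real.exp (s.re / 2 * x)) := by ring
      _ = _ := by rw [← Real.exp_add]; congr 2; ring
  · rw [indicator_of_notMem hx, h0 x (by simp at hx; linarith), norm_zero, mul_zero]

theorem norm_exp_mul_le_of_causal {f : ℝ → ℂ} {a : ℝ} {s : ℂ} (hs : 0 ≤ s.re) (hs1 : s.re ≤ 1)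
    (h0 : ∀ x < a, f x = 0) (x : ℝ) :
    ‖Complex.exp (-s * x) * f x‖ ≤ Real.exp |a| * ‖f x‖ := by
  rcases lt_or_ge x a with hx | hx
  · rw [h0 x hx]; simp
  · rw [norm_mul, norm_exp_neg_mul_ofReal]
    gcongr
    have := neg_abs_le a
    have := abs_nonneg a
    nlinarith

theorem integrable_exp_mul_of_causal {f : ℝ → ℂ} {a : ℝ} {s : ℂ} (hs : 0 ≤ s.re) (hs1 : s.re ≤ 1)
    (h0 : ∀ x < a, f x = 0) (hf : Integrable f) :
    Integrable fun x : ℝ => Complex.exp (-s * x) * f x :=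
  (hf.norm.const_mul (Real.exp |a|)).mono'
    ((Continuous.aestronglyMeasurable (by fun_prop)).mul hf.aestronglyMeasurable)
    (Eventually.of_forall fun x => norm_exp_mul_le_of_causal hs hs1 h0 x)

theorem laplace_deriv {f f' : ℝ → ℂ} {s : ℂ} (hf : ∀ x, HasDerivAt f (f' x) x)
    (h : Integrable fun x : ℝ => Complex.exp (-s * x) * f x)
    (h' : Integrable fun x : ℝ => Complex.exp (-s * x) * f' x) :
    laplace f' s = s * laplace f s := by
  have hd : ∀ x : ℝ, HasDerivAt (fun x : ℝ => Complex.exp (-s * x) * f x)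
      (-s * (Complex.exp (-s * x) * f x) + Complex.exp (-s * x) * f' x) x := by
    intro x
    have h1 : HasDerivAt (fun x : ℝ => -s * (x : ℂ)) (-s) x := by
      simpa using (Complex.ofRealCLM.hasDerivAt (x := x)).const_mul (-s)
    refine (h1.cexp.mul (hf x)).congr_deriv ?_
    ring
  have h2 := integral_eq_zero_of_hasDerivAt_of_integrable hd ((h.const_mul (-s)).add h') h
  rw [integral_add (h.const_mul (-s)) h', integral_const_mul] at h2
  rw [laplace, laplace]
  linear_combination h2

/-- Only the last function is assumed integrable. The others are successive primitives vanishing to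
the left of a, hence of slow growth, so for Re s > 0 the damping makes them integrable and
integration by parts has no boundary terms. -/
theorem laplace_iterate {f : ℕ → ℝ → ℂ} {n : ℕ} {a : ℝ} {s : ℂ} (hs : 0 < s.re) (hs1 : s.re ≤ 1)
    (hf : ∀ k < n, ∀ x, HasDerivAt (f k) (f (k + 1) x) x) (h0 : ∀ k ≤ n, ∀ x < a, f k x = 0)
    (hn : Integrable (f n)) :
    (∀ k ≤ n, Integrable fun x : ℝ => Complex.exp (-s * x) * f k x) ∧
      ∀ k ≤ n, laplace (f k) s = s ^ k * laplace (f 0) s := by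
  -- Descending induction on k: the function just below the top is bounded by the L¹ norm of its
  -- derivative.
  have hslow : ∀ j k, k + j + 1 = n → SlowGrowth (f k) := by
    intro j
    induction j with
    | zero =>
      intro k hk
      have hk' : k + 1 = n := by omega
      subst hk'
      exact SlowGrowth.of_bounded (h0 k (by omega))
        (norm_le_integral_of_hasDerivAt (hf k (by omega)) (h0 k (by omega)) hn)
    | succ j ih =>
      intro k hk
      exact SlowGrowth.of_hasDerivAt (hf k (by omega)) (h0 k (by omega)) (ih (k + 1) (by omega))
  have hint : ∀ k ≤ n, Integrable fun x : ℝ => Complex.exp (-s * x) * f k x := by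
    intro k hk
    rcases hk.eq_or_lt with rfl | hk'
    · exact integrable_exp_mul_of_causal hs.le hs1 (h0 k le_rfl) hn
    · refine SlowGrowth.integrable_exp_mul hs ?_ (h0 k hk) (hslow (n - k - 1) k (by omega))
      exact Continuous.aestronglyMeasurable
        (continuous_iff_continuousAt.mpr fun x => (hf k hk' x).continuousAt)
  refine ⟨hint, fun k => ?_⟩
  induction k with
  | zero => intro _; simp
  | succ k ih =>
    intro hk
    rw [laplace_deriv (hf k (by omega)) (hint k (by omega)) (hint (k + 1) hk), ih (by omega), pow_succ]
    ring

end

noncomputable section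

open Filter Topology

/-! ### The fractional integral and its Laplace transform -/

/-- The left fractional integral of order `σ` on the real line. -/
def fracIntegral (σ : ℝ) (w : ℝ → ℝ) (x : ℝ) : ℝ :=
  (Real.Gamma σ)⁻¹ * ∫ ξ in Iio x, (x - ξ) ^ (σ - 1) * w ξ

theorem fracIntegral_eq_zero {σ a : ℝ} {w : ℝ → ℝ} (h0 : ∀ x < a, w x = 0) {x : ℝ} (hx : x ≤ a) :
    fracIntegral σ w x = 0 := by
  rw [fracIntegral, setIntegral_eq_zero_of_forall_eq_zero, mul_zero]
  intro ξ hξ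
  rw [h0 ξ (lt_of_lt_of_le hξ hx), mul_zero]

/-- The causal kernel of the fractional integral, damped exponentially. -/
def dampedKernel (σ : ℝ) (s : ℂ) : ℝ → ℂ :=
  (Ioi 0).indicator fun t : ℝ => ((t ^ (σ - 1) : ℝ) : ℂ) * Complex.exp (-s * t)

/-- The weight e^{-sx} = e^{-st} e^{-s(x-t)} distributes over the convolution, and the damped kernel
becomes integrable for Re s > 0. -/
theorem exp_mul_fracIntegral (σ : ℝ) (w : ℝ → ℝ) (s : ℂ) (x : ℝ) :
    Complex.exp (-s * x) * (fracIntegral σ w x : ℂ) =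
      ((Real.Gamma σ)⁻¹ : ℝ) * MeasureTheory.convolution (dampedKernel σ s)
        (fun y => Complex.exp (-s * y) * (w y : ℂ)) (ContinuousLinearMap.mul ℂ ℂ) volume x := by
  have h : (∫ ξ in Iio x, (x - ξ) ^ (σ - 1) * w ξ) = ∫ t in Ioi (0 : ℝ), t ^ (σ - 1) * w (x - t) := by
    rw [← integral_indicator measurableSet_Iio, ← integral_indicator measurableSet_Ioi,
      ← integral_sub_left_eq_self _ volume x]
    congr 1
    ext t
    by_cases ht : 0 < t
    · rw [indicator_of_mem (by simpa using ht), indicator_of_mem (by simpa using ht)]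
      simp
    · rw [indicator_of_notMem (by simpa using ht), indicator_of_notMem (by simpa using ht)]
  rw [fracIntegral, h]
  push_cast
  rw [← integral_complex_ofReal, mul_left_comm]
  congr 1
  rw [MeasureTheory.convolution, ← integral_indicator measurableSet_Ioi, ← integral_const_mul]
  congr 1
  ext t
  simp only [ContinuousLinearMap.mul_apply', dampedKernel]
  by_cases ht : t ∈ Ioi (0 : ℝ)
  · rw [indicator_of_mem ht, indicator_of_mem ht]
    have : Complex.exp (-s * x) = Complex.exp (-s * t) * Complex.exp (-s * ((x - t : ℝ) : ℂ)) := by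
      rw [← Complex.exp_add]; congr 1; push_cast; ring
    rw [this]
    push_cast
    ring
  · rw [indicator_of_notMem ht, indicator_of_notMem ht]
    simp

theorem laplace_fracIntegral {σ : ℝ} {w : ℝ → ℝ} {s : ℂ} (hσ : 0 < σ) (hs : 0 < s.re)
    (hw : Integrable fun x : ℝ => Complex.exp (-s * x) * (w x : ℂ)) :
    laplace (fun x => (fracIntegral σ w x : ℂ)) s = s ^ (-σ : ℂ) * laplace (fun x => (w x : ℂ)) s := by
  have hk : Integrable (dampedKernel σ s) :=
    (integrable_indicator_iff measurableSet_Ioi).mpr (integrableOn_rpow_mul_cexp (by linarith) hs)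
  simp only [laplace, exp_mul_fracIntegral]
  rw [integral_const_mul, integral_convolution (ContinuousLinearMap.mul ℂ ℂ) hk hw,
    ContinuousLinearMap.mul_apply', dampedKernel, integral_indicator measurableSet_Ioi,
    integral_rpow_mul_cexp hσ hs]
  have hΓ : (Real.Gamma σ : ℂ) ≠ 0 := by exact_mod_cast (Real.Gamma_pos_of_pos hσ).ne'
  push_cast
  field_simp

/-- The point `ε + 2πiξ`. -/
def abscissa (ε ξ : ℝ) : ℂ := ε + 2 * Real.pi * ξ * Complex.I

theorem abscissa_re (ε ξ : ℝ) : (abscissa ε ξ).re = ε := by simp [abscissa]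

theorem fourier_eq_laplace (f : ℝ → ℂ) (ξ : ℝ) : 𝓕 f ξ = laplace f (abscissa 0 ξ) := by
  rw [Real.fourier_real_eq_integral_exp_smul, laplace]
  congr 1
  ext x
  rw [smul_eq_mul, abscissa]
  congr 2
  push_cast
  ring

theorem fourier_exp_mul_eq_laplace (f : ℝ → ℂ) (ε ξ : ℝ) :
    𝓕 (fun x : ℝ => Complex.exp (-ε * x) * f x) ξ = laplace f (abscissa ε ξ) := by
  rw [Real.fourier_real_eq_integral_exp_smul, laplace]
  congr 1
  ext x
  rw [smul_eq_mul, abscissa, ← mul_assoc, ← Complex.exp_add]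
  congr 2
  push_cast
  ring

theorem tendsto_laplace_abscissa {f : ℝ → ℂ} {a : ℝ} (h0 : ∀ x < a, f x = 0) (hf : Integrable f)
    (ξ : ℝ) : Tendsto (fun ε => laplace f (abscissa ε ξ)) (𝓝[>] 0) (𝓝 (𝓕 f ξ)) := by
  rw [fourier_eq_laplace]
  refine tendsto_integral_filter_of_dominated_convergence (fun x => Real.exp |a| * ‖f x‖)
    (Eventually.of_forall fun ε =>
      (Continuous.aestronglyMeasurable (by fun_prop)).mul hf.aestronglyMeasurable) ?_
    (hf.norm.const_mul _) (Eventually.of_forall fun x => ?_)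
  · filter_upwards [Ioc_mem_nhdsGT (zero_lt_one (α := ℝ))] with ε hε
    exact Eventually.of_forall fun x => norm_exp_mul_le_of_causal (by rw [abscissa_re]; exact hε.1.le)
      (by rw [abscissa_re]; exact hε.2) h0 x
  · refine Tendsto.mul_const _ ?_
    have : Continuous fun ε : ℝ => Complex.exp (-abscissa ε ξ * x) := by
      unfold abscissa; fun_prop
    exact (this.tendsto 0).mono_left nhdsWithin_le_nhds

theorem norm_laplace_le {f : ℝ → ℂ} {a : ℝ} {s : ℂ} (hs : 0 ≤ s.re) (hs1 : s.re ≤ 1)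
    (h0 : ∀ x < a, f x = 0) (hf : Integrable f) :
    ‖laplace f s‖ ≤ Real.exp |a| * ∫ x, ‖f x‖ := by
  rw [laplace, ← integral_const_mul]
  exact norm_integral_le_of_norm_le (hf.norm.const_mul _)
    (Eventually.of_forall fun x => norm_exp_mul_le_of_causal hs hs1 h0 x)

/-! ### Fourier transforms of Riemann-Liouville derivatives -/

section

variable {σ a : ℝ} {n : ℕ} {w : ℝ → ℝ}

theorem laplace_iteratedDeriv_fracIntegral {s : ℂ} (hσ : 0 < σ) (hs : 0 < s.re) (hs1 : s.re ≤ 1)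
    (hw : Integrable w) (h0 : ∀ x < a, w x = 0) (hJ : ContDiff ℝ n (fracIntegral σ w))
    (hn : Integrable (iteratedDeriv n (fracIntegral σ w))) :
    ∀ k ≤ n,
      (Integrable fun x : ℝ => Complex.exp (-s * x) * ((iteratedDeriv k (fracIntegral σ w) x : ℝ) : ℂ)) ∧
      laplace (fun x => ((iteratedDeriv k (fracIntegral σ w) x : ℝ) : ℂ)) s =
        s ^ k * (s ^ (-σ : ℂ) * laplace (fun x => (w x : ℂ)) s) := by
  have hd : ∀ k < n, ∀ x, HasDerivAt (fun x => ((iteratedDeriv k (fracIntegral σ w) x : ℝ) : ℂ))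
      (iteratedDeriv (k + 1) (fracIntegral σ w) x : ℝ) x := by
    intro k hk x
    refine HasDerivAt.ofReal_comp ?_
    rw [iteratedDeriv_succ]
    exact (hJ.differentiable_iteratedDeriv k (by exact_mod_cast hk) x).hasDerivAt
  have hz : ∀ k ≤ n, ∀ x < a, ((iteratedDeriv k (fracIntegral σ w) x : ℝ) : ℂ) = 0 := by
    intro k _ x hx
    have : fracIntegral σ w =ᶠ[𝓝 x] fun _ => 0 := by
      filter_upwards [Iio_mem_nhds hx] with y hy
      exact fracIntegral_eq_zero h0 (le_of_lt hy)
    rw [this.iteratedDeriv_eq k]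
    simp
  obtain ⟨h1, h2⟩ := laplace_iterate (f := fun k x => ((iteratedDeriv k (fracIntegral σ w) x : ℝ) : ℂ))
    hs hs1 hd hz hn.ofReal
  intro k hk
  refine ⟨h1 k hk, ?_⟩
  have hwc : Integrable fun x => (w x : ℂ) := hw.ofReal
  rw [h2 k hk]
  simp only [iteratedDeriv_zero]
  rw [laplace_fracIntegral hσ hs
    (integrable_exp_mul_of_causal hs.le hs1 (fun x hx => by rw [h0 x hx]; simp) hwc)]

theorem iteratedDeriv_fracIntegral_eq_zero (h0 : ∀ x < a, w x = 0) (k : ℕ) {x : ℝ} (hx : x < a) :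
    iteratedDeriv k (fracIntegral σ w) x = 0 := by
  have : fracIntegral σ w =ᶠ[𝓝 x] fun _ => 0 := by
    filter_upwards [Iio_mem_nhds hx] with y hy
    exact fracIntegral_eq_zero h0 (le_of_lt hy)
  rw [this.iteratedDeriv_eq k]
  simp

theorem pow_mul_cpow_neg {s : ℂ} (hs : s ≠ 0) (k : ℕ) (σ : ℝ) :
    s ^ k * s ^ (-σ : ℂ) = s ^ ((k - σ : ℝ) : ℂ) := by
  rw [← Complex.cpow_natCast, ← Complex.cpow_add _ _ hs]
  congr 1
  push_cast
  ring

theorem tendsto_abscissa_cpow {ξ : ℝ} (hξ : ξ ≠ 0) (γ : ℂ) :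
    Tendsto (fun ε => abscissa ε ξ ^ γ) (𝓝[>] 0) (𝓝 (abscissa 0 ξ ^ γ)) := by
  have h1 : Continuous fun ε => abscissa ε ξ := by unfold abscissa; fun_prop
  have hm : abscissa 0 ξ ∈ Complex.slitPlane := by
    rw [Complex.mem_slitPlane_iff]
    right
    simp [abscissa, hξ, Real.pi_ne_zero]
  exact ((h1.continuousAt.cpow continuousAt_const hm).tendsto).mono_left nhdsWithin_le_nhds

/-- The Laplace identity on Re s = ε is passed to the limit ε → 0; ξ ≠ 0 keeps the limit point 2πiξ
off the branch cut. -/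
theorem fourier_iteratedDeriv_fracIntegral (hσ : 0 < σ) (hw : Integrable w) (h0 : ∀ x < a, w x = 0)
    (hJ : ContDiff ℝ n (fracIntegral σ w)) (hn : Integrable (iteratedDeriv n (fracIntegral σ w)))
    {ξ : ℝ} (hξ : ξ ≠ 0) :
    𝓕 (fun x => ((iteratedDeriv n (fracIntegral σ w) x : ℝ) : ℂ)) ξ =
      abscissa 0 ξ ^ ((n - σ : ℝ) : ℂ) * 𝓕 (fun x => (w x : ℂ)) ξ := by
  have hwc : Integrable fun x => (w x : ℂ) := hw.ofReal
  have hnc : Integrable fun x => ((iteratedDeriv n (fracIntegral σ w) x : ℝ) : ℂ) := hn.ofReal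
  have h1 := tendsto_laplace_abscissa (a := a) (fun x hx => by
    rw [iteratedDeriv_fracIntegral_eq_zero h0 n hx, Complex.ofReal_zero]) hnc ξ
  have h2 := (tendsto_abscissa_cpow hξ ((n - σ : ℝ) : ℂ)).mul
    (tendsto_laplace_abscissa (a := a) (fun x hx => by rw [h0 x hx, Complex.ofReal_zero]) hwc ξ)
  refine tendsto_nhds_unique h1 (h2.congr' ?_)
  filter_upwards [Ioc_mem_nhdsGT (zero_lt_one (α := ℝ))] with ε hε
  have hre := abscissa_re ε ξ
  have hs0 : abscissa ε ξ ≠ 0 := fun h => by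
    rw [h, Complex.zero_re] at hre; exact hε.1.ne hre
  refine Eq.trans ?_ (laplace_iteratedDeriv_fracIntegral hσ (by rw [hre]; exact hε.1) (by rw [hre]; exact hε.2) hw h0 hJ hn n
    le_rfl).2.symm
  rw [← pow_mul_cpow_neg hs0, mul_assoc]

/-- The intermediate derivative is not assumed integrable, so Fourier inversion is applied to
e^{-εx} times it. The at least two further derivatives available up to order n give a majorant of
order 1/(1 + ξ²) independent of ε, and dominated convergence yields ε → 0. -/
theorem iteratedDeriv_fracIntegral_eq_integral (hσ : 0 < σ) {m : ℕ} (hm : σ ≤ m) (hmn : m + 2 ≤ n)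
    (hw : Integrable w) (h0 : ∀ x < a, w x = 0)
    (hJ : ContDiff ℝ n (fracIntegral σ w)) (hn : Integrable (iteratedDeriv n (fracIntegral σ w)))
    (x : ℝ) :
    ((iteratedDeriv m (fracIntegral σ w) x : ℝ) : ℂ) =
      ∫ ξ : ℝ, Complex.exp (2 * Real.pi * ξ * x * Complex.I) *
        (abscissa 0 ξ ^ ((m - σ : ℝ) : ℂ) * 𝓕 (fun x => (w x : ℂ)) ξ) := by
  set V : ℝ → ℂ := fun x => ((iteratedDeriv m (fracIntegral σ w) x : ℝ) : ℂ) with hV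
  set wc : ℝ → ℂ := fun x => (w x : ℂ) with hwc
  have hwc0 : ∀ x < a, wc x = 0 := fun x hx => by rw [hwc]; simp [h0 x hx]
  set B₁ := Real.exp |a| * ∫ x, ‖wc x‖
  set B₂ := Real.exp |a| * ∫ x, ‖((iteratedDeriv n (fracIntegral σ w) x : ℝ) : ℂ)‖
  have hB₁ : 0 ≤ B₁ := mul_nonneg (Real.exp_pos _).le (integral_nonneg fun _ => norm_nonneg _)
  have hB₂ : 0 ≤ B₂ := mul_nonneg (Real.exp_pos _).le (integral_nonneg fun _ => norm_nonneg _)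
  have hVc : Continuous V :=
    Complex.continuous_ofReal.comp (hJ.continuous_iteratedDeriv m (by exact_mod_cast (by omega)))
  have key : ∀ ε ∈ Ioc (0 : ℝ) 1, ∀ ξ : ℝ,
      laplace V (abscissa ε ξ) = abscissa ε ξ ^ ((m - σ : ℝ) : ℂ) * laplace wc (abscissa ε ξ) ∧
      ‖laplace V (abscissa ε ξ)‖ ≤ 2 * (B₁ + B₂) * (1 + ξ ^ 2)⁻¹ := by
    intro ε hε ξ
    have hre := abscissa_re ε ξ
    set s := abscissa ε ξ with hs
    have hs0 : s ≠ 0 := fun h => by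
      rw [h, Complex.zero_re] at hre; exact hε.1.ne hre
    have hsp : 0 < s.re := by rw [hre]; exact hε.1
    have hs1 : s.re ≤ 1 := by rw [hre]; exact hε.2
    have hL := laplace_iteratedDeriv_fracIntegral hσ hsp hs1 hw h0 hJ hn
    have e1 : laplace V s = s ^ ((m - σ : ℝ) : ℂ) * laplace wc s := by
      rw [(hL m (by omega)).2, ← pow_mul_cpow_neg hs0, mul_assoc]
    refine ⟨e1, ?_⟩
    have b1 : ‖laplace wc s‖ ≤ B₁ := norm_laplace_le hsp.le hs1 hwc0 hw.ofReal
    have b2 : ‖laplace (fun x => ((iteratedDeriv n (fracIntegral σ w) x : ℝ) : ℂ)) s‖ ≤ B₂ :=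
      norm_laplace_le hsp.le hs1 (fun x hx => by
        rw [iteratedDeriv_fracIntegral_eq_zero h0 n hx, Complex.ofReal_zero]) hn.ofReal
    have hξs : ξ ^ 2 ≤ ‖s‖ ^ 2 := by
      have h1 : |s.im| ≤ ‖s‖ := Complex.abs_im_le_norm s
      have h2 : s.im = 2 * Real.pi * ξ := by simp [hs, abscissa]
      rw [h2] at h1
      have h3 : |ξ| ≤ ‖s‖ := by
        refine le_trans ?_ h1
        rw [abs_mul, abs_of_pos (by positivity : 0 < 2 * Real.pi)]
        have := Real.pi_gt_three
        nlinarith [abs_nonneg ξ]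
      rw [← sq_abs]
      gcongr
    rw [← div_eq_mul_inv, le_div_iff₀ (by positivity)]
    -- For small s the transform of w suffices, since m - σ ≥ 0; for large s the bounded transform
    -- of the n-th derivative is divided by s^{n-m}.
    rcases le_total ‖s‖ 1 with hle | hle
    · have : ‖laplace V s‖ ≤ B₁ := by
        rw [e1, norm_mul, Complex.norm_cpow_real]
        have : ‖s‖ ^ ((m : ℝ) - σ) ≤ 1 := Real.rpow_le_one (norm_nonneg _) hle (by linarith)
        nlinarith [norm_nonneg (laplace wc s), Real.rpow_nonneg (norm_nonneg s) ((m : ℝ) - σ)]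
      have : ξ ^ 2 ≤ 1 := hξs.trans (by nlinarith [norm_nonneg s])
      nlinarith [norm_nonneg (laplace V s)]
    · have e2 : s ^ (n - m) * laplace V s =
          laplace (fun x => ((iteratedDeriv n (fracIntegral σ w) x : ℝ) : ℂ)) s := by
        rw [(hL n le_rfl).2, (hL m (by omega)).2, ← mul_assoc, ← pow_add]
        congr 2
        omega
      have e3 : ‖s‖ ^ (n - m) * ‖laplace V s‖ ≤ B₂ := by
        rw [← norm_pow, ← norm_mul, e2]; exact b2
      have e4 : ‖s‖ ^ 2 ≤ ‖s‖ ^ (n - m) := pow_le_pow_right₀ hle (by omega)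
      have e5 : ‖s‖ ^ 2 * ‖laplace V s‖ ≤ B₂ :=
        (mul_le_mul_of_nonneg_right e4 (norm_nonneg _)).trans e3
      have : 1 + ξ ^ 2 ≤ 2 * ‖s‖ ^ 2 := by nlinarith
      nlinarith [norm_nonneg (laplace V s)]
  have hinv : ∀ ε ∈ Ioc (0 : ℝ) 1, Complex.exp (-ε * x) * V x =
      ∫ ξ : ℝ, Complex.exp (2 * Real.pi * ξ * x * Complex.I) * laplace V (abscissa ε ξ) := by
    intro ε hε
    have hre := abscissa_re ε 0
    have hint : Integrable fun x : ℝ => Complex.exp (-ε * x) * V x := by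
      have := (laplace_iteratedDeriv_fracIntegral hσ (by rw [hre]; exact hε.1) (by rw [hre]; exact hε.2) hw h0 hJ hn m
        (by omega)).1
      simpa [abscissa] using this
    have hF : 𝓕 (fun x : ℝ => Complex.exp (-ε * x) * V x) = fun ξ => laplace V (abscissa ε ξ) :=
      funext fun ξ => fourier_exp_mul_eq_laplace V ε ξ
    have hFc : Continuous (𝓕 (fun x : ℝ => Complex.exp (-ε * x) * V x)) :=
      VectorFourier.fourierIntegral_continuous Real.continuous_fourierChar
        (by exact continuous_inner) hint
    have hFi : Integrable (𝓕 (fun x : ℝ => Complex.exp (-ε * x) * V x)) := by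
      refine (integrable_inv_one_add_sq.const_mul (2 * (B₁ + B₂))).mono' hFc.aestronglyMeasurable
        (Eventually.of_forall fun ξ => ?_)
      rw [hF]
      exact (key ε hε ξ).2
    have hc : Continuous fun x : ℝ => Complex.exp (-ε * x) * V x := by fun_prop
    have h := congrFun (hc.fourierInv_fourier_eq hint hFi) x
    rw [Real.fourierInv_eq', hF] at h
    rw [← h]
    congr 1
    ext ξ
    rw [smul_eq_mul]
    congr 2
    simp only [RCLike.inner_apply, conj_trivial]
    push_cast
    ring
  have hl : Tendsto (fun ε : ℝ => Complex.exp (-ε * x) * V x) (𝓝[>] 0) (𝓝 (V x)) := by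
    have : Continuous fun ε : ℝ => Complex.exp (-ε * x) * V x := by fun_prop
    simpa using (this.tendsto 0).mono_left (nhdsWithin_le_nhds (s := Ioi 0))
  refine tendsto_nhds_unique hl ?_
  have hmem := Ioc_mem_nhdsGT (zero_lt_one (α := ℝ))
  refine Tendsto.congr' (f₁ := fun ε => ∫ ξ : ℝ, Complex.exp (2 * Real.pi * ξ * x * Complex.I) *
    laplace V (abscissa ε ξ)) ?_ ?_
  · filter_upwards [hmem] with ε hε
    exact (hinv ε hε).symm
  have hne : ∀ᵐ ξ : ℝ, ξ ≠ 0 := by simp [ae_iff]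
  refine tendsto_integral_filter_of_dominated_convergence
    (fun ξ => 2 * (B₁ + B₂) * (1 + ξ ^ 2)⁻¹) ?_ ?_ (integrable_inv_one_add_sq.const_mul _) ?_
  · filter_upwards [hmem] with ε hε
    refine Continuous.aestronglyMeasurable (Continuous.mul (by fun_prop) ?_)
    have hre := abscissa_re ε 0
    have hint : Integrable fun x : ℝ => Complex.exp (-ε * x) * V x := by
      have := (laplace_iteratedDeriv_fracIntegral hσ (by rw [hre]; exact hε.1) (by rw [hre]; exact hε.2) hw h0 hJ hn m
        (by omega)).1
      simpa [abscissa] using this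
    have hF : 𝓕 (fun x : ℝ => Complex.exp (-ε * x) * V x) = fun ξ => laplace V (abscissa ε ξ) :=
      funext fun ξ => fourier_exp_mul_eq_laplace V ε ξ
    rw [← hF]
    exact VectorFourier.fourierIntegral_continuous Real.continuous_fourierChar
        (by exact continuous_inner) hint
  · filter_upwards [hmem] with ε hε
    refine Eventually.of_forall fun ξ => ?_
    rw [norm_mul, show (2 * Real.pi * ξ * x * Complex.I : ℂ) =
      ((2 * Real.pi * ξ * x : ℝ) : ℂ) * Complex.I by push_cast; ring,
      Complex.norm_exp_ofReal_mul_I, one_mul]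
    exact (key ε hε ξ).2
  · filter_upwards [hne] with ξ hξ
    refine Tendsto.const_mul _ ?_
    refine ((tendsto_abscissa_cpow hξ ((m - σ : ℝ) : ℂ)).mul
      (tendsto_laplace_abscissa hwc0 hw.ofReal ξ)).congr' ?_
    filter_upwards [hmem] with ε hε
    exact (key ε hε ξ).1.symm

end

end

noncomputable section

open Filter Topology

/-! ### One-sided regularity -/

/-- The conditions on the left fractional derivative of order `n - σ` in `FracRegular`, for a function
vanishing to the left of `a`. -/
structure LeftRegular (σ : ℝ) (n : ℕ) (a M : ℝ) (w : ℝ → ℝ) : Prop where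
  continuous : Continuous w
  integrable : Integrable w
  integrable_fourier : Integrable (𝓕 (fun x => (w x : ℂ)))
  eq_zero : ∀ x < a, w x = 0
  contDiff : ContDiff ℝ n (fracIntegral σ w)
  integrable_deriv : Integrable (iteratedDeriv n (fracIntegral σ w))
  integrable_fourier_deriv :
    Integrable (𝓕 (fun x => ((iteratedDeriv n (fracIntegral σ w) x : ℝ) : ℂ)))
  fourier_le : ∫ ξ, ‖𝓕 (fun x => ((iteratedDeriv n (fracIntegral σ w) x : ℝ) : ℂ)) ξ‖ ≤ M

theorem floor_add_one_sub {α : ℝ} (h₁ : 1 < α) (h₂ : α < 2) :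
    ⌊α⌋₊ = 1 ∧ ⌊α + 4⌋₊ = 5 := by
  constructor <;> rw [Nat.floor_eq_iff (by linarith)] <;> constructor <;> norm_num <;> linarith

theorem leftIntegral_univ (β : ℝ) (w : ℝ → ℝ) :
    leftIntegral univ β w = fracIntegral ((⌊β⌋₊ + 1 : ℕ) - β) w := by
  ext x
  rw [leftIntegral, fracIntegral, univ_inter]

theorem rightIntegral_univ (β : ℝ) (w : ℝ → ℝ) :
    rightIntegral univ β w = fun x => fracIntegral ((⌊β⌋₊ + 1 : ℕ) - β) (fun y => w (-y)) (-x) := by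
  ext x
  rw [rightIntegral, fracIntegral, univ_inter, ← integral_Iic_eq_integral_Iio,
    ← integral_comp_neg_Ioi x (fun ξ => (-x - ξ) ^ (((⌊β⌋₊ + 1 : ℕ) : ℝ) - β - 1) * w (-ξ))]
  congr 1
  refine setIntegral_congr_fun measurableSet_Ioi fun ξ _ => ?_
  simp only [neg_neg]
  rw [show -x - -ξ = ξ - x by ring]

/-- The sign (-1)^n cancels the one produced by reflection, so right-sided statements follow from
left-sided ones for y ↦ w(-y). -/
theorem rightRL_univ (β : ℝ) (w : ℝ → ℝ) (x : ℝ) :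
    rightRL univ β w x = leftRL univ β (fun y => w (-y)) (-x) := by
  rw [rightRL, leftRL, rightIntegral_univ, leftIntegral_univ, iteratedDeriv_comp_neg, smul_eq_mul,
    ← mul_assoc, ← mul_pow]
  norm_num

theorem FracRegular.left {β M a : ℝ} {w : ℝ → ℝ} (h : FracRegular β M w) (h0 : ∀ x < a, w x = 0) :
    LeftRegular ((⌊β⌋₊ + 1 : ℕ) - β) (⌊β⌋₊ + 1) a M w where
  continuous := h.continuous
  integrable := h.integrable
  integrable_fourier := h.integrable_fourier
  eq_zero := h0
  contDiff := leftIntegral_univ β w ▸ h.left_contDiff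
  integrable_deriv := leftIntegral_univ β w ▸ h.left_integrable
  integrable_fourier_deriv := leftIntegral_univ β w ▸ h.left_integrable_fourier
  fourier_le := leftIntegral_univ β w ▸ h.left_fourier_le

theorem fourier_comp_neg (f : ℝ → ℂ) (ξ : ℝ) : 𝓕 (fun x => f (-x)) ξ = 𝓕 f (-ξ) := by
  rw [Real.fourier_real_eq_integral_exp_smul, Real.fourier_real_eq_integral_exp_smul,
    ← integral_neg_eq_self]
  congr 1
  ext x
  rw [neg_neg]
  congr 4
  ring

theorem FracRegular.comp_neg {β M b : ℝ} {w : ℝ → ℝ} (h : FracRegular β M w)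
    (h0 : ∀ x, b < x → w x = 0) :
    LeftRegular ((⌊β⌋₊ + 1 : ℕ) - β) (⌊β⌋₊ + 1) (-b) M (fun x => w (-x)) := by
  have hR : ∀ x, iteratedDeriv (⌊β⌋₊ + 1) (fracIntegral ((⌊β⌋₊ + 1 : ℕ) - β) (fun x => w (-x))) x =
      rightRL univ β w (-x) := fun x => by
    rw [rightRL_univ, neg_neg, leftRL, leftIntegral_univ]
  have hF : ∀ ξ, 𝓕 (fun x => ((iteratedDeriv (⌊β⌋₊ + 1) (fracIntegral ((⌊β⌋₊ + 1 : ℕ) - β)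
      (fun x => w (-x))) x : ℝ) : ℂ)) ξ = 𝓕 (fun x => (rightRL univ β w x : ℂ)) (-ξ) := fun ξ => by
    simp only [hR]
    exact fourier_comp_neg (fun x => (rightRL univ β w x : ℂ)) ξ
  refine ⟨h.continuous.comp continuous_neg, h.integrable.comp_neg, ?_, fun x hx => h0 _ (by linarith),
    ?_, ?_, ?_, ?_⟩
  · have : 𝓕 (fun x => ((w (-x) : ℝ) : ℂ)) = fun ξ => 𝓕 (fun x => (w x : ℂ)) (-ξ) :=
      funext fun ξ => fourier_comp_neg (fun x => (w x : ℂ)) ξ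
    rw [this]
    exact h.integrable_fourier.comp_neg
  · have := h.right_contDiff.comp contDiff_neg
    rw [rightIntegral_univ] at this
    simpa [Function.comp_def] using this
  · rw [funext hR]
    exact h.right_integrable.comp_neg
  · rw [funext hF]
    exact h.right_integrable_fourier.comp_neg
  · simp only [hF]
    rw [integral_neg_eq_self (fun ξ => ‖𝓕 (fun x => (rightRL univ β w x : ℂ)) ξ‖)]
    exact h.right_fourier_le

/-! ### Fourier representation of difference operators -/

theorem norm_exp_two_pi (ξ x : ℝ) : ‖Complex.exp (2 * Real.pi * ξ * x * Complex.I)‖ = 1 := by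
  rw [show (2 * Real.pi * ξ * x * Complex.I : ℂ) =
      ((2 * Real.pi * ξ * x : ℝ) : ℂ) * Complex.I by push_cast; ring]
  exact Complex.norm_exp_ofReal_mul_I _

theorem eq_integral_fourier {w : ℝ → ℝ} (hw : Continuous w) (hwi : Integrable w)
    (hwf : Integrable (𝓕 (fun x => (w x : ℂ)))) (x : ℝ) :
    (w x : ℂ) = ∫ ξ : ℝ, Complex.exp (2 * Real.pi * ξ * x * Complex.I) *
      𝓕 (fun x => (w x : ℂ)) ξ := by
  have hc : Continuous fun x => (w x : ℂ) := Complex.continuous_ofReal.comp hw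
  have h := congrFun (hc.fourierInv_fourier_eq hwi.ofReal hwf) x
  rw [Real.fourierInv_eq'] at h
  rw [← h]
  congr 1
  ext ξ
  rw [smul_eq_mul]
  congr 2
  simp only [RCLike.inner_apply, conj_trivial]
  push_cast
  ring

section

variable {c : ℤ → ℝ} {Φ : ℝ → ℂ} {w : ℝ → ℝ}

/-- A shift by kh multiplies the transform by e^{-2πikhξ}; sum and integral are exchanged because
both c and the transform are absolutely summable. -/
theorem hasSum_difference (hc : Summable fun k => ‖c k‖)
    (hΦ : ∀ θ : ℝ, HasSum (fun k : ℤ => (c k : ℂ) * Complex.exp (-(θ * Complex.I)) ^ k) (Φ θ))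
    (hw : Continuous w) (hwi : Integrable w) (hwf : Integrable (𝓕 (fun x => (w x : ℂ)))) (h x : ℝ) :
    HasSum (fun k : ℤ => (c k : ℂ) * (w (x - k * h) : ℂ))
      (∫ ξ : ℝ, Complex.exp (2 * Real.pi * ξ * x * Complex.I) *
        (Φ (2 * Real.pi * h * ξ) * 𝓕 (fun x => (w x : ℂ)) ξ)) := by
  set F : ℤ → ℝ → ℂ := fun k ξ => (c k : ℂ) *
    (Complex.exp (2 * Real.pi * ξ * ((x - k * h : ℝ) : ℂ) * Complex.I) * 𝓕 (fun x => (w x : ℂ)) ξ)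
  have hFi : ∀ k, Integrable (F k) := fun k => by
    refine ((hwf.norm.const_mul ‖c k‖)).mono' ?_ (Eventually.of_forall fun ξ => ?_)
    · exact ((Continuous.aestronglyMeasurable (by fun_prop)).mul hwf.aestronglyMeasurable).const_mul _
    · simp only [F]
      rw [norm_mul, norm_mul, norm_exp_two_pi, one_mul, Complex.norm_real]
  have hFn : ∀ k, ∫ ξ, ‖F k ξ‖ = ‖c k‖ * ∫ ξ, ‖𝓕 (fun x => (w x : ℂ)) ξ‖ := fun k => by
    rw [← integral_const_mul]
    congr 1
    ext ξ
    simp only [F]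
    rw [norm_mul, norm_mul, norm_exp_two_pi, one_mul, Complex.norm_real]
  have hs := hasSum_integral_of_summable_integral_norm hFi (by
    simp only [hFn]; exact hc.mul_right _)
  have h1 : ∀ k, ∫ ξ, F k ξ = (c k : ℂ) * (w (x - k * h) : ℂ) := fun k => by
    rw [eq_integral_fourier hw hwi hwf (x - k * h), ← integral_const_mul]
  have h2 : ∀ ξ, ∑' k, F k ξ = Complex.exp (2 * Real.pi * ξ * x * Complex.I) *
        (Φ (2 * Real.pi * h * ξ) * 𝓕 (fun x => (w x : ℂ)) ξ) := fun ξ => by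
    have := ((hΦ (2 * Real.pi * h * ξ)).mul_right (𝓕 (fun x => (w x : ℂ)) ξ)).mul_left
      (Complex.exp (2 * Real.pi * ξ * x * Complex.I))
    rw [← this.tsum_eq]
    refine tsum_congr fun k => ?_
    simp only [F]
    have : Complex.exp (2 * Real.pi * ξ * ((x - k * h : ℝ) : ℂ) * Complex.I) =
        Complex.exp (2 * Real.pi * ξ * x * Complex.I) *
          Complex.exp (-(((2 * Real.pi * h * ξ : ℝ) : ℂ) * Complex.I)) ^ k := by
      rw [← Complex.exp_int_mul, ← Complex.exp_add]
      congr 1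
      push_cast
      ring
    rw [this]
    ring
  simp only [h1, h2] at hs
  exact hs

theorem abscissa_zero (ξ : ℝ) : abscissa 0 ξ = ((2 * Real.pi * ξ : ℝ) : ℂ) * Complex.I := by
  simp [abscissa]

theorem norm_abscissa_cpow (ξ γ : ℝ) : ‖abscissa 0 ξ ^ (γ : ℂ)‖ = |2 * Real.pi * ξ| ^ γ := by
  rw [abscissa_zero, norm_mul_I_cpow]

theorem LeftRegular.fourier_deriv_norm {σ a M : ℝ} {n : ℕ} (hσ : 0 < σ) (hw : LeftRegular σ n a M w) :
    Integrable (fun ξ => |2 * Real.pi * ξ| ^ (n - σ) * ‖𝓕 (fun x => (w x : ℂ)) ξ‖) ∧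
      ∫ ξ, |2 * Real.pi * ξ| ^ (n - σ) * ‖𝓕 (fun x => (w x : ℂ)) ξ‖ ≤ M := by
  have hne : ∀ᵐ ξ : ℝ, ξ ≠ 0 := by simp [ae_iff]
  have hae : (fun ξ => ‖𝓕 (fun x => ((iteratedDeriv n (fracIntegral σ w) x : ℝ) : ℂ)) ξ‖) =ᵐ[volume]
      fun ξ => |2 * Real.pi * ξ| ^ (n - σ) * ‖𝓕 (fun x => (w x : ℂ)) ξ‖ := by
    filter_upwards [hne] with ξ hξ
    rw [fourier_iteratedDeriv_fracIntegral hσ hw.integrable hw.eq_zero hw.contDiff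
      hw.integrable_deriv hξ, norm_mul, norm_abscissa_cpow]
  exact ⟨hw.integrable_fourier_deriv.norm.congr hae, (integral_congr_ae hae).symm.trans_le hw.fourier_le⟩

theorem abs_le_of_hasSum {γ K M h x D : ℝ} (hK : 0 ≤ K) (hh : 0 < h) (hc : Summable fun k => ‖c k‖)
    (hΦ : ∀ θ : ℝ, HasSum (fun k : ℤ => (c k : ℂ) * Complex.exp (-(θ * Complex.I)) ^ k) (Φ θ))
    (hb : ∀ θ, ‖Φ θ‖ ≤ K * |θ| ^ γ) {n : ℕ} {σ a : ℝ} (hσ : 0 < σ) (hγ : γ = n - σ)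
    (hw : LeftRegular σ n a M w) (hD : HasSum (fun k : ℤ => c k * w (x - k * h)) D) :
    |D| ≤ K * M * h ^ γ := by
  obtain ⟨hi, hM⟩ := hw.fourier_deriv_norm hσ
  have hD' : HasSum (fun k : ℤ => (c k : ℂ) * (w (x - k * h) : ℂ)) (D : ℂ) := by
    have := Complex.hasSum_ofReal.mpr hD
    simpa using this
  have e := hD'.unique (hasSum_difference hc hΦ hw.continuous hw.integrable hw.integrable_fourier h x)
  rw [← Real.norm_eq_abs, ← Complex.norm_real, e]
  subst hγ
  calc _ ≤ ∫ ξ, K * h ^ ((n : ℝ) - σ) * (|2 * Real.pi * ξ| ^ ((n : ℝ) - σ) * ‖𝓕 (fun x => (w x : ℂ)) ξ‖) := by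
        refine norm_integral_le_of_norm_le (hi.const_mul _) (Eventually.of_forall fun ξ => ?_)
        rw [norm_mul, norm_mul, norm_exp_two_pi, one_mul]
        have h1 := hb (2 * Real.pi * h * ξ)
        have h2 : |2 * Real.pi * h * ξ| ^ ((n : ℝ) - σ) =
            h ^ ((n : ℝ) - σ) * |2 * Real.pi * ξ| ^ ((n : ℝ) - σ) := by
          rw [show 2 * Real.pi * h * ξ = h * (2 * Real.pi * ξ) by ring, abs_mul, abs_of_pos hh,
            Real.mul_rpow hh.le (abs_nonneg _)]
        rw [h2] at h1
        exact (mul_le_mul_of_nonneg_right h1 (norm_nonneg _)).trans_eq (by ring)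
    _ ≤ K * h ^ ((n : ℝ) - σ) * M := by
        rw [integral_const_mul]
        exact mul_le_mul_of_nonneg_left hM (by positivity)
    _ = _ := by ring

/-- Difference quotient and derivative are Fourier integrals of the same transform. After rescaling,
the symbol error is at most K h⁴ |2πξ|^{γ+4}, which the derivative of order γ + 4 pays for. Orders γ
and γ + 4 share the same fractional integral, of order σ. -/
theorem abs_sub_le_of_hasSum {γ K M h x D : ℝ} (hK : 0 ≤ K) (hh : 0 < h)
    (hc : Summable fun k => ‖c k‖)
    (hΦ : ∀ θ : ℝ, HasSum (fun k : ℤ => (c k : ℂ) * Complex.exp (-(θ * Complex.I)) ^ k) (Φ θ))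
    (hb : ∀ θ : ℝ, ‖Φ θ - (θ * Complex.I) ^ (γ : ℂ)‖ ≤ K * |θ| ^ (γ + 4)) {m : ℕ} {σ a : ℝ}
    (hσ : 0 < σ) (hσm : σ ≤ m) (hγ : γ = m - σ)
    (hw : LeftRegular σ (m + 4) a M w) (hD : HasSum (fun k : ℤ => c k * w (x - k * h)) D) :
    |(h ^ γ)⁻¹ * D - iteratedDeriv m (fracIntegral σ w) x| ≤ K * M * h ^ 4 := by
  obtain ⟨hi, hM⟩ := hw.fourier_deriv_norm hσ
  have hγ4 : ((m + 4 : ℕ) : ℝ) - σ = γ + 4 := by rw [hγ]; push_cast; ring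
  rw [hγ4] at hi hM
  have hhγ : 0 < h ^ γ := by positivity
  have hD' : HasSum (fun k : ℤ => (c k : ℂ) * (w (x - k * h) : ℂ)) (D : ℂ) := by
    have := Complex.hasSum_ofReal.mpr hD
    simpa using this
  have e := hD'.unique (hasSum_difference hc hΦ hw.continuous hw.integrable hw.integrable_fourier h x)
  have e' := iteratedDeriv_fracIntegral_eq_integral hσ hσm (by omega) hw.integrable hw.eq_zero
    hw.contDiff hw.integrable_deriv x
  rw [← hγ] at e'
  set ŵ := 𝓕 (fun x => (w x : ℂ)) with hŵ
  have hγ0 : 0 ≤ γ := by rw [hγ]; linarith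
  have hmeas : AEStronglyMeasurable ŵ := hw.integrable_fourier.aestronglyMeasurable
  have hΦm : Continuous Φ := by
    have : Φ = fun θ : ℝ => ∑' k : ℤ, (c k : ℂ) * Complex.exp (-(θ * Complex.I)) ^ k :=
      funext fun θ => (hΦ θ).tsum_eq.symm
    rw [this]
    refine continuous_tsum (fun k => continuous_const.mul ?_) hc fun k θ => ?_
    · exact Continuous.zpow₀ (by fun_prop) k fun θ => Or.inl (Complex.exp_ne_zero _)
    · rw [norm_mul, norm_zpow, norm_exp_neg_mul_I, one_zpow, mul_one, Complex.norm_real]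
  have hpw : ∀ t : ℝ, 0 ≤ t → t ^ γ ≤ 1 + t ^ (γ + 4) := by
    intro t ht
    rcases le_total t 1 with h1 | h1
    · have := Real.rpow_le_one ht h1 hγ0
      have := Real.rpow_nonneg ht (γ + 4)
      linarith
    · have := Real.rpow_le_rpow_of_exponent_le h1 (by linarith : γ ≤ γ + 4)
      linarith
  have hi1 : Integrable fun ξ : ℝ => Complex.exp (2 * Real.pi * ξ * x * Complex.I) *
      (abscissa 0 ξ ^ (γ : ℂ) * ŵ ξ) := by
    refine (hw.integrable_fourier.norm.add hi).mono' ?_ (Eventually.of_forall fun ξ => ?_)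
    · refine (Continuous.aestronglyMeasurable (by fun_prop)).mul (AEStronglyMeasurable.mul ?_ hmeas)
      have : Measurable fun ξ => abscissa 0 ξ := by unfold abscissa; fun_prop
      exact (this.pow_const _).aestronglyMeasurable
    · rw [norm_mul, norm_exp_two_pi, one_mul, norm_mul, norm_abscissa_cpow]
      have := hpw _ (abs_nonneg (2 * Real.pi * ξ))
      calc _ ≤ (1 + |2 * Real.pi * ξ| ^ (γ + 4)) * ‖ŵ ξ‖ := by gcongr
        _ = _ := by simp only [Pi.add_apply]; ring
  have hpoint : ∀ ξ : ℝ, ‖((h ^ γ)⁻¹ : ℝ) * Φ (2 * Real.pi * h * ξ) - abscissa 0 ξ ^ (γ : ℂ)‖ ≤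
      K * h ^ 4 * |2 * Real.pi * ξ| ^ (γ + 4) := by
    intro ξ
    have h1 := hb (2 * Real.pi * h * ξ)
    have h2 : (((2 * Real.pi * h * ξ : ℝ) : ℂ) * Complex.I) ^ (γ : ℂ) =
        (h ^ γ : ℝ) * abscissa 0 ξ ^ (γ : ℂ) := by
      rcases eq_or_ne ξ 0 with rfl | hξ
      · rcases hγ0.eq_or_lt with h0 | h0
        · simp [← h0]
        · have : (γ : ℂ) ≠ 0 := by exact_mod_cast h0.ne'
          simp [abscissa, Complex.zero_cpow this]
      · rw [abscissa_zero, mul_comm ((h ^ γ : ℝ) : ℂ), Complex.ofReal_cpow hh.le, ← mul_cpow_of_re_pos (w := (h : ℂ))]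
        · congr 1
          push_cast
          ring
        · simp [hξ, Real.pi_ne_zero]
        · simp
        · simpa using hh
    have h3 : |2 * Real.pi * h * ξ| ^ (γ + 4) = h ^ γ * h ^ 4 * |2 * Real.pi * ξ| ^ (γ + 4) := by
      rw [show 2 * Real.pi * h * ξ = h * (2 * Real.pi * ξ) by ring, abs_mul, abs_of_pos hh,
        Real.mul_rpow hh.le (abs_nonneg _), Real.rpow_add hh, show (4 : ℝ) = ((4 : ℕ) : ℝ) by norm_num,
        Real.rpow_natCast]
    rw [h2, h3] at h1
    have h4 : ((h ^ γ)⁻¹ : ℝ) * Φ (2 * Real.pi * h * ξ) - abscissa 0 ξ ^ (γ : ℂ) =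
        ((h ^ γ)⁻¹ : ℝ) * (Φ (2 * Real.pi * h * ξ) - (h ^ γ : ℝ) * abscissa 0 ξ ^ (γ : ℂ)) := by
      rw [mul_sub, ← mul_assoc, ← Complex.ofReal_mul, inv_mul_cancel₀ hhγ.ne', Complex.ofReal_one,
        one_mul]
    rw [h4, norm_mul, Complex.norm_real, Real.norm_of_nonneg (by positivity)]
    calc _ ≤ (h ^ γ)⁻¹ * (K * (h ^ γ * h ^ 4 * |2 * Real.pi * ξ| ^ (γ + 4))) := by gcongr
      _ = _ := by field_simp
  have hi2 : Integrable fun ξ : ℝ => Complex.exp (2 * Real.pi * ξ * x * Complex.I) *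
      ((((h ^ γ)⁻¹ : ℝ) * Φ (2 * Real.pi * h * ξ) - abscissa 0 ξ ^ (γ : ℂ)) * ŵ ξ) := by
    refine (hi.const_mul (K * h ^ 4)).mono' ?_ (Eventually.of_forall fun ξ => ?_)
    · refine (Continuous.aestronglyMeasurable (by fun_prop)).mul (AEStronglyMeasurable.mul ?_ hmeas)
      have : Measurable fun ξ => abscissa 0 ξ := by unfold abscissa; fun_prop
      have h2 : Continuous fun ξ => (((h ^ γ)⁻¹ : ℝ) : ℂ) * Φ (2 * Real.pi * h * ξ) := by fun_prop
      exact h2.aestronglyMeasurable.sub (this.pow_const _).aestronglyMeasurable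
    · rw [norm_mul, norm_exp_two_pi, one_mul, norm_mul, ← mul_assoc]
      exact mul_le_mul_of_nonneg_right (hpoint ξ) (norm_nonneg _)
  have heq : (((h ^ γ)⁻¹ * D - iteratedDeriv m (fracIntegral σ w) x : ℝ) : ℂ) =
      ∫ ξ : ℝ, Complex.exp (2 * Real.pi * ξ * x * Complex.I) *
      ((((h ^ γ)⁻¹ : ℝ) * Φ (2 * Real.pi * h * ξ) - abscissa 0 ξ ^ (γ : ℂ)) * ŵ ξ) := by
    rw [Complex.ofReal_sub, Complex.ofReal_mul, e, e', ← integral_const_mul, eq_comm, eq_sub_iff_add_eq,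
      ← integral_add hi2 hi1]
    congr 1
    ext ξ
    ring
  rw [← Real.norm_eq_abs, ← Complex.norm_real, heq]
  calc _ ≤ ∫ ξ, K * h ^ 4 * (|2 * Real.pi * ξ| ^ (γ + 4) * ‖ŵ ξ‖) := by
        refine norm_integral_le_of_norm_le (hi.const_mul _) (Eventually.of_forall fun ξ => ?_)
        rw [norm_mul, norm_exp_two_pi, one_mul, norm_mul, ← mul_assoc]
        exact mul_le_mul_of_nonneg_right (hpoint ξ) (norm_nonneg _)
    _ ≤ K * h ^ 4 * M := by
        rw [integral_const_mul]
        exact mul_le_mul_of_nonneg_left hM (by positivity)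
    _ = _ := by ring

end

end

noncomputable section

open Filter Topology

/-! ### Consistency of the WSLD matrices -/

theorem leftRL_Ioo {a b : ℝ} (β : ℝ) (w : ℝ → ℝ) (x : ℝ) :
    leftRL (Ioo a b) β w x = leftRL univ β (zeroExt a b w) x := by
  have : leftIntegral (Ioo a b) β w = leftIntegral univ β (zeroExt a b w) := by
    ext x
    have h : ∀ ξ, (x - ξ) ^ (((⌊β⌋₊ + 1 : ℕ) : ℝ) - β - 1) * zeroExt a b w ξ =
        (Ioo a b).indicator (fun ξ => (x - ξ) ^ (((⌊β⌋₊ + 1 : ℕ) : ℝ) - β - 1) * w ξ) ξ :=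
      fun ξ => (indicator_mul_right (Ioo a b) (fun ξ => (x - ξ) ^ (((⌊β⌋₊ + 1 : ℕ) : ℝ) - β - 1)) w).symm
    simp only [leftIntegral, univ_inter, h, setIntegral_indicator measurableSet_Ioo]
    rw [inter_comm]
  rw [leftRL, leftRL, this]

theorem rightRL_Ioo {a b : ℝ} (β : ℝ) (w : ℝ → ℝ) (x : ℝ) :
    rightRL (Ioo a b) β w x = rightRL univ β (zeroExt a b w) x := by
  have : rightIntegral (Ioo a b) β w = rightIntegral univ β (zeroExt a b w) := by
    ext x
    have h : ∀ ξ, (ξ - x) ^ (((⌊β⌋₊ + 1 : ℕ) : ℝ) - β - 1) * zeroExt a b w ξ =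
        (Ioo a b).indicator (fun ξ => (ξ - x) ^ (((⌊β⌋₊ + 1 : ℕ) : ℝ) - β - 1) * w ξ) ξ :=
      fun ξ => (indicator_mul_right (Ioo a b) (fun ξ => (ξ - x) ^ (((⌊β⌋₊ + 1 : ℕ) : ℝ) - β - 1)) w).symm
    simp only [rightIntegral, univ_inter, h, setIntegral_indicator measurableSet_Ioo]
    rw [inter_comm]
  rw [rightRL, rightRL, this]

section

variable {xL xR : ℝ} {N : ℕ} {w : ℝ → ℝ} {c : ℤ → ℝ}

theorem mesh_pos (hx : xL < xR) (hN : 1 ≤ N) : 0 < (xR - xL) / N :=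
  div_pos (sub_pos.mpr hx) (by exact_mod_cast hN)

theorem gridPoint_mem (hx : xL < xR) (i : Fin (N - 1)) : gridPoint xL xR N i ∈ Ioo xL xR := by
  have hi := i.2
  have hN : 1 ≤ N := by omega
  have hh := mesh_pos hx hN
  have hNh : (N : ℝ) * ((xR - xL) / N) = xR - xL := by
    have : (N : ℝ) ≠ 0 := by positivity
    field_simp
  have h1 : ((i : ℕ) : ℝ) + 1 < N := by exact_mod_cast (by omega : (i : ℕ) + 1 < N)
  have h2 : 0 ≤ ((i : ℕ) : ℝ) := by positivity
  rw [gridPoint]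
  constructor
  · have : 0 < (((i : ℕ) : ℝ) + 1) * ((xR - xL) / N) := by positivity
    linarith
  · have := mul_lt_mul_of_pos_right h1 hh
    linarith

/-- The grid prolonged to the whole line meets the open interval exactly in the interior mesh
points, so for functions vanishing outside, the infinite convolution is a matrix row. -/
theorem hasSum_row (hx : xL < xR) (h0 : ∀ x ∉ Ioo xL xR, w x = 0) (i : Fin (N - 1)) :
    HasSum (fun k : ℤ => c k * w (gridPoint xL xR N i - k * ((xR - xL) / N)))
      (∑ j : Fin (N - 1), c ((i : ℤ) - (j : ℤ)) * w (gridPoint xL xR N j)) := by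
  have hi := i.2
  have hN : 1 ≤ N := by omega
  have hh := mesh_pos hx hN
  have hNh : (N : ℝ) * ((xR - xL) / N) = xR - xL := by
    have : (N : ℝ) ≠ 0 := by positivity
    field_simp
  have hinj : Function.Injective fun j : Fin (N - 1) => (i : ℤ) - (j : ℤ) := by
    intro j j' hj
    simp only at hj
    ext
    omega
  have hoff : ∀ k ∉ range (fun j : Fin (N - 1) => (i : ℤ) - (j : ℤ)),
      c k * w (gridPoint xL xR N i - k * ((xR - xL) / N)) = 0 := by
    intro k hk
    rw [h0, mul_zero]
    rintro ⟨hl, hr⟩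
    rw [gridPoint] at hl hr
    have h1 : (0 : ℝ) < (i : ℕ) + 1 - k := by
      by_contra hcon
      have := mul_nonneg (sub_nonneg.mpr (not_lt.mp hcon)) hh.le
      nlinarith
    have h2 : ((i : ℕ) : ℝ) + 1 - k < N := by
      by_contra hcon
      have := mul_nonneg (sub_nonneg.mpr (not_lt.mp hcon)) hh.le
      nlinarith
    have h1' : (0 : ℤ) < (i : ℕ) + 1 - k := by exact_mod_cast h1
    have h2' : ((i : ℕ) : ℤ) + 1 - k < N := by exact_mod_cast h2
    refine hk ⟨⟨((i : ℤ) - k).toNat, by omega⟩, ?_⟩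
    simp only
    omega
  refine (hinj.hasSum_iff hoff).mp ?_
  have : (fun k : ℤ => c k * w (gridPoint xL xR N i - k * ((xR - xL) / N))) ∘
      (fun j : Fin (N - 1) => (i : ℤ) - (j : ℤ)) =
      fun j : Fin (N - 1) => c ((i : ℤ) - (j : ℤ)) * w (gridPoint xL xR N j) := by
    ext j
    simp only [Function.comp_def, gridPoint]
    congr 2
    push_cast
    ring
  rw [this]
  exact hasSum_fintype _

theorem hasSum_column (hx : xL < xR) (h0 : ∀ x ∉ Ioo xL xR, w x = 0) (i : Fin (N - 1)) :
    HasSum (fun k : ℤ => c k * w (-(-gridPoint xL xR N i - k * ((xR - xL) / N))))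
      (∑ j : Fin (N - 1), c ((j : ℤ) - (i : ℤ)) * w (gridPoint xL xR N j)) := by
  have h := hasSum_row (c := fun k => c (-k)) hx h0 i
  have h' := (Equiv.neg ℤ).hasSum_iff.mpr h
  simp only [Function.comp_def, Equiv.neg_apply, neg_neg, neg_sub] at h'
  convert h' using 5
  push_cast
  ring

end

section

variable {α : ℝ} {σ : Shifts}

theorem two_sub_of_floor (hα₁ : 1 < α) (hα₂ : α < 2) :
    ((⌊α⌋₊ + 1 : ℕ) : ℝ) - α = 2 - α ∧ ((⌊α + 4⌋₊ + 1 : ℕ) : ℝ) - (α + 4) = 2 - α := by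
  obtain ⟨h1, h2⟩ := floor_add_one_sub hα₁ hα₂
  rw [h1, h2]
  constructor <;> push_cast <;> ring

/-- The WSLD matrices approximate the one-sided Riemann-Liouville derivatives. -/
theorem Shifts.Effective.consistency (hα₁ : 1 < α) (hα₂ : α < 2) (hσ : σ.Effective)
    (hσα : σ.Nondegenerate α) :
    ∃ K : ℝ, 0 ≤ K ∧ ∀ (xL xR M : ℝ) (w : ℝ → ℝ) (N : ℕ) (i : Fin (N - 1)), xL < xR →
      (FracRegular α M (zeroExt xL xR w) →
        |(((xR - xL) / N) ^ α)⁻¹ * (σ.matrix α N *ᵥ fun j => w (gridPoint xL xR N j)) i| ≤ K * M ∧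
        |(((xR - xL) / N) ^ α)⁻¹ * ((σ.matrix α N)ᵀ *ᵥ fun j => w (gridPoint xL xR N j)) i| ≤ K * M) ∧
      (FracRegular (α + 4) M (zeroExt xL xR w) →
        |(((xR - xL) / N) ^ α)⁻¹ * (σ.matrix α N *ᵥ fun j => w (gridPoint xL xR N j)) i -
          leftRL (Ioo xL xR) α w (gridPoint xL xR N i)| ≤ K * M * ((xR - xL) / N) ^ 4 ∧
        |(((xR - xL) / N) ^ α)⁻¹ * ((σ.matrix α N)ᵀ *ᵥ fun j => w (gridPoint xL xR N j)) i -
          rightRL (Ioo xL xR) α w (gridPoint xL xR N i)| ≤ K * M * ((xR - xL) / N) ^ 4) := by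
  obtain ⟨K, hK, hb⟩ := hσ.exists_symbol_bound hα₁ hα₂ hσα
  refine ⟨K, hK, fun xL xR M w N i hx => ?_⟩
  have hN : 1 ≤ N := by have := i.2; omega
  have hh := mesh_pos hx hN
  have hc := σ.summable_coeff hα₁ hα₂
  have hΦ := σ.hasSum_symbol hα₁ hα₂
  obtain ⟨f1, f2⟩ := two_sub_of_floor hα₁ hα₂
  obtain ⟨g1, g2⟩ := floor_add_one_sub hα₁ hα₂
  have hσ0 : 0 < 2 - α := by linarith
  have h0 : ∀ x ∉ Ioo xL xR, zeroExt xL xR w x = 0 := fun x hx => indicator_of_notMem hx _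
  have hL0 : ∀ x < xL, zeroExt xL xR w x = 0 := fun x hx => h0 x fun h => by linarith [h.1]
  have hR0 : ∀ x, xR < x → zeroExt xL xR w x = 0 := fun x hx => h0 x fun h => by linarith [h.2]
  have hgrid : ∀ j : Fin (N - 1), w (gridPoint xL xR N j) = zeroExt xL xR w (gridPoint xL xR N j) :=
    fun j => (indicator_of_mem (gridPoint_mem hx j) _).symm
  have eL : (σ.matrix α N *ᵥ fun j => w (gridPoint xL xR N j)) i =
      ∑ j : Fin (N - 1), σ.coeff α ((i : ℤ) - (j : ℤ)) * zeroExt xL xR w (gridPoint xL xR N j) := by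
    simp only [Matrix.mulVec, dotProduct, Shifts.matrix_apply, hgrid]
  have eR : ((σ.matrix α N)ᵀ *ᵥ fun j => w (gridPoint xL xR N j)) i =
      ∑ j : Fin (N - 1), σ.coeff α ((j : ℤ) - (i : ℤ)) * zeroExt xL xR w (gridPoint xL xR N j) := by
    simp only [Matrix.mulVec, dotProduct, Matrix.transpose_apply, Shifts.matrix_apply, hgrid]
  have sL := hasSum_row (c := σ.coeff α) hx h0 i
  have sR := hasSum_column (c := σ.coeff α) hx h0 i
  rw [← eL] at sL
  rw [← eR] at sR
  have hhα : 0 < ((xR - xL) / N) ^ α := by positivity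
  have hb1 : ∀ {D}, |D| ≤ K * M * ((xR - xL) / N) ^ α → |(((xR - xL) / N) ^ α)⁻¹ * D| ≤ K * M := by
    intro D hD
    rw [abs_mul, abs_of_pos (inv_pos.mpr hhα), inv_mul_le_iff₀ hhα]
    linarith
  have hm : iteratedDeriv 2 (fracIntegral (2 - α) (zeroExt xL xR w)) (gridPoint xL xR N i) =
      leftRL (Ioo xL xR) α w (gridPoint xL xR N i) := by
    rw [leftRL_Ioo, leftRL, leftIntegral_univ, f1, g1]
  have hm' : iteratedDeriv 2 (fracIntegral (2 - α) fun x => zeroExt xL xR w (-x))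
      (-gridPoint xL xR N i) = rightRL (Ioo xL xR) α w (gridPoint xL xR N i) := by
    rw [rightRL_Ioo, rightRL_univ, leftRL, leftIntegral_univ, f1, g1]
  refine ⟨fun hw => ⟨hb1 ?_, hb1 ?_⟩, fun hw => ⟨?_, ?_⟩⟩
  · have hl := hw.left hL0
    rw [f1, g1] at hl
    exact abs_le_of_hasSum hK hh hc hΦ (fun θ => (hb θ).1) hσ0 (by push_cast; ring) hl sL
  · have hl := hw.comp_neg hR0
    rw [f1, g1] at hl
    exact abs_le_of_hasSum hK hh hc hΦ (fun θ => (hb θ).1) hσ0 (by push_cast; ring) hl sR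
  · have hl := hw.left hL0
    rw [f2, g2] at hl
    rw [← hm]
    exact abs_sub_le_of_hasSum (m := 2) hK hh hc hΦ (fun θ => (hb θ).2) hσ0
      (by push_cast; linarith) (by push_cast; ring) hl sL
  · have hl := hw.comp_neg hR0
    rw [f2, g2] at hl
    rw [← hm']
    exact abs_sub_le_of_hasSum (m := 2) hK hh hc hΦ (fun θ => (hb θ).2) hσ0
      (by push_cast; linarith) (by push_cast; ring) hl sR

end

end

noncomputable section

/-! ### Midpoint expansions in time -/

/-- As a function of the half-step s, the difference has derivative at most 2Ms by the mean value
inequality. Differentiability is needed only in the open interval, which suits the end points of [0,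
T]. -/
theorem abs_second_difference_le {G G' G'' : ℝ → ℝ} {t δ M : ℝ} (hδ : 0 ≤ δ)
    (hc : ContinuousOn G (Icc (t - δ) (t + δ)))
    (h1 : ∀ x ∈ Ioo (t - δ) (t + δ), HasDerivAt G (G' x) x)
    (h2 : ∀ x ∈ Ioo (t - δ) (t + δ), HasDerivAt G' (G'' x) x)
    (hM : ∀ x ∈ Ioo (t - δ) (t + δ), |G'' x| ≤ M) :
    |G (t + δ) + G (t - δ) - 2 * G t| ≤ M * δ ^ 2 := by
  have hmem : ∀ s ∈ Ico 0 δ, t + s ∈ Ioo (t - δ) (t + δ) ∧ t - s ∈ Ioo (t - δ) (t + δ) :=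
    fun s hs => ⟨⟨by linarith [hs.1, hs.2], by linarith [hs.1, hs.2]⟩,
      ⟨by linarith [hs.1, hs.2], by linarith [hs.1, hs.2]⟩⟩
  have hcont : ContinuousOn (fun s => G (t + s) + G (t - s) - 2 * G t) (Icc 0 δ) := by
    refine ((hc.comp (by fun_prop) fun s hs => ?_).add (hc.comp (by fun_prop) fun s hs => ?_)).sub
      continuousOn_const <;> constructor <;> linarith [hs.1, hs.2]
  have h := image_norm_le_of_norm_deriv_right_le_deriv_boundary' (a := 0) (b := δ)
    (f' := fun s => G' (t + s) - G' (t - s)) (B := fun s => M * s ^ 2) (B' := fun s => M * (2 * s))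
    hcont (fun s hs => ?_) ?_ (by fun_prop) (fun s _ => ?_) (fun s hs => ?_) ⟨hδ, le_rfl⟩
  · simpa [Real.norm_eq_abs] using h
  · have d1 := (h1 _ (hmem s hs).1).comp_const_add t s
    have d2 := (h1 _ (hmem s hs).2).comp_const_sub t s
    refine HasDerivAt.hasDerivWithinAt ?_
    exact ((d1.add d2).sub_const (2 * G t)).congr_deriv (by ring)
  · have : G (t + 0) + G (t - 0) - 2 * G t = 0 := by rw [add_zero, sub_zero]; ring
    simp only [this]; simp
  · have := ((hasDerivAt_pow 2 s).const_mul M).hasDerivWithinAt (s := Ici s)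
    simpa using this
  · have h := Convex.norm_image_sub_le_of_norm_hasDerivWithin_le
      (fun x hx => (h2 x hx).hasDerivWithinAt) hM (convex_Ioo (t - δ) (t + δ)) (hmem s hs).2 (hmem s hs).1
    refine h.trans_eq ?_
    rw [show t + s - (t - s) = 2 * s by ring, Real.norm_of_nonneg (by linarith [hs.1])]

/-- The derivative in the half-step is the second difference of G', so the previous bound integrates
to Ms³/3. -/
theorem abs_central_difference_le {G G' G'' G''' : ℝ → ℝ} {t δ M : ℝ} (hδ : 0 ≤ δ)
    (hc : ContinuousOn G (Icc (t - δ) (t + δ)))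
    (h1 : ∀ x ∈ Ioo (t - δ) (t + δ), HasDerivAt G (G' x) x)
    (h2 : ∀ x ∈ Ioo (t - δ) (t + δ), HasDerivAt G' (G'' x) x)
    (h3 : ∀ x ∈ Ioo (t - δ) (t + δ), HasDerivAt G'' (G''' x) x)
    (hM : ∀ x ∈ Ioo (t - δ) (t + δ), |G''' x| ≤ M) :
    |G (t + δ) - G (t - δ) - 2 * δ * G' t| ≤ M * δ ^ 3 / 3 := by
  have hmem : ∀ s ∈ Ico 0 δ, t + s ∈ Ioo (t - δ) (t + δ) ∧ t - s ∈ Ioo (t - δ) (t + δ) :=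
    fun s hs => ⟨⟨by linarith [hs.1, hs.2], by linarith [hs.1, hs.2]⟩,
      ⟨by linarith [hs.1, hs.2], by linarith [hs.1, hs.2]⟩⟩
  have hcont : ContinuousOn (fun s => G (t + s) - G (t - s) - 2 * s * G' t) (Icc 0 δ) := by
    refine ((hc.comp (by fun_prop) fun s hs => ?_).sub (hc.comp (by fun_prop) fun s hs => ?_)).sub
      (by fun_prop) <;> constructor <;> linarith [hs.1, hs.2]
  have h := image_norm_le_of_norm_deriv_right_le_deriv_boundary' (a := 0) (b := δ)
    (f' := fun s => G' (t + s) + G' (t - s) - 2 * G' t) (B := fun s => M * s ^ 3 / 3)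
    (B' := fun s => M * s ^ 2)
    hcont (fun s hs => ?_) ?_ (by fun_prop) (fun s _ => ?_) (fun s hs => ?_) ⟨hδ, le_rfl⟩
  · simpa [Real.norm_eq_abs] using h
  · have d1 := (h1 _ (hmem s hs).1).comp_const_add t s
    have d2 := (h1 _ (hmem s hs).2).comp_const_sub t s
    refine HasDerivAt.hasDerivWithinAt ?_
    exact ((d1.sub d2).sub (((hasDerivAt_id s).const_mul 2).mul_const (G' t))).congr_deriv (by ring)
  · simp
  · have := (((hasDerivAt_pow 3 s).const_mul M).div_const 3).hasDerivWithinAt (s := Ici s)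
    refine this.congr_deriv ?_
    norm_num
    ring
  · have hsub : Icc (t - s) (t + s) ⊆ Ioo (t - δ) (t + δ) := fun x hx =>
      ⟨by linarith [hx.1, hs.2], by linarith [hx.2, hs.2]⟩
    have hsub' := Ioo_subset_Icc_self.trans hsub
    exact abs_second_difference_le hs.1
      (fun x hx => (h2 x (hsub hx)).continuousAt.continuousWithinAt)
      (fun x hx => h2 x (hsub' hx)) (fun x hx => h3 x (hsub' hx)) (fun x hx => hM x (hsub' hx))

theorem hasDerivAt_iteratedDerivWithin {g : ℝ → ℝ} {T : ℝ} (hT : 0 < T)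
    (hg : ContDiffOn ℝ 3 g (Icc 0 T)) {k : ℕ} (hk : k < 3) {t : ℝ} (ht : t ∈ Ioo 0 T) :
    HasDerivAt (iteratedDerivWithin k g (Icc 0 T)) (iteratedDerivWithin (k + 1) g (Icc 0 T) t) t := by
  have h := hg.differentiableOn_iteratedDerivWithin (m := k) (by exact_mod_cast hk)
    (uniqueDiffOn_Icc hT) t (Ioo_subset_Icc_self ht)
  rw [iteratedDerivWithin_succ]
  exact h.hasDerivWithinAt.hasDerivAt (Icc_mem_nhds ht.1 ht.2)

/-! ### Stability of the Crank-Nicolson scheme -/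

section

variable {N : ℕ} {B : Matrix (Fin N) (Fin N) ℝ} {d : Fin N → ℝ}

theorem weighted_sum_mul_le {x y : Fin N → ℝ} (hd : ∀ i, 0 ≤ d i) :
    ∑ i, d i * x i * y i ≤ Real.sqrt (∑ i, d i * x i ^ 2) * Real.sqrt (∑ i, d i * y i ^ 2) := by
  have h := Real.sum_mul_le_sqrt_mul_sqrt Finset.univ (fun i => Real.sqrt (d i) * x i)
    (fun i => Real.sqrt (d i) * y i)
  have e : ∀ i, Real.sqrt (d i) * x i * (Real.sqrt (d i) * y i) = d i * x i * y i := fun i => by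
    have := Real.mul_self_sqrt (hd i); linear_combination x i * y i * this
  simpa only [e, mul_pow, Real.sq_sqrt (hd _)] using h

/-- Write e = d z. Pairing the increment of z with v, the mean of two consecutive errors, gives the
increment of E² = ∑ d z², because d (z' + z) = 2v. The term vᵀBv ≤ 0 drops out, and Cauchy-Schwarz
with weight d lets E grow at most linearly. Finally ∑ e² ≤ D E². -/
theorem energy_le {e G : ℕ → Fin N → ℝ} {τ g D : ℝ} {n : ℕ} (hB : ∀ v, v ⬝ᵥ (B *ᵥ v) ≤ 0)
    (hd : ∀ i, 0 ≤ d i) (hD : ∀ i, d i ≤ D) (hτ : 0 ≤ τ) (he0 : e 0 = 0)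
    (hG : ∀ m < n, ∀ i, |G m i| ≤ g)
    (he : ∀ m < n, ∀ i, e (m + 1) i - e m i =
      τ * (d i * ((B *ᵥ ((1 / 2 : ℝ) • (e (m + 1) + e m))) i + G m i))) :
    ∑ i, e n i ^ 2 ≤ N * (n * τ * D * g) ^ 2 := by
  -- Defined by summation because d may vanish and e/d would then be meaningless.
  set z : ℕ → Fin N → ℝ := fun n i =>
    ∑ m ∈ Finset.range n, τ * ((B *ᵥ ((1 / 2 : ℝ) • (e (m + 1) + e m))) i + G m i) with hz
  have hez : ∀ k ≤ n, ∀ i, e k i = d i * z k i := by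
    intro k
    induction k with
    | zero => intro _ i; simp [hz, he0]
    | succ k ih =>
      intro hk i
      have h1 := he k (by omega) i
      rw [ih (by omega)] at h1
      simp only [hz] at h1 ⊢
      rw [Finset.sum_range_succ]
      linear_combination h1
  set E : ℕ → ℝ := fun k => Real.sqrt (∑ i, d i * z k i ^ 2) with hE
  have hD0 : ∀ i : Fin N, 0 ≤ D := fun i => (hd i).trans (hD i)
  have hEsq : ∀ k, E k ^ 2 = ∑ i, d i * z k i ^ 2 := fun k =>
    Real.sq_sqrt (Finset.sum_nonneg fun i _ => mul_nonneg (hd i) (sq_nonneg _))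
  have hstep : ∀ k < n, E (k + 1) ≤ E k + τ * Real.sqrt (N * (D * g ^ 2)) := by
    intro k hk
    have hzk : ∀ i, z (k + 1) i - z k i =
        τ * ((B *ᵥ ((1 / 2 : ℝ) • (e (k + 1) + e k))) i + G k i) := fun i => by
      simp only [hz]; rw [Finset.sum_range_succ]; ring
    set v := (1 / 2 : ℝ) • (e (k + 1) + e k) with hv
    have hvi : ∀ i, 2 * v i = d i * (z (k + 1) i + z k i) := fun i => by
      simp only [hv, Pi.smul_apply, Pi.add_apply, smul_eq_mul]
      rw [hez _ hk, hez _ hk.le]; ring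
    have h1 : E (k + 1) ^ 2 - E k ^ 2 = 2 * τ * (v ⬝ᵥ (B *ᵥ v)) +
        τ * (∑ i, d i * z (k + 1) i * G k i + ∑ i, d i * z k i * G k i) := by
      rw [hEsq, hEsq, ← Finset.sum_sub_distrib, ← Finset.sum_add_distrib, dotProduct, Finset.mul_sum,
        Finset.mul_sum, ← Finset.sum_add_distrib]
      refine Finset.sum_congr rfl fun i _ => ?_
      have e1 := hzk i
      have e2 := hvi i
      linear_combination d i * (z (k + 1) i + z k i) * e1 - τ * (B *ᵥ v) i * e2
    have h2 := hB v
    have hΓ : Real.sqrt (∑ i, d i * G k i ^ 2) ≤ Real.sqrt (N * (D * g ^ 2)) := by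
      refine Real.sqrt_le_sqrt ?_
      have : ∀ i ∈ Finset.univ, d i * G k i ^ 2 ≤ D * g ^ 2 := fun i _ => by
        have h3 : G k i ^ 2 ≤ g ^ 2 := sq_le_sq' (by linarith [(abs_le.mp (hG k hk i)).1])
          (abs_le.mp (hG k hk i)).2
        exact mul_le_mul (hD i) h3 (sq_nonneg _) (hD0 i)
      simpa using Finset.sum_le_card_nsmul _ _ _ this
    set Γ := Real.sqrt (N * (D * g ^ 2))
    have hE0 : ∀ k, 0 ≤ E k := fun k => Real.sqrt_nonneg _
    have h3 : ∀ j, ∑ i, d i * z j i * G k i ≤ E j * Γ := fun j =>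
      (weighted_sum_mul_le hd).trans (mul_le_mul_of_nonneg_left hΓ (hE0 j))
    have h4 : (E (k + 1) - E k) * (E (k + 1) + E k) ≤ τ * Γ * (E (k + 1) + E k) := by
      have := mul_le_mul_of_nonneg_left (add_le_add (h3 (k + 1)) (h3 k)) hτ
      have := mul_nonneg hτ (neg_nonneg.mpr h2)
      nlinarith
    rcases (add_nonneg (hE0 (k + 1)) (hE0 k)).eq_or_lt with h5 | h5
    · have := hE0 k
      have : 0 ≤ τ * Γ := mul_nonneg hτ (Real.sqrt_nonneg _)
      linarith
    · have := le_of_mul_le_mul_right h4 h5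
      linarith
  have hEn : ∀ k ≤ n, E k ≤ k * (τ * Real.sqrt (N * (D * g ^ 2))) := by
    intro k
    induction k with
    | zero => intro _; simp [hE, hz]
    | succ k ih =>
      intro hk
      have := hstep k (by omega)
      have := ih (by omega)
      push_cast
      linarith
  rcases Nat.eq_zero_or_pos N with rfl | hN
  · simp
  have hD0' : 0 ≤ D := hD0 ⟨0, hN⟩
  calc ∑ i, e n i ^ 2 ≤ ∑ i, D * (d i * z n i ^ 2) := by
        refine Finset.sum_le_sum fun i _ => ?_
        rw [hez n le_rfl, mul_pow, sq (d i), mul_assoc]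
        exact mul_le_mul_of_nonneg_right (hD i) (mul_nonneg (hd i) (sq_nonneg _))
    _ = D * E n ^ 2 := by rw [hEsq, Finset.mul_sum]
    _ ≤ D * (n * (τ * Real.sqrt (N * (D * g ^ 2)))) ^ 2 := by
        gcongr
        exact hEn n le_rfl
    _ = _ := by
        rw [mul_pow, mul_pow, Real.sq_sqrt (by positivity)]
        ring

/-- The term ρ has no factor d and cannot be put into G. Subtracting its accumulated sum s restores
the form of `energy_le`, at the price of adding B applied to the mean of s to G. -/
theorem error_le {e G ρ : ℕ → Fin N → ℝ} {τ g r r' D : ℝ} {n : ℕ} (hB : ∀ v, v ⬝ᵥ (B *ᵥ v) ≤ 0)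
    (hd : ∀ i, 0 ≤ d i) (hD : ∀ i, d i ≤ D) (hτ : 0 ≤ τ) (he0 : e 0 = 0) (hr' : 0 ≤ r')
    (hG : ∀ m < n, ∀ i, |G m i| ≤ g) (hρ : ∀ m < n, ∀ i, |ρ m i| ≤ r)
    (hBρ : ∀ m < n, ∀ i, |(B *ᵥ ρ m) i| ≤ r')
    (he : ∀ m < n, ∀ i, e (m + 1) i - e m i =
      τ * (d i * ((B *ᵥ ((1 / 2 : ℝ) • (e (m + 1) + e m))) i + G m i)) + ρ m i) :
    ∑ i, e n i ^ 2 ≤ 2 * (N * (n * τ * D * (g + n * r')) ^ 2) + 2 * (N * (n * r) ^ 2) := by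
  set s : ℕ → Fin N → ℝ := fun k => ∑ m ∈ Finset.range k, ρ m with hs
  have hsucc : ∀ k, s (k + 1) = s k + ρ k := fun k => by simp only [hs]; rw [Finset.sum_range_succ]
  have hsi : ∀ k ≤ n, ∀ i, |s k i| ≤ k * r := by
    intro k hk i
    simp only [hs, Finset.sum_apply]
    refine (Finset.abs_sum_le_sum_abs _ _).trans ?_
    have := Finset.sum_le_card_nsmul (Finset.range k) (fun m => |ρ m i|) r
      fun m hm => hρ m (by have := Finset.mem_range.mp hm; omega) i
    simpa using this
  have hBs : ∀ k ≤ n, ∀ i, |(B *ᵥ s k) i| ≤ n * r' := by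
    intro k hk i
    have h1 : (B *ᵥ s k) i = ∑ m ∈ Finset.range k, (B *ᵥ ρ m) i := by
      simp only [hs]
      rw [← Matrix.mulVecLin_apply, map_sum, Finset.sum_apply]
      rfl
    rw [h1]
    refine (Finset.abs_sum_le_sum_abs _ _).trans ?_
    have := Finset.sum_le_card_nsmul (Finset.range k) (fun m => |(B *ᵥ ρ m) i|) r'
      fun m hm => hBρ m (by have := Finset.mem_range.mp hm; omega) i
    refine this.trans ?_
    simp only [Finset.card_range, nsmul_eq_mul]
    gcongr
  have hen := energy_le (e := fun k => e k - s k)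
    (G := fun m i => G m i + (B *ᵥ ((1 / 2 : ℝ) • (s (m + 1) + s m))) i) (g := g + n * r') hB hd hD hτ
    (by simp [he0, hs]) (n := n) (fun m hm i => ?_) (fun m hm i => ?_)
  · calc ∑ i, e n i ^ 2 ≤ ∑ i, (2 * (e n - s n) i ^ 2 + 2 * (n * r) ^ 2) := by
          refine Finset.sum_le_sum fun i _ => ?_
          have h1 : s n i ^ 2 ≤ (n * r) ^ 2 := sq_le_sq' (by linarith [(abs_le.mp (hsi n le_rfl i)).1])
            (abs_le.mp (hsi n le_rfl i)).2
          rw [Pi.sub_apply]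
          nlinarith [sq_nonneg (e n i - 2 * s n i)]
      _ = 2 * ∑ i, (e n - s n) i ^ 2 + 2 * (N * (n * r) ^ 2) := by
          rw [Finset.sum_add_distrib, ← Finset.mul_sum]
          simp
          ring
      _ ≤ _ := by gcongr
  · refine (abs_add_le _ _).trans (add_le_add (hG m hm i) ?_)
    rw [Matrix.mulVec_smul, Matrix.mulVec_add, Pi.smul_apply, Pi.add_apply, smul_eq_mul, abs_mul]
    have h1 := hBs (m + 1) hm i
    have h2 := hBs m hm.le i
    have h3 := abs_add_le ((B *ᵥ s (m + 1)) i) ((B *ᵥ s m) i)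
    rw [abs_of_pos (by norm_num : (0 : ℝ) < 1 / 2)]
    linarith
  · have h1 := he m hm i
    simp only [hsucc, Matrix.mulVec_smul, Matrix.mulVec_add, Matrix.mulVec_sub, Pi.smul_apply, Pi.add_apply,
      Pi.sub_apply, smul_eq_mul] at h1 ⊢
    linear_combination h1

/-- The form vᵀBv equals c ∑ d (Bv)², hence is both nonpositive and nonnegative; so every c d (Bv)²,
and with it v, vanishes. -/
theorem eq_zero_of_eq_mul {c : ℝ} {v : Fin N → ℝ} (hB : ∀ v, v ⬝ᵥ (B *ᵥ v) ≤ 0) (hd : ∀ i, 0 ≤ d i)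
    (hc : 0 ≤ c) (hv : ∀ i, v i = c * (d i * (B *ᵥ v) i)) : v = 0 := by
  have h1 : ∑ i, c * (d i * (B *ᵥ v) i ^ 2) ≤ 0 := by
    refine le_trans (le_of_eq ?_) (hB v)
    rw [dotProduct]
    refine Finset.sum_congr rfl fun i _ => ?_
    conv_rhs => rw [hv i]
    ring
  have h2 : ∀ i ∈ Finset.univ, 0 ≤ c * (d i * (B *ᵥ v) i ^ 2) := fun i _ =>
    mul_nonneg hc (mul_nonneg (hd i) (sq_nonneg _))
  have h3 := (Finset.sum_eq_zero_iff_of_nonneg h2).mp (le_antisymm h1 (Finset.sum_nonneg h2))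
  ext i
  have h4 := h3 i (Finset.mem_univ i)
  rw [hv i, Pi.zero_apply]
  rcases mul_eq_zero.mp h4 with h | h
  · rw [h, zero_mul]
  · rcases mul_eq_zero.mp h with h | h
    · rw [h, zero_mul, mul_zero]
    · rw [pow_eq_zero_iff two_ne_zero] at h
      rw [h, mul_zero, mul_zero]

end

/-- A linear one-step recursion with invertible leading matrix has exactly one solution. -/
theorem existsUnique_recursion {N Nt : ℕ} {P Q : Matrix (Fin N) (Fin N) ℝ} (hP : IsUnit P)
    (F : Fin Nt → Fin N → ℝ) (v : Fin N → ℝ) :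
    ∃! U : Fin (Nt + 1) → Fin N → ℝ, U 0 = v ∧
      ∀ n : Fin Nt, P *ᵥ U n.succ = Q *ᵥ U n.castSucc + F n := by
  have hdet : IsUnit P.det := (Matrix.isUnit_iff_isUnit_det P).mp hP
  refine ⟨fun n => Fin.induction v (fun n U => P⁻¹ *ᵥ (Q *ᵥ U + F n)) n, ⟨rfl, fun n => ?_⟩, ?_⟩
  · simp only [Fin.induction_succ]
    rw [Matrix.mulVec_mulVec, Matrix.mul_nonsing_inv P hdet, Matrix.one_mulVec]
  · rintro U ⟨h0, hU⟩
    ext1 n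
    induction n using Fin.induction with
    | zero => exact h0
    | succ n ih =>
      rw [Fin.induction_succ, ← ih, ← hU n, Matrix.mulVec_mulVec, Matrix.nonsing_inv_mul P hdet,
        Matrix.one_mulVec]

end

noncomputable section

/-! ### The spatial matrix -/

/-- The matrix `h^{-α} (A_α + κ A_αᵀ)`. -/
def kernelMatrix (α : ℝ) (σ : Shifts) (xL xR κ : ℝ) (N : ℕ) : Matrix (Fin (N - 1)) (Fin (N - 1)) ℝ :=
  (((xR - xL) / N) ^ α)⁻¹ • (σ.matrix α N + κ • (σ.matrix α N)ᵀ)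

theorem kernelMatrix_mulVec (α : ℝ) (σ : Shifts) (xL xR κ : ℝ) {N : ℕ} (v : Fin (N - 1) → ℝ)
    (i : Fin (N - 1)) :
    (kernelMatrix α σ xL xR κ N *ᵥ v) i =
      (((xR - xL) / N) ^ α)⁻¹ * (σ.matrix α N *ᵥ v) i +
        κ * ((((xR - xL) / N) ^ α)⁻¹ * ((σ.matrix α N)ᵀ *ᵥ v) i) := by
  simp only [kernelMatrix, Matrix.smul_mulVec, Matrix.add_mulVec, Pi.smul_apply, Pi.add_apply, smul_eq_mul]
  ring

theorem spatialMatrix_mulVec {α : ℝ} {σ : Shifts} {xL xR κ : ℝ} {dp dm : ℝ → ℝ} {N : ℕ}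
    (hdm : ∀ i : Fin (N - 1), dm (gridPoint xL xR N i) = κ * dp (gridPoint xL xR N i))
    (v : Fin (N - 1) → ℝ) (i : Fin (N - 1)) :
    (spatialMatrix α σ xL xR dp dm N *ᵥ v) i =
      dp (gridPoint xL xR N i) * (kernelMatrix α σ xL xR κ N *ᵥ v) i := by
  rw [kernelMatrix_mulVec]
  simp only [spatialMatrix, Matrix.smul_mulVec, Matrix.add_mulVec, Pi.smul_apply, Pi.add_apply, smul_eq_mul,
    ← Matrix.mulVec_mulVec, Matrix.mulVec_diagonal, hdm]
  ring

theorem Shifts.Effective.kernelMatrix_form_nonpos {α : ℝ} {σ : Shifts} {xL xR κ : ℝ} {N : ℕ}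
    (hα₁ : 1 < α) (hα₂ : α < 2) (hσ : σ.Effective) (hσα : σ.Nondegenerate α) (hx : xL < xR)
    (hκ : 0 ≤ κ) (v : Fin (N - 1) → ℝ) : v ⬝ᵥ (kernelMatrix α σ xL xR κ N *ᵥ v) ≤ 0 := by
  have h := hσ.matrix_form_nonpos hα₁ hα₂ hσα v
  have hT : v ⬝ᵥ ((σ.matrix α N)ᵀ *ᵥ v) = v ⬝ᵥ (σ.matrix α N *ᵥ v) := by
    rw [Matrix.mulVec_transpose, dotProduct_comm, Matrix.dotProduct_mulVec]
  have e : v ⬝ᵥ (kernelMatrix α σ xL xR κ N *ᵥ v) =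
      (((xR - xL) / N) ^ α)⁻¹ * (1 + κ) * (v ⬝ᵥ (σ.matrix α N *ᵥ v)) := by
    rw [kernelMatrix, Matrix.smul_mulVec, Matrix.add_mulVec, Matrix.smul_mulVec, dotProduct_smul,
      dotProduct_add, dotProduct_smul, hT, smul_eq_mul, smul_eq_mul]
    ring
  rw [e]
  have : 0 ≤ (xR - xL) / N := div_nonneg (by linarith) (by positivity)
  exact mul_nonpos_of_nonneg_of_nonpos (by positivity) h

theorem Shifts.Effective.isUnit_one_sub {α : ℝ} {σ : Shifts} {xL xR κ τ : ℝ} {dp dm : ℝ → ℝ} {N : ℕ}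
    (hα₁ : 1 < α) (hα₂ : α < 2) (hσ : σ.Effective) (hσα : σ.Nondegenerate α) (hx : xL < xR)
    (hκ : 0 ≤ κ) (hτ : 0 ≤ τ) (hdp : ∀ i : Fin (N - 1), 0 ≤ dp (gridPoint xL xR N i))
    (hdm : ∀ i : Fin (N - 1), dm (gridPoint xL xR N i) = κ * dp (gridPoint xL xR N i)) :
    IsUnit (1 - τ • spatialMatrix α σ xL xR dp dm N) := by
  rw [← Matrix.mulVec_injective_iff_isUnit]
  intro v v' hv
  rw [← sub_eq_zero]
  refine eq_zero_of_eq_mul (hσ.kernelMatrix_form_nonpos hα₁ hα₂ hσα hx hκ) hdp hτ fun i => ?_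
  have h : ((1 - τ • spatialMatrix α σ xL xR dp dm N) *ᵥ (v - v')) i = 0 := by
    rw [Matrix.mulVec_sub, sub_eq_zero.mpr hv, Pi.zero_apply]
  rw [Matrix.sub_mulVec, Matrix.one_mulVec, Matrix.smul_mulVec, Pi.sub_apply, Pi.smul_apply,
    smul_eq_mul, spatialMatrix_mulVec hdm, sub_eq_zero] at h
  exact h

theorem existsUnique_isSchemeSolution {α : ℝ} {σ : Shifts} {xL xR T κ : ℝ} {dp dm : ℝ → ℝ} {Nx Nt : ℕ}
    (hα₁ : 1 < α) (hα₂ : α < 2) (hσ : σ.Effective) (hσα : σ.Nondegenerate α) (hx : xL < xR)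
    (hκ : 0 ≤ κ) (hT : 0 ≤ T) (hdp : ∀ i : Fin (Nx - 1), 0 ≤ dp (gridPoint xL xR Nx i))
    (hdm : ∀ i : Fin (Nx - 1), dm (gridPoint xL xR Nx i) = κ * dp (gridPoint xL xR Nx i))
    (f : ℝ → ℝ → ℝ) (u₀ : ℝ → ℝ) :
    ∃! U : Fin (Nt + 1) → Fin (Nx - 1) → ℝ, IsSchemeSolution α σ xL xR T dp dm f u₀ Nx Nt U := by
  have hτ : 0 ≤ T / Nt / 2 := by positivity
  obtain ⟨U, ⟨h0, hU⟩, huniq⟩ := existsUnique_recursion (Nt := Nt)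
    (Q := 1 + (T / Nt / 2) • spatialMatrix α σ xL xR dp dm Nx)
    (hσ.isUnit_one_sub hα₁ hα₂ hσα hx hκ hτ hdp hdm)
    (fun n => (T / Nt) • fun i => f (gridPoint xL xR Nx i) (((n : ℝ) + 1 / 2) * (T / Nt)))
    (fun i => u₀ (gridPoint xL xR Nx i))
  exact ⟨U, ⟨fun i => congrFun h0 i, hU⟩, fun V hV => huniq V ⟨funext hV.initial, hV.step⟩⟩

/-! ### Convergence -/

theorem FracRegular.abs_le {β M : ℝ} {w : ℝ → ℝ} (h : FracRegular β M w) (x : ℝ) : |w x| ≤ M := by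
  rw [← Real.norm_eq_abs, ← Complex.norm_real,
    eq_integral_fourier h.continuous h.integrable h.integrable_fourier x]
  refine (norm_integral_le_integral_norm _).trans ?_
  simp only [norm_mul, norm_exp_two_pi, one_mul]
  exact h.fourier_le

theorem FracRegular.bound_nonneg {β M : ℝ} {w : ℝ → ℝ} (h : FracRegular β M w) : 0 ≤ M :=
  (integral_nonneg fun _ => norm_nonneg _).trans h.fourier_le

theorem hasDerivAt_mulVec {N : ℕ} (B : Matrix (Fin N) (Fin N) ℝ) {y y' : Fin N → ℝ → ℝ} {t : ℝ}
    (h : ∀ j, HasDerivAt (y j) (y' j t) t) (i : Fin N) :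
    HasDerivAt (fun t => (B *ᵥ fun j => y j t) i) ((B *ᵥ fun j => y' j t) i) t := by
  simp only [Matrix.mulVec, dotProduct]
  exact HasDerivAt.fun_sum fun j _ => (h j).const_mul (B i j)

theorem discreteNorm_le {h L C X : ℝ} {N : ℕ} {v : Fin N → ℝ} (hh : 0 ≤ h) (hL : h * N ≤ L)
    (hX : 0 ≤ X) (hC : 0 ≤ C) (hv : ∑ i, v i ^ 2 ≤ N * (C * X ^ 2)) :
    discreteNorm h v ≤ Real.sqrt (L * C) * X := by
  have hL0 : 0 ≤ L := (mul_nonneg hh (Nat.cast_nonneg N)).trans hL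
  have hsq : Real.sqrt (L * C) * X = Real.sqrt (L * C * X ^ 2) := by
    rw [Real.sqrt_mul (mul_nonneg hL0 hC), Real.sqrt_sq hX]
  rw [discreteNorm, hsq]
  refine Real.sqrt_le_sqrt ?_
  calc h * ∑ i, v i ^ 2 ≤ h * (N * (C * X ^ 2)) := mul_le_mul_of_nonneg_left hv hh
    _ = (h * N) * (C * X ^ 2) := by ring
    _ ≤ L * (C * X ^ 2) := by gcongr
    _ = _ := by ring

/-- Each summation over time steps costs a factor n, absorbed by n τ ≤ T; thus n τ³ ≤ T τ² ≤ T X. -/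
theorem sum_error_le {S N n τ T D Q M X : ℝ} (hN : 0 ≤ N) (hn : 0 ≤ n) (hτ : 0 ≤ τ) (hT : 0 ≤ T)
    (hD0 : 0 ≤ D) (hQ0 : 0 ≤ Q) (hM0 : 0 ≤ M) (hnτ : n * τ ≤ T) (hτX : τ ^ 2 ≤ X)
    (hS : S ≤ 2 * (N * (n * τ * D * (Q * X + n * (Q * τ ^ 3))) ^ 2) + 2 * (N * (n * (M * τ ^ 3)) ^ 2)) :
    S ≤ N * ((2 * (T * D * ((1 + T) * Q)) ^ 2 + 2 * (T * M) ^ 2) * X ^ 2) := by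
  have hX0 : 0 ≤ X := (sq_nonneg τ).trans hτX
  have b1 : n * τ * D * (Q * X + n * (Q * τ ^ 3)) ≤ T * D * ((1 + T) * Q) * X := by
    have : n * (Q * τ ^ 3) ≤ T * Q * X := by
      calc n * (Q * τ ^ 3) = (n * τ) * (Q * τ ^ 2) := by ring
        _ ≤ T * (Q * X) := by gcongr
        _ = _ := by ring
    calc n * τ * D * (Q * X + n * (Q * τ ^ 3)) ≤ T * D * (Q * X + T * Q * X) := by gcongr
      _ = _ := by ring
  have b2 : n * (M * τ ^ 3) ≤ T * M * X := by
    calc n * (M * τ ^ 3) = (n * τ) * (M * τ ^ 2) := by ring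
      _ ≤ T * (M * X) := by gcongr
      _ = _ := by ring
  refine hS.trans ?_
  have p1 : 0 ≤ n * τ * D * (Q * X + n * (Q * τ ^ 3)) := by positivity
  have p2 : 0 ≤ n * (M * τ ^ 3) := by positivity
  calc _ ≤ 2 * (N * (T * D * ((1 + T) * Q) * X) ^ 2) + 2 * (N * (T * M * X) ^ 2) := by gcongr
    _ = _ := by ring

/-- The error estimate for fixed step sizes. -/
theorem IsSchemeSolution.error_estimate {α : ℝ} {σ : Shifts} {xL xR T κ K M D : ℝ}
    {dp dm u₀ : ℝ → ℝ} {f u : ℝ → ℝ → ℝ} {Nx Nt : ℕ} {U : Fin (Nt + 1) → Fin (Nx - 1) → ℝ}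
    (hα₁ : 1 < α) (hα₂ : α < 2) (hσ : σ.Effective) (hσα : σ.Nondegenerate α)
    (hx : xL < xR) (hT : 0 < T) (hκ : 0 ≤ κ) (hK : 0 ≤ K) (hD0 : 0 ≤ D)
    (hd : ∀ i : Fin (Nx - 1), 0 ≤ dp (gridPoint xL xR Nx i))
    (hdD : ∀ i : Fin (Nx - 1), dp (gridPoint xL xR Nx i) ≤ D)
    (hdm' : ∀ i : Fin (Nx - 1), dm (gridPoint xL xR Nx i) = κ * dp (gridPoint xL xR Nx i))
    (hcons : ∀ (M : ℝ) (w : ℝ → ℝ) (i : Fin (Nx - 1)),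
      (FracRegular α M (zeroExt xL xR w) →
        |(((xR - xL) / Nx) ^ α)⁻¹ * (σ.matrix α Nx *ᵥ fun j => w (gridPoint xL xR Nx j)) i| ≤ K * M ∧
        |(((xR - xL) / Nx) ^ α)⁻¹ * ((σ.matrix α Nx)ᵀ *ᵥ fun j => w (gridPoint xL xR Nx j)) i| ≤
          K * M) ∧
      (FracRegular (α + 4) M (zeroExt xL xR w) →
        |(((xR - xL) / Nx) ^ α)⁻¹ * (σ.matrix α Nx *ᵥ fun j => w (gridPoint xL xR Nx j)) i -
          leftRL (Ioo xL xR) α w (gridPoint xL xR Nx i)| ≤ K * M * ((xR - xL) / Nx) ^ 4 ∧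
        |(((xR - xL) / Nx) ^ α)⁻¹ * ((σ.matrix α Nx)ᵀ *ᵥ fun j => w (gridPoint xL xR Nx j)) i -
          rightRL (Ioo xL xR) α w (gridPoint xL xR Nx i)| ≤ K * M * ((xR - xL) / Nx) ^ 4))
    (hu : IsExactSolution α xL xR T dp dm f u₀ u)
    (htime : ∀ x ∈ Ioo xL xR, ContDiffOn ℝ 3 (u x) (Icc 0 T))
    (hM : ∀ t ∈ Icc 0 T,
      FracRegular (α + 4) M (zeroExt xL xR (fun x => u x t)) ∧
      FracRegular α M (zeroExt xL xR (fun x => iteratedDerivWithin 2 (u x) (Icc 0 T) t)) ∧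
      FracRegular α M (zeroExt xL xR (fun x => iteratedDerivWithin 3 (u x) (Icc 0 T) t)))
    (hNx : 1 ≤ Nx) (hNt : 1 ≤ Nt) (hU : IsSchemeSolution α σ xL xR T dp dm f u₀ Nx Nt U)
    (n : Fin (Nt + 1)) :
    discreteNorm ((xR - xL) / Nx) (fun i => u (gridPoint xL xR Nx i) ((n : ℝ) * (T / Nt)) - U n i) ≤
      Real.sqrt ((xR - xL) * (2 * (T * D * ((1 + T) * ((1 + κ) * K * M))) ^ 2 + 2 * (T * M) ^ 2)) *
        ((T / Nt) ^ 2 + ((xR - xL) / Nx) ^ 4) := by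
  have hM0 : 0 ≤ M := (hM 0 ⟨le_rfl, hT.le⟩).1.bound_nonneg
  set Q := (1 + κ) * K * M with hQ
  have hQ0 : 0 ≤ Q := by positivity
  have hgrid : ∀ i : Fin (Nx - 1), gridPoint xL xR Nx i ∈ Ioo xL xR := gridPoint_mem hx
  have hh : 0 < (xR - xL) / Nx := mesh_pos hx hNx
  set h := (xR - xL) / Nx with hh_def
  have hNt0 : (0 : ℝ) < Nt := by exact_mod_cast hNt
  have hτ : 0 < T / Nt := by positivity
  set τ := T / Nt with hτ_def
  have hNτ : Nt * τ = T := by rw [hτ_def]; field_simp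
  set B := kernelMatrix α σ xL xR κ Nx with hB
  set Y : ℕ → Fin (Nx - 1) → ℝ → ℝ := fun k j =>
    iteratedDerivWithin k (u (gridPoint xL xR Nx j)) (Icc 0 T) with hY
  have hY0 : ∀ j t, Y 0 j t = u (gridPoint xL xR Nx j) t := fun j t => by
    simp only [hY, iteratedDerivWithin_zero]
  have hYd : ∀ k < 3, ∀ j, ∀ t ∈ Ioo 0 T, HasDerivAt (Y k j) (Y (k + 1) j t) t :=
    fun k hk j t ht => hasDerivAt_iteratedDerivWithin hT (htime _ (hgrid j)) hk ht
  have hYc : ∀ j, ContinuousOn (Y 0 j) (Icc 0 T) := fun j => by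
    have : Y 0 j = u (gridPoint xL xR Nx j) := funext (hY0 j)
    rw [this]
    exact (htime _ (hgrid j)).continuousOn
  have hBd : ∀ k < 3, ∀ i, ∀ t ∈ Ioo 0 T,
      HasDerivAt (fun t => (B *ᵥ fun j => Y k j t) i) ((B *ᵥ fun j => Y (k + 1) j t) i) t :=
    fun k hk i t ht => hasDerivAt_mulVec B (fun j => hYd k hk j t ht) i
  have hBc : ∀ i, ContinuousOn (fun t => (B *ᵥ fun j => Y 0 j t) i) (Icc 0 T) := fun i => by
    simp only [Matrix.mulVec, dotProduct]
    exact continuousOn_finsetSum _ fun j _ => continuousOn_const.mul (hYc j)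
  have hrow : ∀ {a b E : ℝ}, |a| ≤ E → |b| ≤ E → |a + κ * b| ≤ (1 + κ) * E := fun {a b E} ha hb => by
    refine (abs_add_le _ _).trans ?_
    rw [abs_mul, abs_of_nonneg hκ]
    nlinarith
  have hB2 : ∀ i, ∀ t ∈ Icc 0 T, |(B *ᵥ fun j => Y 2 j t) i| ≤ Q := fun i t ht => by
    have h1 := (hcons M (fun x => iteratedDerivWithin 2 (u x) (Icc 0 T) t) i).1
      (hM t ht).2.1
    rw [hB, kernelMatrix_mulVec]
    exact (hrow h1.1 h1.2).trans_eq (by rw [hQ]; ring)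
  have hB3 : ∀ i, ∀ t ∈ Icc 0 T, |(B *ᵥ fun j => Y 3 j t) i| ≤ Q := fun i t ht => by
    have h1 := (hcons M (fun x => iteratedDerivWithin 3 (u x) (Icc 0 T) t) i).1
      (hM t ht).2.2
    rw [hB, kernelMatrix_mulVec]
    exact (hrow h1.1 h1.2).trans_eq (by rw [hQ]; ring)
  have hY3 : ∀ j, ∀ t ∈ Icc 0 T, |Y 3 j t| ≤ M := fun j t ht => by
    have h1 := (hM t ht).2.2.abs_le (gridPoint xL xR Nx j)
    rwa [zeroExt, indicator_of_mem (hgrid j)] at h1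
  set V : ℝ → Fin (Nx - 1) → ℝ := fun t i =>
    leftRL (Ioo xL xR) α (fun y => u y t) (gridPoint xL xR Nx i) +
      κ * rightRL (Ioo xL xR) α (fun y => u y t) (gridPoint xL xR Nx i) with hV
  have hBV : ∀ i, ∀ t ∈ Icc 0 T, |(B *ᵥ fun j => Y 0 j t) i - V t i| ≤ Q * h ^ 4 := fun i t ht => by
    have h1 := (hcons M (fun x => u x t) i).2 (hM t ht).1
    rw [hB, kernelMatrix_mulVec, hV]
    simp only [hY0]
    refine (le_of_eq ?_).trans ((hrow h1.1 h1.2).trans_eq (by rw [hQ, hh_def]; ring))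
    congr 1
    ring
  set s : ℕ → ℝ := fun m => ((m : ℝ) + 1 / 2) * τ with hs
  have hsm : ∀ m : ℕ, s m - τ / 2 = m * τ := fun m => by simp only [hs]; ring
  have hsp : ∀ m : ℕ, s m + τ / 2 = (m + 1 : ℕ) * τ := fun m => by simp only [hs]; push_cast; ring
  have hnode : ∀ m ≤ Nt, (m : ℝ) * τ ∈ Icc 0 T := fun m hm =>
    ⟨by positivity, by rw [← hNτ]; gcongr⟩
  have hIcc : ∀ m < Nt, Icc (s m - τ / 2) (s m + τ / 2) ⊆ Icc 0 T := fun m hm => by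
    rw [hsm, hsp]
    exact Icc_subset_Icc (hnode m hm.le).1 (hnode (m + 1) hm).2
  have hIoo : ∀ m < Nt, Ioo (s m - τ / 2) (s m + τ / 2) ⊆ Ioo 0 T := fun m hm => by
    rw [hsm, hsp]
    exact Ioo_subset_Ioo (hnode m hm.le).1 (hnode (m + 1) hm).2
  have hsIoo : ∀ m < Nt, s m ∈ Ioo 0 T := fun m hm =>
    hIoo m hm ⟨by linarith, by linarith⟩
  -- The value 0 beyond Nt is never reached; indexing by ℕ is what `error_le` expects.
  set e : ℕ → Fin (Nx - 1) → ℝ := fun m i =>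
    if hm : m < Nt + 1 then Y 0 i (m * τ) - U ⟨m, hm⟩ i else 0 with he
  set ρ : ℕ → Fin (Nx - 1) → ℝ := fun m i =>
    Y 0 i ((m + 1 : ℕ) * τ) - Y 0 i (m * τ) - τ * Y 1 i (s m) with hρ
  -- This joins the spatial consistency error at the midpoint with the error of averaging B u over
  -- the two time levels; both carry the factor d.
  set G : ℕ → Fin (Nx - 1) → ℝ := fun m i => V (s m) i -
    1 / 2 * ((B *ᵥ fun j => Y 0 j ((m + 1 : ℕ) * τ)) i + (B *ᵥ fun j => Y 0 j (m * τ)) i) with hG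
  have hG_le : ∀ m < (n : ℕ), ∀ i, |G m i| ≤ Q * (τ ^ 2 + h ^ 4) := fun m hmn i => by
    have hm : m < Nt := by have := n.2; omega
    have h1 := abs_second_difference_le (by positivity : 0 ≤ τ / 2) ((hBc i).mono (hIcc m hm))
      (fun t ht => hBd 0 (by norm_num) i t (hIoo m hm ht))
      (fun t ht => hBd 1 (by norm_num) i t (hIoo m hm ht))
      (fun t ht => hB2 i t (Ioo_subset_Icc_self (hIoo m hm ht)))
    have h2 := hBV i (s m) (Ioo_subset_Icc_self (hsIoo m hm))
    rw [hsm, hsp] at h1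
    rw [abs_le] at h1 h2 ⊢
    have : 0 ≤ Q * τ ^ 2 := by positivity
    simp only [hG]
    constructor <;> nlinarith [h1.1, h1.2, h2.1, h2.2]
  have hρ_le : ∀ m < (n : ℕ), ∀ i, |ρ m i| ≤ M * τ ^ 3 := fun m hmn i => by
    have hm : m < Nt := by have := n.2; omega
    have h1 := abs_central_difference_le (by positivity : 0 ≤ τ / 2) ((hYc i).mono (hIcc m hm))
      (fun t ht => hYd 0 (by norm_num) i t (hIoo m hm ht))
      (fun t ht => hYd 1 (by norm_num) i t (hIoo m hm ht))
      (fun t ht => hYd 2 (by norm_num) i t (hIoo m hm ht))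
      (fun t ht => hY3 i t (Ioo_subset_Icc_self (hIoo m hm ht)))
    rw [hsm, hsp, show 2 * (τ / 2) = τ by ring] at h1
    refine h1.trans ?_
    have : 0 ≤ M * τ ^ 3 := by positivity
    linarith
  -- B commutes with differences in time, so B ρ is the central difference error of t ↦ B u. The
  -- consistency bound for ∂_t³u keeps it free of the factor h^{-α} in B.
  have hBρ_le : ∀ m < (n : ℕ), ∀ i, |(B *ᵥ ρ m) i| ≤ Q * τ ^ 3 := fun m hmn i => by
    have hm : m < Nt := by have := n.2; omega
    have h1 := abs_central_difference_le (by positivity : 0 ≤ τ / 2) ((hBc i).mono (hIcc m hm))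
      (fun t ht => hBd 0 (by norm_num) i t (hIoo m hm ht))
      (fun t ht => hBd 1 (by norm_num) i t (hIoo m hm ht))
      (fun t ht => hBd 2 (by norm_num) i t (hIoo m hm ht))
      (fun t ht => hB3 i t (Ioo_subset_Icc_self (hIoo m hm ht)))
    rw [hsm, hsp, show 2 * (τ / 2) = τ by ring] at h1
    have h2 : (B *ᵥ ρ m) i = (B *ᵥ fun j => Y 0 j ((m + 1 : ℕ) * τ)) i -
        (B *ᵥ fun j => Y 0 j (m * τ)) i - τ * (B *ᵥ fun j => Y 1 j (s m)) i := by
      have : ρ m = (fun j => Y 0 j ((m + 1 : ℕ) * τ)) - (fun j => Y 0 j (m * τ)) -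
          τ • fun j => Y 1 j (s m) := rfl
      rw [this, Matrix.mulVec_sub, Matrix.mulVec_sub, Matrix.mulVec_smul]
      rfl
    rw [h2]
    refine h1.trans ?_
    have : 0 ≤ Q * τ ^ 3 := by positivity
    linarith
  have he0 : e 0 = 0 := by
    ext i
    have h1 := hU.initial i
    have h2 := hu.initial _ (hgrid i)
    simp only [he, hY0]
    rw [dif_pos (by omega)]
    have : (⟨0, by omega⟩ : Fin (Nt + 1)) = 0 := rfl
    simp [this, h1, h2]
  have herr : ∀ m < (n : ℕ), ∀ i, e (m + 1) i - e m i =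
      τ * (dp (gridPoint xL xR Nx i) *
        ((B *ᵥ ((1 / 2 : ℝ) • (e (m + 1) + e m))) i + G m i)) + ρ m i := fun m hmn i => by
    have hm : m < Nt := by have := n.2; omega
    have h1 := congrFun (hU.step ⟨m, hm⟩) i
    have h2 := hu.pde _ (hgrid i) (s m) (Ioo_subset_Ioc_self (hsIoo m hm))
    have e1 : e (m + 1) = (fun j => Y 0 j ((m + 1 : ℕ) * τ)) - U (Fin.succ ⟨m, hm⟩) := by
      ext j
      simp only [he]
      rw [dif_pos (by omega)]
      rfl
    have e0 : e m = (fun j => Y 0 j (m * τ)) - U (Fin.castSucc ⟨m, hm⟩) := by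
      ext j
      simp only [he]
      rw [dif_pos (by omega)]
      rfl
    have hY1 : derivWithin (u (gridPoint xL xR Nx i)) (Icc 0 T) (s m) = Y 1 i (s m) := by
      simp only [hY, iteratedDerivWithin_one]
    rw [hY1, hdm' i] at h2
    simp only [Matrix.sub_mulVec, Matrix.add_mulVec, Matrix.one_mulVec, Matrix.smul_mulVec,
      Pi.sub_apply, Pi.add_apply, Pi.smul_apply, smul_eq_mul, spatialMatrix_mulVec hdm'] at h1
    rw [e1, e0]
    simp only [Matrix.mulVec_smul, Matrix.mulVec_add, Matrix.mulVec_sub, Pi.smul_apply,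
      Pi.add_apply, Pi.sub_apply, smul_eq_mul, hG, hρ, hV]
    simp only [← hB] at h1
    linear_combination τ * h2 - h1
  have hfin := error_le (B := B) (fun v => hσ.kernelMatrix_form_nonpos hα₁ hα₂ hσα hx hκ v)
    hd hdD hτ.le he0 (by positivity) hG_le hρ_le hBρ_le herr
  set X := τ ^ 2 + h ^ 4 with hX
  have hX0 : 0 ≤ X := by positivity
  have hnτ : (n : ℝ) * τ ≤ T := (hnode n (by have := n.2; omega)).2
  have hn0 : 0 ≤ (n : ℝ) * τ := by positivity
  have hτX : τ ^ 2 ≤ X := by rw [hX]; linarith [pow_nonneg hh.le 4]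
  have hsum := sum_error_le (Nat.cast_nonneg _) (Nat.cast_nonneg _) hτ.le hT.le hD0 hQ0 hM0 hnτ hτX hfin
  have hhN : h * ((Nx - 1 : ℕ) : ℝ) ≤ xR - xL := by
    have h1 : ((Nx - 1 : ℕ) : ℝ) ≤ Nx := by exact_mod_cast Nat.sub_le _ _
    calc h * ((Nx - 1 : ℕ) : ℝ) ≤ h * Nx := by gcongr
      _ = xR - xL := by
        have : (Nx : ℝ) ≠ 0 := by positivity
        rw [hh_def]; field_simp
  have hres := discreteNorm_le hh.le hhN hX0 (by positivity) hsum
  have hen : e n = fun i => u (gridPoint xL xR Nx i) ((n : ℝ) * τ) - U n i := by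
    ext i
    simp only [he, hY0]
    rw [dif_pos n.2]
  rw [← hen]
  exact hres

end

end WSLD

/-! ### Assembly: a constant independent of both mesh sizes -/

theorem theorem4p4 (α : ℝ) (hα₁ : 1 < α) (hα₂ : α < 2)
    (σ : WSLD.Shifts) (hσ : σ.Effective) (hσα : σ.Nondegenerate α)
    (xL xR T : ℝ) (hx : xL < xR) (hT : 0 < T)
    (dp dm : ℝ → ℝ) (hdp : ∀ x ∈ Set.Ioo xL xR, 0 ≤ dp x)
    (hdp_bdd : BddAbove (dp '' Set.Ioo xL xR))
    (κ : ℝ) (hκ : 0 ≤ κ) (hdm : ∀ x ∈ Set.Ioo xL xR, dm x = κ * dp x)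
    (f : ℝ → ℝ → ℝ) (u₀ : ℝ → ℝ) (u : ℝ → ℝ → ℝ)
    (hu : WSLD.IsExactSolution α xL xR T dp dm f u₀ u)
    (hu_smooth : WSLD.IsSmoothSolution α xL xR T u) :
    ∃ C : ℝ, 0 < C ∧ ∀ Nx Nt : ℕ, 1 ≤ Nx → 1 ≤ Nt →
      (∃! U : Fin (Nt + 1) → Fin (Nx - 1) → ℝ,
        WSLD.IsSchemeSolution α σ xL xR T dp dm f u₀ Nx Nt U) ∧
      ∀ U : Fin (Nt + 1) → Fin (Nx - 1) → ℝ,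
        WSLD.IsSchemeSolution α σ xL xR T dp dm f u₀ Nx Nt U →
        ∀ n : Fin (Nt + 1),
          WSLD.discreteNorm ((xR - xL) / Nx)
            (fun i => u (WSLD.gridPoint xL xR Nx i) ((n : ℝ) * (T / Nt)) - U n i) ≤
          C * ((T / Nt) ^ 2 + ((xR - xL) / Nx) ^ 4) := by
  obtain ⟨M, hM⟩ := hu_smooth.space
  obtain ⟨D₀, hD₀⟩ := hdp_bdd
  obtain ⟨K, hK, hcons⟩ := hσ.consistency hα₁ hα₂ hσα
  have hM0 : 0 ≤ M := (hM 0 ⟨le_rfl, hT.le⟩).1.bound_nonneg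
  set D := max D₀ 0 with hDdef
  have hD0 : 0 ≤ D := le_max_right _ _
  set Q := (1 + κ) * K * M with hQ
  have hQ0 : 0 ≤ Q := by positivity
  set C₀ := 2 * (T * D * ((1 + T) * Q)) ^ 2 + 2 * (T * M) ^ 2 with hC₀
  have hC₀0 : 0 ≤ C₀ := by positivity
  -- The added 1 makes the constant positive even when the square root vanishes.
  refine ⟨Real.sqrt ((xR - xL) * C₀) + 1, by positivity, fun Nx Nt hNx hNt => ?_⟩
  have hgrid : ∀ i : Fin (Nx - 1), WSLD.gridPoint xL xR Nx i ∈ Set.Ioo xL xR :=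
    WSLD.gridPoint_mem hx
  have hd : ∀ i : Fin (Nx - 1), 0 ≤ dp (WSLD.gridPoint xL xR Nx i) := fun i => hdp _ (hgrid i)
  have hdm' : ∀ i : Fin (Nx - 1), dm (WSLD.gridPoint xL xR Nx i) =
      κ * dp (WSLD.gridPoint xL xR Nx i) := fun i => hdm _ (hgrid i)
  have hdD : ∀ i : Fin (Nx - 1), dp (WSLD.gridPoint xL xR Nx i) ≤ D := fun i =>
    (hD₀ ⟨_, hgrid i, rfl⟩).trans (le_max_left _ _)
  refine ⟨WSLD.existsUnique_isSchemeSolution hα₁ hα₂ hσ hσα hx hκ hT.le hd hdm' f u₀,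
    fun U hU n => (hU.error_estimate hα₁ hα₂ hσ hσα hx hT hκ hK hD0 hd hdD hdm'
      (fun M w i => hcons xL xR M w Nx i hx) hu hu_smooth.time hM hNx hNt n).trans ?_⟩
  gcongr
  linarith
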